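/- Let $n\ge 1$, let $\mathcal O_n$ be the ring of germs of holomorphic functions $(\mathbb C^n,0)\to\mathbb C$ and $\mathfrak m=\mathfrak m_n$ its maximal ideal. For ideals $I_1,\dots,I_n$ of finite colength, let $e(I_1,\dots,I_n)$ be their mixed multiplicity, i.e. the coefficient of $t_1\cdots t_n$ in the polynomial of degree at most $n$ that gives the length of $\mathcal O_n/I_1^{t_1}\cdots I_n^{t_n}$ for all sufficiently large $t_1,\dots,t_n$. For proper ideals of finite colength put $$\sigma(I_1,\dots,I_n)=\max_{r\ge 1} e(I_1+\mathfrak m^r,\dots,I_n+\mathfrak m^r),$$ $$r(I_1,\dots,I_n)=\min\{r\ge 1:\ \sigma(I_1,\dots,I_n)=e(I_1+\mathfrak m^r,\dots,I_n+\mathfrak m^r)\},$$ $$\mathcal L_0(I_1,\dots,I_n)=\inf_{s\ge 1}\frac{r(I_1^s,\dots,I_n^s)}{s},$$ and, for $i\in\{1,\dots,n\}$, let $\mathcal L_0^{(i)}(I)=\mathcal L_0(I,\dots,I,\mathfrak m,\dots,\mathfrak m)$, with $I$ repeated $i$ times and $\mathfrak m$ repeated $n-i$ times. Two ideals $I,J$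 are called projectively equivalent if there are integers $a,b\ge 1$ such that $I^a$ and $J^b$ have the same integral closure. **Theorem.** Let $I$ and $J$ be proper ideals of $\mathcal O_n$ of finite colength. Then, for all $i\in\{1,\dots,n\}$, $$\mathcal L_0^{(i)}(IJ)\le \mathcal L_0^{(i)}(I)+\mathcal L_0^{(i)}(J).$$ Equality holds for all $i\in\{1,\dots,n\}$ if $I$ and $J$ are projectively equivalent or if $J=\mathfrak m_n$. Moreover, $\mathcal L_0^{(i)}(\mathfrak m_n I)=\mathcal L_0^{(i)}(I)+1$ for all $i\in\{1,\dots,n\}$. -/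

import Mathlib

open Filter Topology

section General

variable {R : Type*} [CommRing R]

/-- The integral closure of an ideal `I`, as a subset of `R`: the elements `x` satisfying an equation
`x ^ k + a₁ x ^ (k - 1) + ⋯ + a_k = 0` with `k ≥ 1` and `a_j ∈ I ^ j`. -/
def idealIntegralClosure (I : Ideal R) : Set R :=
  {x | ∃ k : ℕ, 1 ≤ k ∧ ∃ a : ℕ → R, (∀ j ∈ Finset.Icc 1 k, a j ∈ I ^ j) ∧
    x ^ k + ∑ j ∈ Finset.Icc 1 k, a j * x ^ (k - j) = 0}

/-- Two ideals are projectively equivalent if some positive powers of them have the same integral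
closure. -/
def ProjectivelyEquivalent (I J : Ideal R) : Prop :=
  ∃ a b : ℕ, 1 ≤ a ∧ 1 ≤ b ∧ idealIntegralClosure (I ^ a) = idealIntegralClosure (J ^ b)

/-- `I` has finite colength: the module `R ⧸ I` has finite length. -/
def HasFiniteColength (I : Ideal R) : Prop :=
  IsFiniteLength R (R ⧸ I)

/-- `e` is the mixed multiplicity of the ideals `I₁, …, Iₙ` (for `R` Noetherian local of dimension
`n` and `I_j` primary to the maximal ideal): the length of `R ⧸ I₁ ^ t₁ ⋯ Iₙ ^ tₙ` is, for all
sufficiently large `t₁, …, tₙ`, given by a polynomial in `t₁, …, tₙ` of total degree at most `n`,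
and `e` is the coefficient of `t₁ ⋯ tₙ` in it. -/
def IsMixedMultiplicity {n : ℕ} (I : Fin n → Ideal R) (e : ℕ) : Prop :=
  ∃ P : MvPolynomial (Fin n) ℚ, P.totalDegree ≤ n ∧
    (∃ N : ℕ, ∀ t : Fin n → ℕ, (∀ j, N ≤ t j) →
      ∃ l : ℕ, Module.length R (R ⧸ ∏ j, I j ^ t j) = (l : ℕ∞) ∧
        MvPolynomial.eval (fun j => (t j : ℚ)) P = (l : ℚ)) ∧
    P.coeff (Finsupp.equivFunOnFinite.symm fun _ => 1) = (e : ℚ)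

open Classical in
/-- The mixed multiplicity `e(I₁, …, Iₙ)`. -/
noncomputable def mixedMultiplicity {n : ℕ} (I : Fin n → Ideal R) : ℕ :=
  if h : ∃ e, IsMixedMultiplicity I e then h.choose else 0

variable [IsLocalRing R]

/-- `e(I₁ + 𝔪 ^ r, …, Iₙ + 𝔪 ^ r)`. -/
noncomputable def truncatedMixedMultiplicity {n : ℕ} (I : Fin n → Ideal R) (r : ℕ) : ℕ :=
  mixedMultiplicity fun j => I j + IsLocalRing.maximalIdeal R ^ r

/-- Rees' mixed multiplicity `σ(I₁, …, Iₙ)`, the maximum over `r ≥ 1` of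
`e(I₁ + 𝔪 ^ r, …, Iₙ + 𝔪 ^ r)` (infinite if these numbers are unbounded). -/
noncomputable def reesMixedMultiplicity {n : ℕ} (I : Fin n → Ideal R) : ℕ∞ :=
  ⨆ r : ℕ, ⨆ _ : 1 ≤ r, (truncatedMixedMultiplicity I r : ℕ∞)

/-- `r(I₁, …, Iₙ)`, the least `r ≥ 1` with `σ(I₁, …, Iₙ) = e(I₁ + 𝔪 ^ r, …, Iₙ + 𝔪 ^ r)`. -/
noncomputable def mixedOrder {n : ℕ} (I : Fin n → Ideal R) : ℕ :=
  sInf {r : ℕ | 1 ≤ r ∧ reesMixedMultiplicity I = (truncatedMixedMultiplicity I r : ℕ∞)}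

/-- The mixed Łojasiewicz exponent `𝓛₀(I₁, …, Iₙ)`, the infimum over `s ≥ 1` of
`r(I₁ ^ s, …, Iₙ ^ s) / s`. -/
noncomputable def mixedLojasiewicz {n : ℕ} (I : Fin n → Ideal R) : ℝ :=
  sInf {q : ℝ | ∃ s : ℕ, 1 ≤ s ∧ q = (mixedOrder fun j => I j ^ s : ℝ) / s}

/-- `𝓛₀⁽ⁱ⁾(I) = 𝓛₀(I, …, I, 𝔪, …, 𝔪)`, with `I` repeated `i` times and `𝔪` repeated `n - i` times
(`n` is the dimension of `R`). -/
noncomputable def lojasiewiczSeq (n i : ℕ) (I : Ideal R) : ℝ :=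
  mixedLojasiewicz fun j : Fin n => if (j : ℕ) < i then I else IsLocalRing.maximalIdeal R

end General

/-- The ring `𝒪ₙ` of germs at the origin of holomorphic functions `(ℂⁿ, 0) → ℂ`. -/
def holomorphicGerms (n : ℕ) : Subring (Germ (𝓝 (0 : Fin n → ℂ)) ℂ) where
  carrier := {g | ∃ f : (Fin n → ℂ) → ℂ, AnalyticAt ℂ f 0 ∧ (f : Germ (𝓝 (0 : Fin n → ℂ)) ℂ) = g}
  mul_mem' := by
    rintro _ _ ⟨f, hf, rfl⟩ ⟨g, hg, rfl⟩
    exact ⟨f * g, hf.mul hg, rfl⟩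
  one_mem' := ⟨1, analyticAt_const, rfl⟩
  add_mem' := by
    rintro _ _ ⟨f, hf, rfl⟩ ⟨g, hg, rfl⟩
    exact ⟨f + g, hf.add hg, rfl⟩
  zero_mem' := ⟨0, analyticAt_const, rfl⟩
  neg_mem' := by
    rintro _ ⟨f, hf, rfl⟩
    exact ⟨-f, hf.neg, rfl⟩

/-- Evaluation of a germ at the origin. -/
noncomputable def germEval (n : ℕ) : holomorphicGerms n →+* ℂ :=
  Germ.valueRingHom.comp (holomorphicGerms n).subtype

instance germEval_isLocalHom (n : ℕ) : IsLocalHom (germEval n) where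
  map_nonunit := by
    rintro ⟨_, f, hf, rfl⟩ h
    have h0 : f 0 ≠ 0 := h.ne_zero
    refine IsUnit.of_mul_eq_one ⟨((f⁻¹ : (Fin n → ℂ) → ℂ) : Germ (𝓝 (0 : Fin n → ℂ)) ℂ),
      f⁻¹, hf.inv h0, rfl⟩ ?_
    apply Subtype.ext
    refine Germ.coe_eq.2 ?_
    filter_upwards [hf.continuousAt.eventually_ne h0] with x hx
    exact mul_inv_cancel₀ hx

instance holomorphicGerms_isLocalRing (n : ℕ) : IsLocalRing (holomorphicGerms n) :=
  (germEval n).domain_isLocalRing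

/-- The maximal ideal `𝔪ₙ` consists of the germs that vanish at the origin. -/
theorem mem_maximalIdeal_holomorphicGerms {n : ℕ} (g : holomorphicGerms n) :
    g ∈ IsLocalRing.maximalIdeal (holomorphicGerms n) ↔ germEval n g = 0 := by
  rw [IsLocalRing.mem_maximalIdeal, mem_nonunits_iff, ← isUnit_map_iff (germEval n),
    isUnit_iff_ne_zero, not_not]

/-! An ideal of finite colength contains a power of `𝔪`, so it is extended from an ideal `Z` of the
polynomial ring that contains a power of the ideal of the variables (also written `𝔪` below), and
colengths can be computed there as dimensions over `ℂ`. Write `n = i + m`. The mixed multiplicity of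
`i` copies of `Y` and `m` copies of `𝔪` is the coefficient `hsCoeff Y i m` of `C(a, i) C(b, m)` in
the polynomial giving the codimension of `Y ^ a * 𝔪 ^ b`. With this, `𝓛₀⁽ⁱ⁾` becomes the infimum of
`r / s` over the pairs for which adding `𝔪 ^ r` to `Z ^ s` leaves this coefficient unchanged
(`lojasiewiczSeq_map_eq`).

Generic linear forms are superficial (`exists_superficial`), so `hsCoeff Y i m` is the ordinary
multiplicity of the restriction of `Y` to a generic linear subspace of dimension `i`
(`exists_section_hsCoeff_eq`). There Rees' theorem (`IsReductionOf.of_hsCoeff_top_eq`) turns equal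
multiplicities of `A ≤ A'` into the relation `A' N ≤ A N` for some primary `N`. This relation is
compatible with products and allows primary factors to be cancelled. By products, if `𝔪 ^ r` is
harmless for `I ^ s` and `𝔪 ^ r'` for `J ^ s`, then `𝔪 ^ (r + r')` is harmless for `(I J) ^ s`: this
is the inequality. By cancellation in `𝔪 ^ s (Z ^ s + 𝔪 ^ r)`, multiplying by `𝔪` raises the
exponent by exactly 1. In the projectively equivalent case, the exponent is homogeneous under powers
and unchanged by reductions, so everything is a multiple of the exponent of `I ^ a + J ^ b`.

Rees' theorem is proved on a chart of a blowup. If `x` is not integral over `A`, then `A/x`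
generates a proper ideal of `R[A/x]`, the colength of whose `t`-th power is at most the difference
of the colengths of `A ^ t` and `(A + (x)) ^ t`. A maximal ideal above it sits on a chain of primes
of full length, which forces this difference to grow with exponent the dimension, so the
multiplicities differ. -/

/-! ### Numerical polynomials and their growth -/

/-- A sequence that eventually agrees with a numerical polynomial: a rational linear combination of
binomial coefficients. -/
def IsEventuallyNumerical (f : ℕ → ℚ) : Prop :=
  ∃ (D : ℕ) (g : ℕ → ℚ) (N : ℕ), ∀ a, N ≤ a → f a = ∑ u ∈ Finset.range D, g u * (a.choose u : ℚ)

namespace IsEventuallyNumerical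

theorem of_eventually_zero {f : ℕ → ℚ} (N : ℕ) (h : ∀ a, N ≤ a → f a = 0) :
    IsEventuallyNumerical f :=
  ⟨0, 0, N, fun a ha => by simp [h a ha]⟩

theorem exists_le {f : ℕ → ℚ} (h : IsEventuallyNumerical f) :
    ∃ D₀, ∀ D, D₀ ≤ D → ∃ (g : ℕ → ℚ) (N : ℕ), ∀ a, N ≤ a →
      f a = ∑ u ∈ Finset.range D, g u * (a.choose u : ℚ) := by
  obtain ⟨D, g, N, h⟩ := h
  refine ⟨D, fun D' hD => ⟨fun u => if u < D then g u else 0, N, fun a ha => ?_⟩⟩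
  rw [h a ha, ← Finset.sum_subset (Finset.range_mono hD)]
  · exact Finset.sum_congr rfl fun u hu => by simp only [if_pos (Finset.mem_range.1 hu)]
  · intro u _ hu
    rw [Finset.mem_range] at hu
    simp [hu]

theorem sub {f f' : ℕ → ℚ} (h : IsEventuallyNumerical f) (h' : IsEventuallyNumerical f') :
    IsEventuallyNumerical (fun a => f a - f' a) := by
  obtain ⟨D, h⟩ := h.exists_le
  obtain ⟨D', h'⟩ := h'.exists_le
  obtain ⟨g, N, h⟩ := h (max D D') (le_max_left _ _)
  obtain ⟨g', N', h'⟩ := h' (max D D') (le_max_right _ _)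
  refine ⟨max D D', g - g', max N N', fun a ha => ?_⟩
  beta_reduce
  rw [h a (le_of_max_le_left ha), h' a (le_of_max_le_right ha), ← Finset.sum_sub_distrib]
  simp [sub_mul]

theorem congr {f f' : ℕ → ℚ} (h : IsEventuallyNumerical f) (N : ℕ) (h' : ∀ a, N ≤ a → f' a = f a) :
    IsEventuallyNumerical f' := by
  obtain ⟨D, g, N', h⟩ := h
  exact ⟨D, g, max N N', fun a ha => by
    rw [h' a (le_of_max_le_left ha), h a (le_of_max_le_right ha)]⟩

theorem shift {f : ℕ → ℚ} (h : IsEventuallyNumerical f) :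
    IsEventuallyNumerical (fun a => f (a + 1)) := by
  obtain ⟨D, g, N, h⟩ := h
  refine ⟨D, fun u => g u + if u + 1 < D then g (u + 1) else 0, N, fun a ha => ?_⟩
  beta_reduce
  rw [h (a + 1) (by omega)]
  simp only [add_mul, Finset.sum_add_distrib]
  cases D with
  | zero => simp
  | succ D =>
    rw [Finset.sum_range_succ' (fun u => g u * ((a + 1).choose u : ℚ)),
      Finset.sum_range_succ' (fun u => g u * (a.choose u : ℚ)),
      Finset.sum_range_succ (fun u => (if u + 1 < D + 1 then g (u + 1) else 0) * (a.choose u : ℚ))]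
    have : ∀ u ∈ Finset.range D, g (u + 1) * ((a + 1).choose (u + 1) : ℚ) =
        g (u + 1) * (a.choose (u + 1) : ℚ) +
          (if u + 1 < D + 1 then g (u + 1) else 0) * (a.choose u : ℚ) := by
      intro u hu
      rw [Finset.mem_range] at hu
      rw [Nat.choose_succ_succ, if_pos (by omega)]
      push_cast
      ring
    rw [Finset.sum_congr rfl this, Finset.sum_add_distrib]
    simp
    ring

/-- Discrete integration: by Pascal's rule `C(a, u + 1)` has difference `C(a, u)`, so the
coefficients shift up by one and the constant of integration becomes the coefficient of `C(a, 0)`.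
-/
theorem of_diff {f : ℕ → ℚ} (h : IsEventuallyNumerical fun a => f (a + 1) - f a) :
    IsEventuallyNumerical f := by
  obtain ⟨D, g, N, h⟩ := h
  set q : ℕ → ℚ := fun a => ∑ u ∈ Finset.range D, g u * (a.choose (u + 1) : ℚ) with hq
  have key : ∀ k, f (N + k) = f N - q N + q (N + k) := by
    intro k
    induction k with
    | zero => simp
    | succ k ih =>
      have h1 := h (N + k) (by omega)
      have h2 : q (N + k + 1) = q (N + k) + ∑ u ∈ Finset.range D, g u * ((N + k).choose u : ℚ) := by
        simp only [hq, ← Finset.sum_add_distrib]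
        refine Finset.sum_congr rfl fun u _ => ?_
        rw [Nat.choose_succ_succ]
        push_cast
        ring
      rw [← add_assoc, h2]
      linarith
  refine ⟨D + 1, fun u => Nat.casesOn u (f N - q N) g, N, fun a ha => ?_⟩
  obtain ⟨k, rfl⟩ := Nat.exists_eq_add_of_le ha
  rw [key, Finset.sum_range_succ']
  simp [hq]
  ring

end IsEventuallyNumerical

theorem tendsto_choose_div_pow {u D : ℕ} (h : u ≤ D) :
    Tendsto (fun a : ℕ => (a.choose u : ℝ) / (a : ℝ) ^ D) atTop
      (𝓝 (if u = D then 1 / (D.factorial : ℝ) else 0)) := by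
  have hu : Tendsto (fun a : ℕ => (a.choose u : ℝ) / (a : ℝ) ^ u) atTop
      (𝓝 (1 / (u.factorial : ℝ))) := by
    induction u with
    | zero => simp
    | succ u ih =>
      have h1 := ih (by omega)
      have h2 : Tendsto (fun a : ℕ => ((a : ℝ) - u) / a * (1 / (u + 1))) atTop
          (𝓝 (1 * (1 / (u + 1 : ℝ)))) := by
        refine Tendsto.mul_const _ ?_
        have : Tendsto (fun a : ℕ => 1 - (u : ℝ) / a) atTop (𝓝 (1 - 0)) :=
          tendsto_const_nhds.sub (tendsto_const_div_atTop_nhds_zero_nat _)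
        rw [sub_zero] at this
        refine this.congr' ?_
        filter_upwards [eventually_gt_atTop 0] with a ha
        have : (a : ℝ) ≠ 0 := by positivity
        field_simp
      have h3 := h1.mul h2
      have e : 1 / (u.factorial : ℝ) * (1 * (1 / (u + 1 : ℝ))) = 1 / ((u + 1).factorial : ℝ) := by
        rw [Nat.factorial_succ]
        push_cast
        field_simp
      rw [e] at h3
      refine h3.congr' ?_
      filter_upwards [eventually_ge_atTop (u + 1)] with a ha
      have ha' : (a : ℝ) ≠ 0 := by
        have : 0 < a := by omega
        positivity
      have := Nat.choose_succ_right_eq a u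
      have h4 : ((a.choose (u + 1) : ℕ) : ℝ) * (u + 1) = a.choose u * ((a : ℝ) - u) := by
        rw [← Nat.cast_sub (by omega : u ≤ a)]
        exact_mod_cast this
      have h5 : ((a.choose (u + 1) : ℕ) : ℝ) = a.choose u * ((a : ℝ) - u) / (u + 1) := by
        rw [← h4]
        field_simp
      rw [h5, pow_succ]
      field_simp
  rcases h.eq_or_lt with rfl | hlt
  · simpa using hu
  · rw [if_neg hlt.ne]
    have h1 : Tendsto (fun a : ℕ => ((a : ℝ) ^ (D - u))⁻¹) atTop (𝓝 0) :=
      tendsto_inv_atTop_zero.comp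
        ((tendsto_pow_atTop (by omega)).comp tendsto_natCast_atTop_atTop)
    have h2 := hu.mul h1
    rw [mul_zero] at h2
    refine h2.congr' ?_
    filter_upwards [eventually_gt_atTop 0] with a ha
    have : (a : ℝ) ≠ 0 := by positivity
    have e : (a : ℝ) ^ D = a ^ u * a ^ (D - u) := by rw [← pow_add]; congr 1; omega
    rw [e]
    field_simp

theorem tendsto_sum_choose_div_pow (D : ℕ) (g : ℕ → ℚ) :
    Tendsto (fun a : ℕ => ((∑ u ∈ Finset.range (D + 1), g u * (a.choose u : ℚ) : ℚ) : ℝ) /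
      (a : ℝ) ^ D) atTop (𝓝 ((g D : ℝ) / D.factorial)) := by
  have : Tendsto (fun a : ℕ => ∑ u ∈ Finset.range (D + 1),
      (g u : ℝ) * ((a.choose u : ℝ) / (a : ℝ) ^ D)) atTop
      (𝓝 (∑ u ∈ Finset.range (D + 1), (g u : ℝ) *
        (if u = D then 1 / (D.factorial : ℝ) else 0))) :=
    tendsto_finsetSum _ fun u hu => (tendsto_choose_div_pow
      (by rw [Finset.mem_range] at hu; omega)).const_mul _
  simp only [mul_ite, mul_zero, Finset.sum_ite_eq', Finset.mem_range, Nat.lt_succ_self,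
    if_true] at this
  convert this using 2 with a
  · push_cast
    rw [Finset.sum_div]
    exact Finset.sum_congr rfl fun u _ => by ring
  · ring

/-- Dividing by `a ^ D` isolates the top coefficient in the limit, and the growth bound makes that
limit zero as long as `D` exceeds `m`. Coefficients are peeled off from the top. -/
theorem coeff_eq_zero_of_growth {f : ℕ → ℚ} {g : ℕ → ℚ} {N m : ℕ} {K : ℝ} (D : ℕ)
    (h : ∀ a, N ≤ a → f a = ∑ u ∈ Finset.range D, g u * (a.choose u : ℚ))
    (hK : ∀ a, N ≤ a → |(f a : ℝ)| ≤ K * ((a : ℝ) + 1) ^ m) :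
    ∀ u, u < D → m < u → g u = 0 := by
  induction D with
  | zero => intro u hu; omega
  | succ D ih =>
    intro u hu hmu
    have hD : m < D → g D = 0 := by
      intro hmD
      have h1 := tendsto_sum_choose_div_pow D g
      -- For `a ≥ 1` one has `a + 1 ≤ 2 a`, and `m ≤ D - 1`, so this dominates the quotient by `a ^
      -- D`.
      have h2 : Tendsto (fun a : ℕ => K * 2 ^ m * ((a : ℝ))⁻¹) atTop (𝓝 0) := by
        have := (tendsto_inv_atTop_zero.comp
          (tendsto_natCast_atTop_atTop (R := ℝ))).const_mul (K * 2 ^ m)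
        simpa using this
      have h3 : Tendsto (fun a : ℕ => ((∑ u ∈ Finset.range (D + 1), g u * (a.choose u : ℚ) : ℚ) : ℝ) /
          (a : ℝ) ^ D) atTop (𝓝 0) := by
        refine squeeze_zero_norm' ?_ h2
        filter_upwards [eventually_ge_atTop (max N 1)] with a ha
        have hN : N ≤ a := le_of_max_le_left ha
        have h1a : (1 : ℝ) ≤ a := by exact_mod_cast le_of_max_le_right ha
        rw [← h a hN, Real.norm_eq_abs, abs_div, abs_of_nonneg (by positivity : (0 : ℝ) ≤ (a : ℝ) ^ D),
          div_le_iff₀ (by positivity)]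
        have hK0 : 0 ≤ K := by
          have := (abs_nonneg _).trans (hK a hN)
          by_contra hneg
          have : K * ((a : ℝ) + 1) ^ m < 0 := mul_neg_of_neg_of_pos (not_le.1 hneg) (by positivity)
          linarith
        calc |(f a : ℝ)| ≤ K * ((a : ℝ) + 1) ^ m := hK a hN
          _ ≤ K * (2 * (a : ℝ)) ^ m := by gcongr; linarith
          _ = K * 2 ^ m * (a : ℝ) ^ m := by rw [mul_pow]; ring
          _ ≤ K * 2 ^ m * (a : ℝ) ^ (D - 1) := by gcongr; omega
          _ = K * 2 ^ m * (a : ℝ)⁻¹ * (a : ℝ) ^ D := by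
            obtain ⟨E, rfl⟩ : ∃ E, D = E + 1 := ⟨D - 1, by omega⟩
            rw [Nat.add_sub_cancel, pow_succ]
            field_simp
      have := tendsto_nhds_unique h1 h3
      have hf : (D.factorial : ℝ) ≠ 0 := by positivity
      rw [div_eq_zero_iff] at this
      exact_mod_cast this.resolve_right hf
    by_cases hDm : m < D
    · rcases Nat.lt_succ_iff_lt_or_eq.1 hu with h' | rfl
      · refine ih (fun a ha => ?_) u h' hmu
        rw [h a ha, Finset.sum_range_succ, hD hDm, zero_mul, add_zero]
      · exact hD hDm
    · omega

/-- The top coefficient of an eventually integer valued combination of binomial coefficients is an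
integer. -/
theorem exists_int_top_coeff (D : ℕ) : ∀ {f : ℕ → ℤ} {g : ℕ → ℚ} {N : ℕ},
    (∀ a, N ≤ a → (f a : ℚ) = ∑ u ∈ Finset.range (D + 1), g u * (a.choose u : ℚ)) →
    ∃ z : ℤ, g D = z := by
  induction D with
  | zero => intro f g N h; exact ⟨f N, by simpa using (h N le_rfl).symm⟩
  | succ D ih =>
    intro f g N h
    -- Taking differences keeps the values integral and lowers the index of the top coefficient by
    -- one.
    refine ih (f := fun a => f (a + 1) - f a) (g := fun u => g (u + 1)) (N := N) fun a ha => ?_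
    push_cast
    rw [h a ha, h (a + 1) (by omega), Finset.sum_range_succ', Finset.sum_range_succ' _ (D + 1),
      add_sub_add_comm, ← Finset.sum_sub_distrib]
    simp only [Nat.choose_zero_right, sub_self, add_zero]
    refine Finset.sum_congr rfl fun u _ => ?_
    rw [Nat.choose_succ_succ]
    push_cast
    ring

/-! ### Codimension of ideals and multiplication sequences -/

section Codim

variable (K : Type*) [Field K] {R : Type*} [CommRing R] [Algebra K R]

/-- The dimension of `R ⧸ X` over the field `K`. -/
noncomputable def codim (X : Ideal R) : ℕ := Module.finrank K (R ⧸ X)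

/-- `R ⧸ X` is finite-dimensional over the field `K`. -/
abbrev FinCodim (X : Ideal R) : Prop := Module.Finite K (R ⧸ X)

variable {K}

theorem FinCodim.mono {X Y : Ideal R} (h : FinCodim K X) (hXY : X ≤ Y) : FinCodim K Y :=
  Module.Finite.of_surjective (Ideal.Quotient.factorₐ K hXY).toLinearMap
    (Ideal.Quotient.factor_surjective hXY)

theorem codim_mono {X Y : Ideal R} (h : FinCodim K X) (hXY : X ≤ Y) : codim K Y ≤ codim K X :=
  LinearMap.finrank_le_finrank_of_surjective (f := (Ideal.Quotient.factorₐ K hXY).toLinearMap)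
    (Ideal.Quotient.factor_surjective hXY)

theorem codim_eq_add_finrank_ker {X Y : Ideal R} (h : FinCodim K X) (hXY : X ≤ Y) :
    codim K X = codim K Y +
      Module.finrank K (LinearMap.ker (Ideal.Quotient.factorₐ K hXY).toLinearMap) := by
  have := LinearMap.finrank_range_add_finrank_ker (Ideal.Quotient.factorₐ K hXY).toLinearMap
  rw [LinearMap.range_eq_top.2 (Ideal.Quotient.factor_surjective hXY), finrank_top] at this
  exact this.symm

/-- Multiplication by `x` induces an isomorphism from `N / (N ∩ (N' : x))` onto `(N' + x N) / N'`;
the formula compares the dimensions of the two sides. -/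
theorem codim_add_codim {N N' : Ideal R} (x : R) (h' : FinCodim K N')
    (hK : FinCodim K (N ⊓ N'.colon {x})) :
    codim K (N ⊓ N'.colon {x}) + codim K (N' ⊔ Ideal.span {x} * N) =
      codim K N' + codim K N := by
  set Z := N ⊓ N'.colon {x} with hZ
  set S := N' ⊔ Ideal.span {x} * N with hS
  have hZN : Z ≤ N := inf_le_left
  have hNS : N' ≤ S := le_sup_left
  have e1 := codim_eq_add_finrank_ker hK hZN
  have e2 := codim_eq_add_finrank_ker h' hNS
  have hmem : ∀ y, y ∈ Z ↔ y ∈ N ∧ y * x ∈ N' := fun y => by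
    rw [hZ, Submodule.mem_inf, Submodule.mem_colon_singleton]; rfl
  let T : (R ⧸ Z) →ₗ[K] (R ⧸ N') :=
    (Submodule.mapQ Z N' (LinearMap.mulLeft R x) (fun y hy => by
      have := ((hmem y).1 hy).2
      rw [mul_comm] at this
      exact this)).restrictScalars K
  have hT : ∀ y : R, T (Ideal.Quotient.mk Z y) = Ideal.Quotient.mk N' (x * y) := fun y => rfl
  have hkZ : ∀ y : R, Ideal.Quotient.mk Z y ∈
      LinearMap.ker (Ideal.Quotient.factorₐ K hZN).toLinearMap ↔ y ∈ N := fun y => by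
    rw [LinearMap.mem_ker]
    exact Ideal.Quotient.eq_zero_iff_mem
  have hkS : ∀ y : R, Ideal.Quotient.mk N' y ∈
      LinearMap.ker (Ideal.Quotient.factorₐ K hNS).toLinearMap ↔ y ∈ S := fun y => by
    rw [LinearMap.mem_ker]
    exact Ideal.Quotient.eq_zero_iff_mem
  have hmaps : ∀ v ∈ LinearMap.ker (Ideal.Quotient.factorₐ K hZN).toLinearMap,
      T v ∈ LinearMap.ker (Ideal.Quotient.factorₐ K hNS).toLinearMap := by
    intro v hv
    obtain ⟨y, rfl⟩ := Ideal.Quotient.mk_surjective v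
    rw [hT, hkS]
    exact Ideal.mem_sup_right (Ideal.mul_mem_mul (Ideal.mem_span_singleton_self x) ((hkZ y).1 hv))
  have hbij : Function.Bijective (T.restrict hmaps) := by
    constructor
    · rw [← LinearMap.ker_eq_bot, LinearMap.ker_eq_bot']
      rintro ⟨v, hv⟩ h
      obtain ⟨y, rfl⟩ := Ideal.Quotient.mk_surjective v
      have h1 : T (Ideal.Quotient.mk Z y) = 0 := congrArg Subtype.val h
      rw [hT, Ideal.Quotient.eq_zero_iff_mem, mul_comm] at h1
      have h2 : y ∈ Z := (hmem y).2 ⟨(hkZ y).1 hv, h1⟩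
      exact Subtype.ext (Ideal.Quotient.eq_zero_iff_mem.2 h2)
    · rintro ⟨v, hv⟩
      obtain ⟨w, rfl⟩ := Ideal.Quotient.mk_surjective v
      obtain ⟨n, hn, m, hm, rfl⟩ := Submodule.mem_sup.1 ((hkS w).1 hv)
      obtain ⟨y, hy, rfl⟩ := Ideal.mem_span_singleton_mul.1 hm
      refine ⟨⟨Ideal.Quotient.mk Z y, (hkZ y).2 hy⟩, Subtype.ext ?_⟩
      change T (Ideal.Quotient.mk Z y) = Ideal.Quotient.mk N' (n + x * y)
      rw [hT, map_add, Ideal.Quotient.eq_zero_iff_mem.2 hn, zero_add]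
  have e3 := (LinearEquiv.ofBijective _ hbij).finrank_eq
  omega

/-- The multiplication sequence `0 → R ⧸ (X : x) → R ⧸ X → R ⧸ (X + x) → 0`. -/
theorem codim_colon_add {X : Ideal R} (x : R) (h : FinCodim K X) :
    codim K (X.colon {x}) + codim K (X ⊔ Ideal.span {x}) = codim K X := by
  have hX : X ≤ X.colon {x} := fun y hy => by
    rw [Submodule.mem_colon_singleton]
    exact X.mul_mem_right x hy
  have := codim_add_codim (K := K) (N := ⊤) x h (by rw [top_inf_eq]; exact h.mono hX)
  rw [top_inf_eq, Ideal.mul_top] at this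
  rw [this]
  have : codim K (⊤ : Ideal R) = 0 := by
    unfold codim
    have : Subsingleton (R ⧸ (⊤ : Ideal R)) := Ideal.Quotient.subsingleton_iff.2 rfl
    exact Module.finrank_zero_of_subsingleton
  omega

theorem FinCodim.of_colon {X : Ideal R} (x : R) (h₁ : FinCodim K (X.colon {x}))
    (h₂ : FinCodim K (X ⊔ Ideal.span {x})) : FinCodim K X := by
  have hle : X ≤ X ⊔ Ideal.span {x} := le_sup_left
  let f := (Ideal.Quotient.factorₐ K hle).toLinearMap
  have hmem : ∀ y, y ∈ X.colon {x} ↔ y * x ∈ X := fun y => Submodule.mem_colon_singleton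
  let T : (R ⧸ X.colon {x}) →ₗ[K] (R ⧸ X) :=
    (Submodule.mapQ (X.colon {x}) X (LinearMap.mulLeft R x) (fun y hy => by
      have := (hmem y).1 hy
      rw [mul_comm] at this
      exact this)).restrictScalars K
  have hker : (LinearMap.ker f) ≤ LinearMap.range T := by
    intro v hv
    obtain ⟨w, rfl⟩ := Ideal.Quotient.mk_surjective v
    have hw : w ∈ X ⊔ Ideal.span {x} := Ideal.Quotient.eq_zero_iff_mem.1 hv
    obtain ⟨n, hn, m, hm, rfl⟩ := Submodule.mem_sup.1 hw
    obtain ⟨y, rfl⟩ := Ideal.mem_span_singleton'.1 hm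
    refine ⟨Ideal.Quotient.mk _ y, ?_⟩
    change Ideal.Quotient.mk X (x * y) = _
    rw [map_add, Ideal.Quotient.eq_zero_iff_mem.2 hn, zero_add, mul_comm]
  have : Module.Finite K (LinearMap.ker f) := Submodule.finiteDimensional_of_le hker
  have : Module.Finite K (LinearMap.range f) :=
    Module.Finite.equiv (LinearEquiv.ofTop _ (LinearMap.range_eq_top.2
      (Ideal.Quotient.factor_surjective hle))).symm
  have : Module.Finite K ((R ⧸ X) ⧸ LinearMap.ker f) :=
    Module.Finite.equiv f.quotKerEquivRange.symm
  exact Module.Finite.of_submodule_quotient (LinearMap.ker f)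

end Codim

/-! ### Hilbert–Samuel functions of filtrations -/

section Hilbert

variable {K : Type*} [Field K] {R : Type*} [CommRing R] [Algebra K R]

/-- The Hilbert–Samuel theorem for pairs of filtrations. -/
theorem isEventuallyNumerical_codim_sub [IsNoetherianRing R] {Y : Ideal R} {gens : Finset R}
    (hgens : Ideal.span (gens : Set R) = Y) (F : Y.Filtration R) (τ : Finset R) :
    ∀ (F₁ F₂ : Y.Filtration R), F.Stable → F₁ ≤ F → F₂ ≤ F₁ →
    (∀ a, FinCodim K (F₂.N a)) →
    (∀ x ∈ gens, x ∉ τ → ∀ a, ∀ y ∈ F₁.N a, x * y ∈ F₂.N (a + 1)) →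
    IsEventuallyNumerical fun a => (codim K (F₂.N a) : ℚ) - codim K (F₁.N a) := by
  classical
  induction τ using Finset.induction_on with
  | empty =>
    intro F₁ F₂ hF h₁ h₂ _ hx
    -- By Artin–Rees `F₁` inherits stability from `F`, so eventually `F₁ (b + 1) = Y F₁ b`. All
    -- generators send `F₁ b` into `F₂ (b + 1)`, and the two filtrations eventually agree.
    obtain ⟨c, hc⟩ := hF.of_le h₁
    refine .of_eventually_zero (c + 1) fun a ha => ?_
    obtain ⟨b, rfl⟩ : ∃ b, a = b + 1 := ⟨a - 1, by omega⟩
    have : F₂.N (b + 1) = F₁.N (b + 1) := by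
      refine le_antisymm (h₂ _) ?_
      subst hgens
      rw [← hc b (by omega), Submodule.smul_le]
      intro z hz y hy
      induction hz using Submodule.span_induction with
      | mem x hxg => exact hx x hxg (by simp) b y hy
      | zero => simp
      | add u v _ _ hu hv => rw [add_smul]; exact add_mem hu hv
      | smul r u _ hu => rw [smul_assoc]; exact Submodule.smul_mem _ r hu
    rw [this, sub_self]
  | insert x τ hxτ ih =>
    intro F₁ F₂ hF h₁ h₂ hfin hx
    by_cases hxg : x ∈ gens
    swap
    · refine ih F₁ F₂ hF h₁ h₂ hfin fun z hz hzτ => hx z hz fun h => ?_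
      rcases Finset.mem_insert.1 h with rfl | h
      exacts [hxg hz, hzτ h]
    have hxY : x ∈ Y := hgens ▸ Ideal.subset_span hxg
    have hmul : ∀ (G : Y.Filtration R) (a : ℕ) (z : R), z ∈ Y → ∀ y ∈ G.N a, z * y ∈ G.N (a + 1) :=
      fun G a z hz y hy => G.smul_le a (Submodule.smul_mem_smul hz hy)
    -- `Ker / F₂` and `F₁ / Cok` are the kernel and, up to a shift, the cokernel of multiplication
    -- by `x` on `F₁ / F₂`. Both are killed by `x`, so the induction hypothesis, with one generator
    -- fewer left to control, applies to them.
    let Ker : Y.Filtration R :=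
      { N := fun a => F₁.N a ⊓ (F₂.N (a + 1)).colon {x}
        mono := fun a => inf_le_inf (F₁.mono a) (Submodule.colon_mono (F₂.mono _) le_rfl)
        smul_le := fun a => by
          rw [Submodule.smul_le]
          rintro z hz y ⟨hy, hy'⟩
          refine ⟨hmul F₁ a z hz y hy, ?_⟩
          rw [SetLike.mem_coe, Submodule.mem_colon_singleton] at hy' ⊢
          rw [smul_assoc]
          exact hmul F₂ _ z hz _ hy' }
    let Cok : Y.Filtration R :=
      { N := fun a => F₂.N a ⊔ Ideal.span {x} * F₁.N (a - 1)
        mono := fun a => sup_le_sup (F₂.mono a) (Ideal.mul_mono_right (F₁.antitone (by omega)))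
        smul_le := fun a => by
          rw [Submodule.smul_sup]
          refine sup_le_sup (F₂.smul_le a) ?_
          rw [smul_eq_mul, mul_left_comm]
          refine Ideal.mul_mono_right ?_
          rcases a with _ | a
          · exact Ideal.mul_le_right
          · exact F₁.smul_le a }
    have hKerF₁ : Ker ≤ F₁ := fun a => inf_le_left
    have hF₂Ker : F₂ ≤ Ker := fun a => le_inf (h₂ a) fun y hy => by
      rw [Submodule.mem_colon_singleton, smul_eq_mul, mul_comm]
      exact hmul F₂ a x hxY y hy
    have hF₂Cok : F₂ ≤ Cok := fun a => le_sup_left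
    -- eventually the cokernel filtration is a subfiltration, so we cut with `F₁`
    have hker := ih Ker F₂ hF (hKerF₁.trans h₁) hF₂Ker hfin (by
      intro z hz hzτ a y hy
      by_cases hzx : z = x
      · subst hzx
        have := hy.2
        rw [SetLike.mem_coe, Submodule.mem_colon_singleton, smul_eq_mul, mul_comm] at this
        exact this
      · exact hx z hz (by simp [hzx, hzτ]) a y hy.1)
    have hcok := ih F₁ (Cok ⊓ F₁) hF h₁ inf_le_right
      (fun a => (hfin a).mono (le_inf (hF₂Cok a) (h₂ a))) (by
        intro z hz hzτ a y hy
        refine ⟨?_, hmul F₁ a z (hgens ▸ Ideal.subset_span hz) y hy⟩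
        by_cases hzx : z = x
        · subst hzx
          exact Ideal.mem_sup_right (Ideal.mul_mem_mul (Ideal.mem_span_singleton_self z) hy)
        · exact hF₂Cok (a + 1) (hx z hz (by simp [hzx, hzτ]) a y hy))
    -- The first difference of the codimension of `F₁ / F₂` is the length of the cokernel minus that
    -- of the kernel.
    refine .of_diff ((hcok.shift.sub hker).congr 0 fun a _ => ?_)
    have hc : (Cok ⊓ F₁).N (a + 1) = F₂.N (a + 1) ⊔ Ideal.span {x} * F₁.N a := by
      refine le_antisymm inf_le_left (le_inf le_rfl (sup_le (h₂ _) ?_))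
      rw [Ideal.span_singleton_mul_le_iff]
      exact fun y hy => hmul F₁ a x hxY y hy
    have := codim_add_codim (K := K) (N := F₁.N a) x (hfin (a + 1)) ((hfin a).mono (hF₂Ker a))
    have hk : Ker.N a = F₁.N a ⊓ (F₂.N (a + 1)).colon {x} := rfl
    rw [hc, hk]
    have : (codim K (F₁.N a ⊓ (F₂.N (a + 1)).colon {x}) : ℚ) +
        codim K (F₂.N (a + 1) ⊔ Ideal.span {x} * F₁.N a) =
        codim K (F₂.N (a + 1)) + codim K (F₁.N a) := by exact_mod_cast this
    linarith

/-- The Hilbert–Samuel function of an ideal `Y` on an ideal `W` is eventually a numerical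
polynomial. -/
theorem isEventuallyNumerical_codim_pow_mul [IsNoetherianRing R] (Y W : Ideal R)
    (hfin : ∀ a, FinCodim K (Y ^ a * W)) :
    IsEventuallyNumerical fun a => (codim K (Y ^ a * W) : ℚ) := by
  obtain ⟨gens, hgens⟩ := IsNoetherian.noetherian Y
  let F := Y.stableFiltration W
  let F' : Y.Filtration R :=
    { N := fun a => Y ^ (a + 1) * W
      mono := fun a => F.mono (a + 1)
      smul_le := fun a => F.smul_le (a + 1) }
  -- Putting all generators into `τ` makes the annihilation hypothesis vacuous; the pair `Y ^ (a +
  -- 1) W ≤ Y ^ a W` gives the first difference of the function wanted.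
  have := isEventuallyNumerical_codim_sub (K := K) hgens F gens F F' (Y.stableFiltration_stable W)
    le_rfl (fun a => F.mono a) (fun a => hfin (a + 1)) (fun x hx hx' => absurd hx hx')
  exact .of_diff this

end Hilbert

/-! ### Superficial elements via Rees algebras -/

section Superficial

open Polynomial

variable {S : Type*} [CommRing S]

/-- The ideal of the Rees algebra of `M` whose degree `b` part is `Y * M ^ (b + 1)`. -/
def reesIdeal (Y M : Ideal S) : Ideal (reesAlgebra M) where
  carrier := {p | ∀ b, (p : S[X]).coeff b ∈ Y * M ^ (b + 1)}
  zero_mem' := fun b => by simp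
  add_mem' := fun {p q} hp hq b => by simpa using add_mem (hp b) (hq b)
  smul_mem' := fun q p hp b => by
    rw [smul_eq_mul, MulMemClass.coe_mul, coeff_mul]
    refine sum_mem fun ij hij => ?_
    rw [Finset.HasAntidiagonal.mem_antidiagonal] at hij
    have := Ideal.mul_mem_mul (q.2 ij.1) (hp ij.2)
    rw [mul_left_comm, ← pow_add] at this
    rwa [show b + 1 = ij.1 + (ij.2 + 1) by omega]

/-- The homogeneous element `y t ^ b` of the Rees algebra. -/
noncomputable def reesMonomial (M : Ideal S) (b : ℕ) (y : S) (hy : y ∈ M ^ b) : reesAlgebra M :=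
  ⟨monomial b y, reesAlgebra.monomial_mem.2 hy⟩

theorem reesMonomial_mul {M : Ideal S} {b b' : ℕ} {y y' : S} (hy : y ∈ M ^ b) (hy' : y' ∈ M ^ b') :
    reesMonomial M b y hy * reesMonomial M b' y' hy' =
      reesMonomial M (b + b') (y * y') (by rw [pow_add]; exact Ideal.mul_mem_mul hy hy') :=
  Subtype.ext (monomial_mul_monomial b b' y y')

theorem reesMonomial_mem_reesIdeal {Y M : Ideal S} {b : ℕ} {y : S} (hy : y ∈ M ^ b) :
    reesMonomial M b y hy ∈ reesIdeal Y M ↔ y ∈ Y * M ^ (b + 1) := by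
  constructor
  · intro h
    have := h b
    rwa [reesMonomial, coeff_monomial, if_pos rfl] at this
  · intro h b'
    rw [reesMonomial, coeff_monomial]
    split_ifs with hb
    · rwa [← hb]
    · exact zero_mem _

/-- If a power of the ideal generated by the degree-one generators lies in a primary component, this
places all of `M ^ k`, in degree `k`, in that component. -/
theorem reesMonomial_mem_span_pow {ι : Type*} {z : ι → S} {M : Ideal S}
    (hM : M = Ideal.span (Set.range z)) (hz : ∀ i, z i ∈ M ^ 1) (k : ℕ) :
    ∀ (w : S) (hw : w ∈ M ^ k), reesMonomial M k w hw ∈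
      Ideal.span (Set.range fun i => reesMonomial M 1 (z i) (hz i)) ^ k := by
  have h1 : ∀ (w : S) (hw : w ∈ M ^ 1), reesMonomial M 1 w hw ∈
      Ideal.span (Set.range fun i => reesMonomial M 1 (z i) (hz i)) := by
    intro w hw
    have hw' : w ∈ Ideal.span (Set.range z) := by rwa [pow_one, hM] at hw
    induction hw' using Submodule.span_induction with
    | mem x hx =>
      obtain ⟨i, rfl⟩ := hx
      exact Ideal.subset_span ⟨i, rfl⟩
    | zero =>
      have : reesMonomial M 1 0 hw = 0 := Subtype.ext (by simp [reesMonomial])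
      rw [this]
      exact zero_mem _
    | add u v hu hv ihu ihv =>
      have hu' : u ∈ M ^ 1 := by rwa [pow_one, hM]
      have hv' : v ∈ M ^ 1 := by rwa [pow_one, hM]
      convert add_mem (ihu hu') (ihv hv')
      exact Subtype.ext (by simp [reesMonomial])
    | smul r u hu ihu =>
      have hu' : u ∈ M ^ 1 := by rwa [pow_one, hM]
      convert Submodule.smul_of_tower_mem _ r (ihu hu')
      exact Subtype.ext (by simp [reesMonomial, smul_monomial])
  induction k with
  | zero => intro w hw; simp
  | succ k ih =>
    intro w hw
    have hw' : w ∈ M ^ k * M ^ 1 := by rwa [← pow_add]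
    induction hw' using Submodule.mul_induction_on' with
    | mem_mul_mem a ha b hb =>
      rw [← reesMonomial_mul ha hb, pow_succ]
      exact Ideal.mul_mem_mul (ih a ha) (h1 b hb)
    | add u hu v hv ihu ihv =>
      have hu' : u ∈ M ^ (k + 1) := by rwa [pow_add]
      have hv' : v ∈ M ^ (k + 1) := by rwa [pow_add]
      convert add_mem (ihu hu') (ihv hv')
      exact Subtype.ext (by simp [reesMonomial])

/-- A filtration whose `b`-th term is multiplied into `Y * M ^ (k + b + 1)` by `M ^ k` eventually
lies in `Y * M ^ (b + 1)`. -/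
theorem exists_le_mul_pow_of_pow_mul_le [IsNoetherianRing S] (Y M : Ideal S) (k : ℕ) :
    ∃ B, ∀ b, B ≤ b → ∀ y ∈ M ^ b, (∀ w ∈ M ^ k, w * y ∈ Y * M ^ (k + b + 1)) →
      y ∈ Y * M ^ (b + 1) := by
  let N : M.Filtration S :=
    { N := fun b => M ^ b ⊓ (Y * M ^ (k + b + 1)).colon (M ^ k : Ideal S)
      mono := fun b => inf_le_inf (Ideal.pow_le_pow_right (Nat.le_succ b))
        (Submodule.colon_mono (Ideal.mul_mono_right (Ideal.pow_le_pow_right (by omega))) le_rfl)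
      smul_le := fun b => by
        rw [Submodule.smul_le]
        rintro z hz y ⟨hy, hy'⟩
        refine ⟨?_, ?_⟩
        · rw [pow_succ']
          exact Ideal.mul_mem_mul hz hy
        · rw [SetLike.mem_coe, Submodule.mem_colon] at hy' ⊢
          intro w hw
          have := Ideal.mul_mem_mul hz (hy' w hw)
          rw [mul_left_comm, ← pow_succ'] at this
          simpa [mul_assoc, add_assoc] using this }
  have hN : N.Stable := (M.stableFiltration_stable (⊤ : Ideal S)).of_le fun b => by
    change _ ≤ M ^ b • (⊤ : Ideal S)
    rw [smul_eq_mul, Ideal.mul_top]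
    exact inf_le_left
  obtain ⟨n₀, hn₀⟩ := hN.exists_pow_smul_eq
  refine ⟨n₀ + k, fun b hb y hy h => ?_⟩
  obtain ⟨d, rfl⟩ := Nat.exists_eq_add_of_le hb
  have hyN : y ∈ N.N (n₀ + k + d) := by
    refine ⟨hy, ?_⟩
    rw [SetLike.mem_coe, Submodule.mem_colon]
    intro w hw
    rw [smul_eq_mul, mul_comm y w]
    exact h w hw
  have e : N.N (n₀ + k + d) = M ^ k • N.N (n₀ + d) := by
    rw [show n₀ + k + d = n₀ + (k + d) by omega, hn₀, hn₀, pow_add, mul_smul]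
  rw [e] at hyN
  refine Submodule.smul_induction_on hyN (fun w hw n hn => ?_) fun u v hu hv => add_mem hu hv
  have := hn.2
  rw [SetLike.mem_coe, Submodule.mem_colon] at this
  have := this w hw
  rw [smul_eq_mul, mul_comm n w, show k + (n₀ + d) = n₀ + k + d by omega] at this
  exact this

/-- Decompose the ideal with graded pieces `Y * M ^ (b + 1)` into primary ideals. A linear form
avoiding the radicals of the components that do not contain a power of the degree-one part can be
cancelled there; the remaining components affect only low degrees. -/
theorem exists_superficial_step {K : Type*} [Field K] [Algebra K S] [IsNoetherianRing S]
    {ι : Type*} [Fintype ι] (z : ι → S) {M : Ideal S} (hM : M = Ideal.span (Set.range z))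
    (Y : Ideal S) :
    ∃ V : Finset (Submodule K (ι → K)), ⊤ ∉ V ∧ ∀ c : ι → K, (∀ W ∈ V, c ∉ W) →
      ∃ B, ∀ b, B ≤ b → ∀ y ∈ M ^ b, (∑ i, c i • z i) * y ∈ Y * M ^ (b + 2) →
        y ∈ Y * M ^ (b + 1) := by
  classical
  have hz : ∀ i, z i ∈ M ^ 1 := fun i => by
    rw [pow_one, hM]
    exact Ideal.subset_span ⟨i, rfl⟩
  obtain ⟨s, hs, hprim⟩ := Submodule.isLasker (reesAlgebra M) (reesAlgebra M) (reesIdeal Y M)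
  let zt : ι → reesAlgebra M := fun i => reesMonomial M 1 (z i) (hz i)
  let lin : (ι → K) →ₗ[K] reesAlgebra M := ∑ i, (LinearMap.proj i).smulRight (zt i)
  have hlin : ∀ c, lin c = ∑ i, c i • zt i := fun c => by simp [lin]
  -- `V q` consists of the coefficient vectors whose linear form lies in the radical of `q`. It is
  -- the whole space exactly when that radical contains all degree-one generators.
  let V : Ideal (reesAlgebra M) → Submodule K (ι → K) := fun q =>
    (q.radical.restrictScalars K).comap lin
  have hV : ∀ q c, c ∈ V q ↔ lin c ∈ q.radical := fun q c => Iff.rfl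
  refine ⟨(s.image V).erase ⊤, by simp, fun c hc => ?_⟩
  set h := ∑ i, c i • z i with hh
  have hhM : h ∈ M ^ 1 := by
    rw [hh]
    refine sum_mem fun i _ => ?_
    rw [Algebra.smul_def]
    exact Ideal.mul_mem_left _ _ (hz i)
  have hch : lin c = reesMonomial M 1 h hhM := by
    rw [hlin]
    refine Subtype.ext ?_
    rw [AddSubmonoidClass.coe_finsetSum]
    simp only [zt, reesMonomial, hh, map_sum]
    exact Finset.sum_congr rfl fun i _ => smul_monomial _ _ _
  have hk : ∀ q : Ideal (reesAlgebra M), ∃ k : ℕ, V q = ⊤ →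
      Ideal.span (Set.range zt) ^ k ≤ q := by
    intro q
    by_cases hq : V q = ⊤
    · have hle : Ideal.span (Set.range zt) ≤ q.radical := by
        rw [Ideal.span_le]
        rintro _ ⟨i, rfl⟩
        have : Pi.single i 1 ∈ V q := hq ▸ Submodule.mem_top
        rw [hV, hlin] at this
        simpa [Pi.single_apply, ite_smul] using this
      obtain ⟨k, hk⟩ := Ideal.exists_pow_le_of_le_radical_of_fg hle (IsNoetherian.noetherian _)
      exact ⟨k, fun _ => hk⟩
    · exact ⟨0, fun h => absurd h hq⟩
  choose k hk using hk
  -- It is enough to prove membership after multiplying by `M ^ k`, where the `k`-th power of the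
  -- degree-one part lies in every component not avoided.
  obtain ⟨B, hB⟩ := exists_le_mul_pow_of_pow_mul_le Y M (s.sup k)
  refine ⟨B, fun b hb y hy hhy => hB b hb y hy fun w hw => ?_⟩
  have hyL : lin c * reesMonomial M b y hy ∈ reesIdeal Y M := by
    rw [hch, reesMonomial_mul, reesMonomial_mem_reesIdeal]
    rwa [show 1 + b + 1 = b + 2 by omega]
  have key : reesMonomial M (s.sup k) w hw * reesMonomial M b y hy ∈ reesIdeal Y M := by
    rw [← hs] at hyL ⊢
    rw [Submodule.mem_finsetInf] at hyL ⊢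
    intro q hq
    by_cases hVq : V q = ⊤
    · refine Ideal.mul_mem_right _ _ (hk q hVq (Ideal.pow_le_pow_right (Finset.le_sup hq) ?_))
      exact reesMonomial_mem_span_pow hM hz _ w hw
    · have hcq : c ∉ V q := hc _ (Finset.mem_erase.2 ⟨hVq, Finset.mem_image_of_mem V hq⟩)
      have hyq := hyL q hq
      rw [id, mul_comm] at hyq
      exact Ideal.mul_mem_left _ _
        (((Ideal.isPrimary_iff.1 (hprim hq)).2 hyq).resolve_right hcq)
  rwa [reesMonomial_mul, reesMonomial_mem_reesIdeal] at key

end Superficial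

section Superficial

open Polynomial

variable {R : Type*} [CommRing R]

/-- With `reesMonomial_mem_map`, this identifies the degree `a` part of the extension of `Q` as `Q *
Y ^ a`. Statements about one ideal over the Rees algebra thereby become statements uniform in `a`.
-/
theorem coeff_mem_of_mem_map_reesAlgebra {Y Q : Ideal R} {p : reesAlgebra Y}
    (hp : p ∈ Q.map (algebraMap R (reesAlgebra Y))) (a : ℕ) :
    (p : R[X]).coeff a ∈ Q * Y ^ a := by
  let J : Ideal (reesAlgebra Y) :=
    { carrier := {p | ∀ a, (p : R[X]).coeff a ∈ Q * Y ^ a}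
      zero_mem' := fun b => by simp
      add_mem' := fun {p q} hp hq b => by simpa using add_mem (hp b) (hq b)
      smul_mem' := fun q p hp b => by
        rw [smul_eq_mul, MulMemClass.coe_mul, coeff_mul]
        refine sum_mem fun ij hij => ?_
        rw [Finset.HasAntidiagonal.mem_antidiagonal] at hij
        have := Ideal.mul_mem_mul (q.2 ij.1) (hp ij.2)
        rwa [mul_left_comm, ← pow_add, hij] at this }
  have : Q.map (algebraMap R (reesAlgebra Y)) ≤ J := by
    rw [Ideal.map_le_iff_le_comap]
    intro x hx a
    have e : ((algebraMap R (reesAlgebra Y) x : reesAlgebra Y) : R[X]) = C x := rfl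
    rw [e, coeff_C]
    split_ifs with h
    · subst h
      simpa using hx
    · exact zero_mem _
  exact this hp a

theorem reesMonomial_mem_map {Y Q : Ideal R} {a : ℕ} {y : R} (hy : y ∈ Q * Y ^ a)
    (hya : y ∈ Y ^ a) : reesMonomial Y a y hya ∈ Q.map (algebraMap R (reesAlgebra Y)) := by
  induction hy using Submodule.mul_induction_on' with
  | mem_mul_mem q hq y hy =>
    have e : reesMonomial Y a (q * y) hya =
        algebraMap R (reesAlgebra Y) q * reesMonomial Y a y hy :=
      Subtype.ext (C_mul_monomial (a := q) (b := y) (n := a)).symm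
    rw [e]
    exact Ideal.mul_mem_right _ _ (Ideal.mem_map_of_mem _ hq)
  | add u hu v hv ihu ihv =>
    convert add_mem (ihu (Ideal.mul_le_right hu)) (ihv (Ideal.mul_le_right hv))
    exact Subtype.ext (by simp [reesMonomial])

/-- This is `exists_superficial_step` over the Rees algebra of `Y`, read off in degree `a`; hence
`B` does not depend on `a`. -/
theorem exists_superficial_diagonal_step {K : Type*} [Field K] [Algebra K R] [IsNoetherianRing R]
    {ι : Type*} [Fintype ι] (z : ι → R) {M : Ideal R} (hM : M = Ideal.span (Set.range z))
    (Y : Ideal R) :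
    ∃ V : Finset (Submodule K (ι → K)), ⊤ ∉ V ∧ ∀ c : ι → K, (∀ W ∈ V, c ∉ W) →
      ∃ B, ∀ a b, B ≤ b → ∀ y ∈ Y ^ a * M ^ b, (∑ i, c i • z i) * y ∈ Y ^ (a + 1) * M ^ (b + 2) →
        y ∈ Y ^ (a + 1) * M ^ (b + 1) := by
  obtain ⟨V, hV, h⟩ := exists_superficial_step (K := K) (fun i => algebraMap R (reesAlgebra Y) (z i)) (M := M.map (algebraMap R (reesAlgebra Y)))
    (by rw [hM, Ideal.map_span, ← Set.range_comp]; rfl) (Y.map (algebraMap R (reesAlgebra Y)))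
  refine ⟨V, hV, fun c hc => ?_⟩
  obtain ⟨B, hB⟩ := h c hc
  refine ⟨B, fun a b hb y hy hhy => ?_⟩
  have hy' : y ∈ M ^ b * Y ^ a := by rwa [mul_comm]
  have hya : y ∈ Y ^ a := Ideal.mul_le_right hy'
  have h1 := reesMonomial_mem_map hy' hya
  have hhy' : (∑ i, c i • z i) * y ∈ (Y * M ^ (b + 2)) * Y ^ a := by
    rwa [mul_right_comm, ← pow_succ']
  have h2 := reesMonomial_mem_map hhy' (Ideal.mul_le_right hhy')
  have e : (∑ i, c i • algebraMap R (reesAlgebra Y) (z i)) * reesMonomial Y a y hya =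
      reesMonomial Y a ((∑ i, c i • z i) * y) (Ideal.mul_le_right hhy') := by
    have : (∑ i, c i • algebraMap R (reesAlgebra Y) (z i)) = algebraMap R (reesAlgebra Y) (∑ i, c i • z i) := by
      rw [map_sum]
      refine Finset.sum_congr rfl fun i _ => ?_
      rw [Algebra.smul_def, Algebra.smul_def, map_mul]
      rfl
    rw [this]
    exact Subtype.ext C_mul_monomial
  rw [Ideal.map_pow] at h1
  rw [Ideal.map_mul, Ideal.map_pow, ← e] at h2
  have h3 := hB b hb _ h1 h2
  rw [← Ideal.map_pow, ← Ideal.map_mul] at h3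
  have h4 := coeff_mem_of_mem_map_reesAlgebra h3 a
  rw [reesMonomial, coeff_monomial, if_pos rfl, mul_right_comm, ← pow_succ'] at h4
  exact h4

/-- Artin–Rees for the principal ideal of `h` in degree one of the Rees algebra of `M`: dividing by
`h` costs at most `k` powers of `Y`, with `k` independent of `b`. -/
theorem exists_colon_le_pow_sub [IsNoetherianRing R] (Y M : Ideal R) {h : R} (hhM : h ∈ M)
    (hreg : ∀ y, h * y = 0 → y = 0) (hM : ∀ b y, h * y ∈ M ^ (b + 1) → y ∈ M ^ b) :
    ∃ k, ∀ a b, k ≤ a → ∀ y, h * y ∈ Y ^ a * M ^ (b + 1) → y ∈ Y ^ (a - k) * M ^ b := by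
  have hhM' : h ∈ M ^ 1 := by rwa [pow_one]
  let g := reesMonomial M 1 h hhM'
  obtain ⟨k, hk⟩ := Ideal.exists_pow_inf_eq_pow_smul (Y.map (algebraMap R (reesAlgebra M))) (Ideal.span {g})
  refine ⟨k, fun a b hka y hy => ?_⟩
  have hyb : y ∈ M ^ b := hM b y (Ideal.mul_le_right hy)
  have h1 := reesMonomial_mem_map (Q := Y ^ a) hy (Ideal.mul_le_right hy)
  have e : reesMonomial M (b + 1) (h * y) (Ideal.mul_le_right hy) = g * reesMonomial M b y hyb := by
    rw [reesMonomial_mul]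
    exact Subtype.ext (by simp [reesMonomial, add_comm])
  have h2 : g * reesMonomial M b y hyb ∈
      (Y.map (algebraMap R (reesAlgebra M))) ^ (a - k) * Ideal.span {g} := by
    have : g * reesMonomial M b y hyb ∈ Y.map (algebraMap R (reesAlgebra M)) ^ a • ⊤ ⊓ Ideal.span {g} := by
      refine ⟨?_, Ideal.mul_mem_right _ _ (Ideal.mem_span_singleton_self g)⟩
      rw [smul_eq_mul, Ideal.mul_top, ← e, ← Ideal.map_pow]
      exact h1
    rw [hk a hka] at this
    exact Ideal.mul_mono_right inf_le_right this
  obtain ⟨p, hp, hpe⟩ := Ideal.mem_mul_span_singleton.1 h2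
  rw [← Ideal.map_pow] at hp
  have h3 := coeff_mem_of_mem_map_reesAlgebra hp b
  have h4 : (p : R[X]).coeff b * h = h * y := by
    have := congrArg (fun q : reesAlgebra M => (q : R[X]).coeff (b + 1)) hpe
    simp only [MulMemClass.coe_mul, g, reesMonomial] at this
    rw [coeff_mul_monomial, monomial_mul_monomial, coeff_monomial, if_pos (add_comm 1 b)] at this
    exact this
  have h5 : (p : R[X]).coeff b = y := by
    rw [← sub_eq_zero]
    refine hreg _ ?_
    rw [mul_sub, ← h4, mul_comm, sub_self]
  rwa [h5] at h3

/-- Combines the bounded loss of `exists_colon_le_pow_sub` with the diagonal step, which recovers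
one power of `Y` and one of `M` at a time. -/
theorem exists_superficial {K : Type*} [Field K] [Algebra K R] [IsNoetherianRing R]
    {ι : Type*} [Fintype ι] (z : ι → R) {M : Ideal R} (hM : M = Ideal.span (Set.range z))
    (Y : Ideal R) :
    ∃ V : Finset (Submodule K (ι → K)), ⊤ ∉ V ∧ ∀ c : ι → K, (∀ W ∈ V, c ∉ W) →
      (∀ y, (∑ i, c i • z i) * y = 0 → y = 0) →
      (∀ b y, (∑ i, c i • z i) * y ∈ M ^ (b + 1) → y ∈ M ^ b) →
      ∃ N, ∀ a b, N ≤ a → N ≤ b → ∀ y, (∑ i, c i • z i) * y ∈ Y ^ a * M ^ (b + 1) →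
        y ∈ Y ^ a * M ^ b := by
  obtain ⟨V, hV, h⟩ := exists_superficial_diagonal_step (K := K) z hM Y
  refine ⟨V, hV, fun c hc hreg hcM => ?_⟩
  obtain ⟨B, hB⟩ := h c hc
  have hhM : ∑ i, c i • z i ∈ M := by
    refine sum_mem fun i _ => ?_
    rw [Algebra.smul_def, hM]
    exact Ideal.mul_mem_left _ _ (Ideal.subset_span ⟨i, rfl⟩)
  obtain ⟨k, hk⟩ := exists_colon_le_pow_sub Y M hhM hreg hcM
  refine ⟨B + k, fun a b ha hb y hy => ?_⟩
  -- Start from the exponents `(a - k, b - k)` and climb the diagonal `k` times; `b ≥ B + k` keeps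
  -- the second exponent above `B`.
  have climb : ∀ j, j ≤ k → y ∈ Y ^ (a - k + j) * M ^ (b - k + j) := by
    intro j
    induction j with
    | zero =>
      intro _
      exact Ideal.mul_mono_right (Ideal.pow_le_pow_right (by omega)) (hk a b (by omega) y hy)
    | succ j ih =>
      intro hj
      exact hB (a - k + j) (b - k + j) (by omega) y (ih (by omega))
        (Ideal.mul_mono (Ideal.pow_le_pow_right (by omega)) (Ideal.pow_le_pow_right (by omega)) hy)
  have := climb k le_rfl
  rwa [Nat.sub_add_cancel (by omega), Nat.sub_add_cancel (by omega)] at this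

end Superficial

/-! ### The polynomial ring, its ideal of variables and hyperplane restrictions -/

section Vars

variable (K : Type*) [Field K] (n : ℕ)

/-- The ideal generated by the variables of the polynomial ring in `n` variables. -/
noncomputable abbrev varsIdeal : Ideal (MvPolynomial (Fin n) K) := MvPolynomial.idealOfVars (Fin n) K

variable {K n}

/-- An ideal containing a power of the ideal generated by the variables. -/
def IsVarsPrimary (Y : Ideal (MvPolynomial (Fin n) K)) : Prop := ∃ q, varsIdeal K n ^ q ≤ Y

namespace IsVarsPrimary

variable {X Y : Ideal (MvPolynomial (Fin n) K)}

theorem mono (h : IsVarsPrimary X) (hXY : X ≤ Y) : IsVarsPrimary Y :=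
  h.imp fun _ hq => hq.trans hXY

theorem mul (h : IsVarsPrimary X) (h' : IsVarsPrimary Y) : IsVarsPrimary (X * Y) := by
  obtain ⟨q, hq⟩ := h
  obtain ⟨q', hq'⟩ := h'
  exact ⟨q + q', by rw [pow_add]; exact Ideal.mul_mono hq hq'⟩

theorem pow (h : IsVarsPrimary X) (a : ℕ) : IsVarsPrimary (X ^ a) := by
  obtain ⟨q, hq⟩ := h
  exact ⟨q * a, by rw [pow_mul]; exact Ideal.pow_right_mono hq a⟩

theorem vars_pow (a : ℕ) : IsVarsPrimary (varsIdeal K n ^ a) := ⟨a, le_rfl⟩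

theorem map {m : ℕ} (h : IsVarsPrimary X) {π : MvPolynomial (Fin n) K →ₐ[K] MvPolynomial (Fin m) K}
    (hπ : (varsIdeal K n).map π = varsIdeal K m) : IsVarsPrimary (X.map π) := by
  obtain ⟨q, hq⟩ := h
  exact ⟨q, by rw [← hπ, ← Ideal.map_pow]; exact Ideal.map_mono hq⟩

end IsVarsPrimary

theorem mem_vars_pow_iff_le_order {b : ℕ} {p : MvPolynomial (Fin n) K} :
    p ∈ varsIdeal K n ^ b ↔ (b : ℕ∞) ≤ (p : MvPowerSeries (Fin n) K).order := by
  rw [MvPolynomial.mem_pow_idealOfVars_iff']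
  constructor
  · intro h
    refine MvPowerSeries.le_order fun d hd => ?_
    rw [MvPolynomial.coeff_coe]
    exact h d (by exact_mod_cast hd)
  · intro h d hd
    rw [← MvPolynomial.coeff_coe]
    exact MvPowerSeries.coeff_of_lt_order (lt_of_lt_of_le (by exact_mod_cast hd) h)

/-- Dividing by a polynomial with nonzero linear part lowers the order by at most one. -/
theorem mem_vars_pow_of_mul_mem {h : MvPolynomial (Fin n) K} {j : Fin n}
    (hj : h.coeff (Finsupp.single j 1) ≠ 0) {b : ℕ} {y : MvPolynomial (Fin n) K}
    (hy : h * y ∈ varsIdeal K n ^ (b + 1)) : y ∈ varsIdeal K n ^ b := by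
  rw [mem_vars_pow_iff_le_order] at hy ⊢
  rw [MvPolynomial.coe_mul, MvPowerSeries.order_mul] at hy
  have h1 : (h : MvPowerSeries (Fin n) K).order ≤ 1 := by
    have := MvPowerSeries.order_le (f := (h : MvPowerSeries (Fin n) K))
      (d := Finsupp.single j 1) (by rwa [MvPolynomial.coeff_coe])
    simpa using this
  have h2 : ((b : ℕ∞) + 1) ≤ 1 + (y : MvPowerSeries (Fin n) K).order := by
    have := hy.trans (add_le_add_left h1 _)
    exact_mod_cast this
  rw [add_comm] at h2
  exact (ENat.add_le_add_iff_left ENat.one_ne_top).1 h2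

theorem coeff_linear (c : Fin n → K) (j : Fin n) :
    (∑ i, c i • (MvPolynomial.X i : MvPolynomial (Fin n) K)).coeff (Finsupp.single j 1) = c j := by
  classical
  rw [MvPolynomial.coeff_sum, Finset.sum_eq_single j]
  · simp
  · intro i _ hij
    rw [MvPolynomial.coeff_smul, MvPolynomial.coeff_X, if_neg, smul_zero]
    intro h
    exact hij (Finsupp.single_left_injective one_ne_zero h)
  · simp

/-- The restriction of polynomials to the hyperplane `∑ cᵢ Xᵢ = 0`, when the last coefficient is
nonzero. -/
noncomputable def hyperplaneRestriction (c : Fin (n + 1) → K) :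
    MvPolynomial (Fin (n + 1)) K →ₐ[K] MvPolynomial (Fin n) K :=
  MvPolynomial.aeval (Fin.snoc (α := fun _ => MvPolynomial (Fin n) K) MvPolynomial.X
    (-(c (Fin.last n))⁻¹ • ∑ i : Fin n, c i.castSucc • MvPolynomial.X i))

section

variable (c : Fin (n + 1) → K)

theorem hyperplaneRestriction_castSucc (i : Fin n) :
    hyperplaneRestriction c (MvPolynomial.X i.castSucc) = MvPolynomial.X i := by
  simp [hyperplaneRestriction]

theorem hyperplaneRestriction_last :
    hyperplaneRestriction c (MvPolynomial.X (Fin.last n)) =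
      -(c (Fin.last n))⁻¹ • ∑ i : Fin n, c i.castSucc • MvPolynomial.X i := by
  simp [hyperplaneRestriction]

theorem hyperplaneRestriction_rename (p : MvPolynomial (Fin n) K) :
    hyperplaneRestriction c (MvPolynomial.rename Fin.castSucc p) = p := by
  have : (hyperplaneRestriction c).comp (MvPolynomial.rename Fin.castSucc) =
      AlgHom.id K (MvPolynomial (Fin n) K) := by
    refine MvPolynomial.algHom_ext fun i => ?_
    simp [hyperplaneRestriction_castSucc]
  exact DFunLike.congr_fun this p

theorem hyperplaneRestriction_surjective : Function.Surjective (hyperplaneRestriction c) :=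
  fun p => ⟨_, hyperplaneRestriction_rename c p⟩

theorem map_hyperplaneRestriction_vars :
    (varsIdeal K (n + 1)).map (hyperplaneRestriction c) = varsIdeal K n := by
  refine le_antisymm ?_ ?_
  · rw [Ideal.map_span, Ideal.span_le]
    rintro _ ⟨_, ⟨i, rfl⟩, rfl⟩
    induction i using Fin.lastCases with
    | last =>
      rw [hyperplaneRestriction_last, SetLike.mem_coe]
      refine Submodule.smul_of_tower_mem _ _ (sum_mem fun i _ => ?_)
      exact Submodule.smul_of_tower_mem _ _ (Ideal.subset_span ⟨i, rfl⟩)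
    | cast i =>
      rw [hyperplaneRestriction_castSucc]
      exact Ideal.subset_span ⟨i, rfl⟩
  · rw [varsIdeal, MvPolynomial.idealOfVars, Ideal.span_le]
    rintro _ ⟨i, rfl⟩
    rw [← hyperplaneRestriction_castSucc c]
    exact Ideal.mem_map_of_mem _ (Ideal.subset_span ⟨_, rfl⟩)

theorem ker_hyperplaneRestriction (hc : c (Fin.last n) ≠ 0) :
    RingHom.ker (hyperplaneRestriction c) = Ideal.span {∑ i, c i • MvPolynomial.X i} := by
  set h := ∑ i, c i • (MvPolynomial.X i : MvPolynomial (Fin (n + 1)) K) with hh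
  refine le_antisymm ?_ ?_
  · intro p hp
    -- Modulo the linear form every polynomial equals its restriction, viewed again in the larger
    -- ring; this can be checked on the variables.
    have key : (Ideal.Quotient.mkₐ K (Ideal.span {h})) =
        (Ideal.Quotient.mkₐ K (Ideal.span {h})).comp
          ((MvPolynomial.rename Fin.castSucc).comp (hyperplaneRestriction c)) := by
      refine MvPolynomial.algHom_ext fun i => ?_
      induction i using Fin.lastCases with
      | last =>
        simp only [AlgHom.comp_apply, hyperplaneRestriction_last, Ideal.Quotient.mkₐ_eq_mk]
        rw [Ideal.Quotient.eq]
        refine Ideal.mem_span_singleton'.2 ⟨MvPolynomial.C (c (Fin.last n))⁻¹, ?_⟩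
        rw [hh, Fin.sum_univ_castSucc]
        simp only [MvPolynomial.smul_eq_C_mul, map_neg, map_mul, map_sum, MvPolynomial.rename_X,
          MvPolynomial.algHom_C, MvPolynomial.algebraMap_eq]
        have : (MvPolynomial.C (c (Fin.last n))⁻¹ * MvPolynomial.C (c (Fin.last n)) :
          MvPolynomial (Fin (n + 1)) K) = 1 := by
          rw [← map_mul, inv_mul_cancel₀ hc, map_one]
        linear_combination (MvPolynomial.X (Fin.last n)) * this
      | cast i => simp [hyperplaneRestriction_castSucc]
    have h1 := DFunLike.congr_fun key p
    rw [AlgHom.comp_apply, AlgHom.comp_apply, (RingHom.mem_ker).1 hp, map_zero, map_zero] at h1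
    exact Ideal.Quotient.eq_zero_iff_mem.1 h1
  · rw [Ideal.span_le, Set.singleton_subset_iff, SetLike.mem_coe, RingHom.mem_ker, hh,
      Fin.sum_univ_castSucc, map_add, map_sum]
    simp only [map_smul, hyperplaneRestriction_castSucc, hyperplaneRestriction_last]
    rw [neg_smul, smul_neg, smul_smul, mul_inv_cancel₀ hc, one_smul, add_neg_cancel]

end

theorem codim_map_of_surjective {R S : Type*} [CommRing R] [CommRing S] [Algebra K R] [Algebra K S]
    (π : R →ₐ[K] S) (hπ : Function.Surjective π) (Z : Ideal R) :
    codim K (Z.map π) = codim K (Z ⊔ RingHom.ker π) ∧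
      (FinCodim K (Z.map π) → FinCodim K (Z ⊔ RingHom.ker π)) := by
  have hker : RingHom.ker ((Ideal.Quotient.mkₐ K (Z.map π)).comp π) = Z ⊔ RingHom.ker π := by
    rw [RingHom.ker_eq_comap_bot π, ← Ideal.comap_map_of_surjective π hπ]
    ext x
    simp [RingHom.mem_ker, Ideal.Quotient.eq_zero_iff_mem]
  have e : (R ⧸ (Z ⊔ RingHom.ker π)) ≃ₐ[K] (S ⧸ Z.map π) :=
    (Ideal.quotientEquivAlgOfEq K hker.symm).trans
      (Ideal.quotientKerAlgEquivOfSurjective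
        (f := (Ideal.Quotient.mkₐ K (Z.map π)).comp π)
        ((Ideal.Quotient.mkₐ_surjective K _).comp hπ))
  exact ⟨e.symm.toLinearEquiv.finrank_eq, fun h => Module.Finite.equiv e.symm.toLinearEquiv⟩

/-- Cutting by the last variable `h`: since `𝔪 ^ (b + 1) : h = 𝔪 ^ b`, consecutive codimensions
differ by a codimension in one variable fewer, and Pascal's rule sums them. -/
theorem finCodim_and_codim_vars_pow_succ (n : ℕ) : ∀ b,
    FinCodim K (varsIdeal K n ^ (b + 1)) ∧ codim K (varsIdeal K n ^ (b + 1)) = (b + n).choose n := by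
  induction n with
  | zero =>
    intro b
    have h0 : varsIdeal K 0 ^ (b + 1) = ⊥ := by
      rw [varsIdeal, MvPolynomial.idealOfVars, Set.range_eq_empty, Ideal.span_empty,
        pow_succ, Ideal.mul_bot]
    let e : (MvPolynomial (Fin 0) K ⧸ varsIdeal K 0 ^ (b + 1)) ≃ₐ[K] K :=
      (Ideal.quotientEquivAlgOfEq K h0).trans
        ((AlgEquiv.quotientBot K _).trans (MvPolynomial.isEmptyAlgEquiv K (Fin 0)))
    refine ⟨Module.Finite.equiv e.symm.toLinearEquiv, ?_⟩
    rw [codim, e.toLinearEquiv.finrank_eq]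
    simp
  | succ n ih =>
    let c : Fin (n + 1) → K := Pi.single (Fin.last n) 1
    have hc : c (Fin.last n) ≠ 0 := by simp [c]
    set h := ∑ i, c i • (MvPolynomial.X i : MvPolynomial (Fin (n + 1)) K) with hh
    have hcol : ∀ b, (varsIdeal K (n + 1) ^ (b + 1)).colon {h} = varsIdeal K (n + 1) ^ b := by
      intro b
      refine le_antisymm (fun y hy => ?_) fun y hy => ?_
      · rw [Submodule.mem_colon_singleton, smul_eq_mul, mul_comm] at hy
        exact mem_vars_pow_of_mul_mem (j := Fin.last n) (by rwa [hh, coeff_linear]) hy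
      · rw [Submodule.mem_colon_singleton, smul_eq_mul, pow_succ]
        refine Ideal.mul_mem_mul hy (sum_mem fun i _ => ?_)
        exact Submodule.smul_of_tower_mem _ _ (Ideal.subset_span ⟨i, rfl⟩)
    have hstep : ∀ b, FinCodim K (varsIdeal K (n + 1) ^ b) →
        FinCodim K (varsIdeal K (n + 1) ^ (b + 1)) ∧
        codim K (varsIdeal K (n + 1) ^ (b + 1)) =
          codim K (varsIdeal K (n + 1) ^ b) + (b + n).choose n := by
      intro b hb
      obtain ⟨h1, h2⟩ := codim_map_of_surjective _ (hyperplaneRestriction_surjective c)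
        (varsIdeal K (n + 1) ^ (b + 1))
      rw [Ideal.map_pow, map_hyperplaneRestriction_vars, ker_hyperplaneRestriction c hc] at h1 h2
      rw [(ih b).2] at h1
      have hfin : FinCodim K (varsIdeal K (n + 1) ^ (b + 1)) :=
        FinCodim.of_colon h (by rwa [hcol]) (h2 (ih b).1)
      refine ⟨hfin, ?_⟩
      rw [← codim_colon_add h hfin, hcol, h1]
    have h0 : FinCodim K (varsIdeal K (n + 1) ^ 0) ∧ codim K (varsIdeal K (n + 1) ^ 0) = 0 := by
      rw [pow_zero, Ideal.one_eq_top]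
      have : Subsingleton (MvPolynomial (Fin (n + 1)) K ⧸
        (⊤ : Ideal (MvPolynomial (Fin (n + 1)) K))) := Ideal.Quotient.subsingleton_iff.2 rfl
      exact ⟨inferInstance, Module.finrank_zero_of_subsingleton⟩
    intro b
    induction b with
    | zero =>
      obtain ⟨h1, h2⟩ := hstep 0 h0.1
      refine ⟨h1, ?_⟩
      rw [h2, h0.2]
      simp
    | succ b ihb =>
      obtain ⟨h1, h2⟩ := hstep (b + 1) ihb.1
      refine ⟨h1, ?_⟩
      rw [h2, ihb.2, show b + 1 + (n + 1) = (b + (n + 1)) + 1 by ring, Nat.choose_succ_succ,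
        show b + 1 + n = b + (n + 1) by ring, add_comm]

theorem IsVarsPrimary.finCodim {Y : Ideal (MvPolynomial (Fin n) K)} (h : IsVarsPrimary Y) :
    FinCodim K Y := by
  obtain ⟨q, hq⟩ := h
  exact (finCodim_and_codim_vars_pow_succ n q).1.mono
    ((Ideal.pow_le_pow_right (Nat.le_succ q)).trans hq)

theorem codim_vars_pow_le (b : ℕ) : codim K (varsIdeal K n ^ b) ≤ (b + n) ^ n := by
  refine (codim_mono (finCodim_and_codim_vars_pow_succ n b).1
    (Ideal.pow_le_pow_right (Nat.le_succ b))).trans ?_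
  rw [(finCodim_and_codim_vars_pow_succ n b).2]
  exact Nat.choose_le_pow _ _

end Vars

/-! ### Bivariate Hilbert–Samuel polynomials and generic sections -/

section HilbertSamuel

variable {K : Type*} [Field K] {n : ℕ}

/-- `c` is the family of coefficients, in the basis of products of binomial coefficients, of the
polynomial of degree at most `n` giving the codimension of `Y ^ a * 𝔪 ^ b` for large `a` and `b`. -/
def IsHilbertSamuel (Y : Ideal (MvPolynomial (Fin n) K)) (c : ℕ → ℕ → ℚ) : Prop :=
  (∀ u v, n < u + v → c u v = 0) ∧ ∃ N, ∀ a b, N ≤ a → N ≤ b →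
    (codim K (Y ^ a * varsIdeal K n ^ b) : ℚ) = ∑ u ∈ Finset.range (n + 1),
      ∑ v ∈ Finset.range (n + 1), c u v * ((a.choose u : ℚ) * (b.choose v : ℚ))

/-- For fixed `b` the codimension of `Y ^ a * 𝔪 ^ b` is a numerical polynomial of degree at most
`n`. -/
theorem exists_codim_pow_mul_eq {Y : Ideal (MvPolynomial (Fin n) K)} (hY : IsVarsPrimary Y)
    (b : ℕ) : ∃ (g : ℕ → ℚ) (N : ℕ), (∀ u, n < u → g u = 0) ∧ ∀ a, N ≤ a →
      (codim K (Y ^ a * varsIdeal K n ^ b) : ℚ) =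
        ∑ u ∈ Finset.range (n + 1), g u * (a.choose u : ℚ) := by
  have hfin : ∀ a, FinCodim K (Y ^ a * varsIdeal K n ^ b) := fun a =>
    ((hY.pow a).mul (.vars_pow b)).finCodim
  obtain ⟨D₀, hD₀⟩ := (isEventuallyNumerical_codim_pow_mul Y _ hfin).exists_le
  obtain ⟨g, N, hg⟩ := hD₀ (max D₀ (n + 1)) (le_max_left _ _)
  obtain ⟨q, hq⟩ := hY
  -- From `𝔪 ^ q ≤ Y` the ideal `Y ^ a * 𝔪 ^ b` contains `𝔪 ^ (q a + b)`, so its codimension grows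
  -- at most like `a ^ n` for fixed `b`.
  have hzero := coeff_eq_zero_of_growth (m := n) (K := ((q + b + n : ℕ) : ℝ) ^ n) _ hg (by
    intro a _
    have h1 : codim K (Y ^ a * varsIdeal K n ^ b) ≤ (q * a + b + n) ^ n := by
      refine (codim_mono (IsVarsPrimary.vars_pow _).finCodim ?_).trans
        (codim_vars_pow_le (q * a + b))
      rw [pow_add, pow_mul]
      exact Ideal.mul_mono_left (Ideal.pow_right_mono hq a)
    have h2 : q * a + b + n ≤ (q + b + n) * (a + 1) := by nlinarith
    have h3 := h1.trans (Nat.pow_le_pow_left h2 n)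
    rw [mul_pow] at h3
    rw [abs_of_nonneg (by positivity)]
    exact_mod_cast h3)
  refine ⟨fun u => if u ≤ n then g u else 0, N, fun u hu => if_neg (by omega), fun a ha => ?_⟩
  rw [hg a ha, ← Finset.sum_subset (Finset.range_mono (le_max_right D₀ (n + 1)))]
  · refine Finset.sum_congr rfl fun u hu => ?_
    rw [Finset.mem_range] at hu
    beta_reduce
    rw [if_pos (by omega)]
  · intro u hu hu'
    rw [Finset.mem_range] at hu hu'
    rw [hzero u hu (by omega), zero_mul]

/-- The codimension upstairs is obtained from its value at a fixed `b = N` by summing the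
codimensions of the section over `b`. Summation raises the index `v` of a top-degree coefficient by
one. -/
theorem IsHilbertSamuel.of_section {Y : Ideal (MvPolynomial (Fin (n + 1)) K)}
    (hY : IsVarsPrimary Y) {c' : ℕ → ℕ → ℚ}
    {π : MvPolynomial (Fin (n + 1)) K →ₐ[K] MvPolynomial (Fin n) K}
    (hc' : IsHilbertSamuel (Y.map π) c') {N₀ : ℕ}
    (hstep : ∀ a b, N₀ ≤ a → N₀ ≤ b → codim K (Y ^ a * varsIdeal K (n + 1) ^ (b + 1)) =
      codim K (Y ^ a * varsIdeal K (n + 1) ^ b) +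
        codim K (Y.map π ^ a * varsIdeal K n ^ (b + 1))) :
    ∃ c, IsHilbertSamuel Y c ∧ ∀ u v, u + v = n → c u (v + 1) = c' u v := by
  obtain ⟨hc0, N₁, hN₁⟩ := hc'
  set N := max N₀ N₁ with hN
  obtain ⟨g, N₂, hg0, hg⟩ := exists_codim_pow_mul_eq hY N
  let F : ℕ → ℕ → ℚ := fun a b => (codim K (Y ^ a * varsIdeal K (n + 1) ^ b) : ℚ)
  let q : ℕ → ℕ → ℚ := fun a b => ∑ u ∈ Finset.range (n + 2), ∑ v ∈ Finset.range (n + 1),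
    c' u v * ((a.choose u : ℚ) * ((b + 1).choose (v + 1) : ℚ))
  have hlast : ∀ v, c' (n + 1) v = 0 := fun v => hc0 _ _ (by omega)
  have hq : ∀ a b, q a (b + 1) = q a b + ∑ u ∈ Finset.range (n + 1), ∑ v ∈ Finset.range (n + 1),
      c' u v * ((a.choose u : ℚ) * ((b + 1).choose v : ℚ)) := by
    intro a b
    have h0 : ∑ u ∈ Finset.range (n + 1), ∑ v ∈ Finset.range (n + 1),
      c' u v * ((a.choose u : ℚ) * ((b + 1).choose v : ℚ)) =
      ∑ u ∈ Finset.range (n + 2), ∑ v ∈ Finset.range (n + 1),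
      c' u v * ((a.choose u : ℚ) * ((b + 1).choose v : ℚ)) := by
      rw [Finset.sum_range_succ _ (n + 1)]
      simp [hlast]
    rw [h0]
    simp only [q, ← Finset.sum_add_distrib]
    refine Finset.sum_congr rfl fun u _ => Finset.sum_congr rfl fun v _ => ?_
    rw [Nat.choose_succ_succ (b + 1) v]
    push_cast
    ring
  have hF : ∀ a, N ≤ a → ∀ k, F a (N + k) = F a N - q a N + q a (N + k) := by
    intro a ha k
    induction k with
    | zero => simp
    | succ k ih =>
      have h1 : F a (N + k + 1) = F a (N + k) +
          (codim K (Y.map π ^ a * varsIdeal K n ^ (N + k + 1)) : ℚ) := by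
        simp only [F]
        exact_mod_cast hstep a (N + k) (by omega) (by omega)
      rw [hN₁ a (N + k + 1) (by omega) (by omega)] at h1
      rw [← add_assoc, h1, hq, ih]
      ring
  let γ : ℕ → ℚ := fun u => g u - ∑ v ∈ Finset.range (n + 1), c' u v * ((N + 1).choose (v + 1) : ℚ)
  have hγ : ∀ a, N₂ ≤ a → F a N - q a N = ∑ u ∈ Finset.range (n + 2), γ u * (a.choose u : ℚ) := by
    intro a ha
    simp only [F, q, γ]
    rw [hg a ha, ← Finset.sum_sub_distrib]
    refine Finset.sum_congr rfl fun u _ => ?_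
    rw [sub_mul, Finset.sum_mul]
    congr 1
    exact Finset.sum_congr rfl fun v _ => by ring
  -- The two summands come from `C(b + 1, v + 1) = C(b, v + 1) + C(b, v)`. The constants of
  -- integration `γ u` are the coefficients for `v = 0`; in top degree the second summand vanishes.
  refine ⟨fun u v => (if v = 0 then γ u else c' u (v - 1)) + c' u v, ⟨fun u v huv => ?_, max N N₂,
    fun a b ha hb => ?_⟩, fun u v huv => ?_⟩
  · beta_reduce
    rw [hc0 u v (by omega), add_zero]
    split_ifs with hv
    · simp only [γ]
      rw [hg0 u (by omega), Finset.sum_eq_zero, sub_zero]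
      intro w _
      rw [hc0 u w (by omega), zero_mul]
    · exact hc0 _ _ (by omega)
  · obtain ⟨k, rfl⟩ := Nat.exists_eq_add_of_le (le_of_max_le_left hb)
    change F a (N + k) = _
    rw [hF a (le_of_max_le_left ha), hγ a (le_of_max_le_right ha)]
    simp only [q]
    rw [← Finset.sum_add_distrib]
    refine Finset.sum_congr rfl fun u _ => ?_
    have e1 : ∑ v ∈ Finset.range (n + 1 + 1), ((if v = 0 then γ u else c' u (v - 1)) + c' u v) *
        ((a.choose u : ℚ) * ((N + k).choose v : ℚ)) =
        ∑ v ∈ Finset.range (n + 1 + 1), (if v = 0 then γ u else c' u (v - 1)) *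
        ((a.choose u : ℚ) * ((N + k).choose v : ℚ)) +
        ∑ v ∈ Finset.range (n + 1), c' u v * ((a.choose u : ℚ) * ((N + k).choose v : ℚ)) := by
      simp only [add_mul, Finset.sum_add_distrib]
      congr 1
      rw [Finset.sum_range_succ _ (n + 1), hc0 u (n + 1) (by omega), zero_mul, add_zero]
    rw [e1, Finset.sum_range_succ' _ (n + 1)]
    simp only [Nat.add_eq_zero_iff, one_ne_zero, and_false, if_false, if_true,
      Nat.add_sub_cancel, Nat.choose_zero_right, Nat.cast_one, mul_one]
    have e2 : ∀ v, (((N + k + 1).choose (v + 1) : ℕ) : ℚ) =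
        (N + k).choose v + (N + k).choose (v + 1) := fun v => by
      rw [Nat.choose_succ_succ (N + k) v]
      push_cast
      rfl
    simp only [e2, mul_add, Finset.sum_add_distrib]
    ring
  · beta_reduce
    rw [if_neg (by omega), Nat.add_sub_cancel, hc0 u (v + 1) (by omega), add_zero]

/-- Generic hyperplane sections preserve the mixed Hilbert–Samuel coefficients. -/
theorem exists_section [Infinite K] (s : Finset (Ideal (MvPolynomial (Fin (n + 1)) K)))
    (hs : ∀ Y ∈ s, IsVarsPrimary Y) :
    ∃ π : MvPolynomial (Fin (n + 1)) K →ₐ[K] MvPolynomial (Fin n) K,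
      Function.Surjective π ∧ (varsIdeal K (n + 1)).map π = varsIdeal K n ∧
      ∀ Y ∈ s, ∀ c', IsHilbertSamuel (Y.map π) c' →
        ∃ c, IsHilbertSamuel Y c ∧ ∀ u v, u + v = n → c u (v + 1) = c' u v := by
  classical
  choose V hV hVsup using fun Y : Ideal (MvPolynomial (Fin (n + 1)) K) =>
    exists_superficial (K := K) (MvPolynomial.X : Fin (n + 1) → MvPolynomial (Fin (n + 1)) K)
      (M := varsIdeal K (n + 1)) rfl Y
  let W : Submodule K (Fin (n + 1) → K) := LinearMap.ker (LinearMap.proj (Fin.last n))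
  have hW : W ≠ ⊤ := by
    intro h
    have : (Pi.single (Fin.last n) 1 : Fin (n + 1) → K) ∈ W := h ▸ Submodule.mem_top
    simp [W] at this
  have htop : ⊤ ∉ insert W (s.biUnion V) := by
    rw [Finset.mem_insert, Finset.mem_biUnion]
    rintro (h | ⟨Y, _, h⟩)
    exacts [hW h.symm, hV Y h]
  -- Over an infinite field finitely many proper subspaces do not cover the space. Avoiding `W` as
  -- well makes the last coefficient nonzero, as the hyperplane restriction needs.
  obtain ⟨c, hc⟩ := (Set.ne_univ_iff_exists_notMem _).1
    (Subspace.biUnion_ne_univ_of_top_notMem htop)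
  simp only [Set.mem_iUnion, not_exists, SetLike.mem_coe] at hc
  have hcl : c (Fin.last n) ≠ 0 := fun h => hc W (Finset.mem_insert_self _ _) h
  set h := ∑ i, c i • (MvPolynomial.X i : MvPolynomial (Fin (n + 1)) K) with hh
  have hcoeff : h.coeff (Finsupp.single (Fin.last n) 1) ≠ 0 := by rwa [hh, coeff_linear]
  have hreg : ∀ y, h * y = 0 → y = 0 := fun y hy => (mul_eq_zero.1 hy).resolve_left fun h0 => by
    rw [h0] at hcoeff
    simp at hcoeff
  refine ⟨hyperplaneRestriction c, hyperplaneRestriction_surjective c,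
    map_hyperplaneRestriction_vars c, fun Y hY c' hc' => ?_⟩
  obtain ⟨N, hN⟩ := hVsup Y c
    (fun W' hW' => hc W' (Finset.mem_insert_of_mem (Finset.mem_biUnion.2 ⟨Y, hY, hW'⟩)))
    hreg (fun b y => mem_vars_pow_of_mul_mem hcoeff)
  refine IsHilbertSamuel.of_section (hs Y hY) hc' (N₀ := N) fun a b ha hb => ?_
  have hcol : (Y ^ a * varsIdeal K (n + 1) ^ (b + 1)).colon {h} =
      Y ^ a * varsIdeal K (n + 1) ^ b := by
    refine le_antisymm (fun y hy => ?_) fun y hy => ?_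
    · rw [Submodule.mem_colon_singleton, smul_eq_mul, mul_comm y h] at hy
      exact hN a b ha hb y hy
    · rw [Submodule.mem_colon_singleton, smul_eq_mul, pow_succ, ← mul_assoc]
      refine Ideal.mul_mem_mul hy (sum_mem fun i _ => ?_)
      exact Submodule.smul_of_tower_mem _ _ (Ideal.subset_span ⟨i, rfl⟩)
  have h1 := (codim_map_of_surjective _ (hyperplaneRestriction_surjective c)
    (Y ^ a * varsIdeal K (n + 1) ^ (b + 1))).1
  rw [Ideal.map_mul, Ideal.map_pow, Ideal.map_pow, map_hyperplaneRestriction_vars,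
    ker_hyperplaneRestriction c hcl] at h1
  rw [h1, ← hcol, codim_colon_add h (((hs Y hY).pow a).mul (.vars_pow _)).finCodim]

theorem exists_isHilbertSamuel [Infinite K] (n : ℕ) :
    ∀ {Y : Ideal (MvPolynomial (Fin n) K)}, IsVarsPrimary Y → ∃ c, IsHilbertSamuel Y c := by
  induction n with
  | zero =>
    intro Y _
    refine ⟨fun u v => if u + v = 0 then 1 else 0, fun u v h => if_neg (by omega), 1,
      fun a b _ hb => ?_⟩
    have h0 : Y ^ a * varsIdeal K 0 ^ b = varsIdeal K 0 ^ (0 + 1) := by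
      obtain ⟨b, rfl⟩ : ∃ b', b = b' + 1 := ⟨b - 1, by omega⟩
      rw [varsIdeal, MvPolynomial.idealOfVars, Set.range_eq_empty, Ideal.span_empty,
        pow_succ, Ideal.mul_bot, Ideal.mul_bot, pow_succ, Ideal.mul_bot]
    rw [h0, (finCodim_and_codim_vars_pow_succ 0 0).2]
    simp
  | succ n ih =>
    intro Y hY
    obtain ⟨π, -, hπ, h⟩ := exists_section {Y} (by simpa using hY)
    obtain ⟨c', hc'⟩ := ih (hY.map hπ)
    obtain ⟨c, hc, -⟩ := h Y (Finset.mem_singleton_self Y) c' hc'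
    exact ⟨c, hc⟩

/-- Generic linear sections of dimension `i`. -/
theorem exists_linear_section [Infinite K] (i m : ℕ) :
    ∀ (s : Finset (Ideal (MvPolynomial (Fin (i + m)) K))), (∀ Y ∈ s, IsVarsPrimary Y) →
    ∃ π : MvPolynomial (Fin (i + m)) K →ₐ[K] MvPolynomial (Fin i) K,
      Function.Surjective π ∧ (varsIdeal K (i + m)).map π = varsIdeal K i ∧
      ∀ Y ∈ s, ∀ c', IsHilbertSamuel (Y.map π) c' →
        ∃ c, IsHilbertSamuel Y c ∧ c i m = c' i 0 := by
  classical
  induction m with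
  | zero =>
    intro s _
    refine ⟨AlgHom.id K _, Function.surjective_id, Ideal.map_id _, fun Y _ c' hc' => ⟨c', ?_, rfl⟩⟩
    have : Y.map (AlgHom.id K (MvPolynomial (Fin (i + 0)) K)) = Y := Ideal.map_id Y
    rwa [this] at hc'
  | succ m ih =>
    intro s hs
    obtain ⟨π, hπs, hπ, h⟩ := exists_section (n := i + m) s hs
    obtain ⟨ρ, hρs, hρ, h'⟩ := ih (s.image (Ideal.map π)) (by
      intro Z hZ
      obtain ⟨Y, hY, rfl⟩ := Finset.mem_image.1 hZ
      exact (hs Y hY).map hπ)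
    have hcomp : ∀ Z : Ideal (MvPolynomial (Fin (i + (m + 1))) K),
        Z.map (ρ.comp π) = (Z.map π).map ρ := fun Z =>
      (Ideal.map_mapₐ π ρ).symm
    refine ⟨ρ.comp π, hρs.comp hπs, ?_, fun Y hY c' hc' => ?_⟩
    · rw [hcomp, ← hρ, ← hπ]
      rfl
    · rw [hcomp] at hc'
      obtain ⟨d, hd, hdi⟩ := h' _ (Finset.mem_image_of_mem _ hY) c' hc'
      obtain ⟨c, hc, hci⟩ := h Y hY d hd
      exact ⟨c, hc, by rw [hci i m rfl, hdi]⟩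

end HilbertSamuel

/-! ### Lower bounds for Hilbert–Samuel functions from chains of primes -/

section Growth

variable {K : Type*} [Field K] {S : Type*} [CommRing S] [Algebra K S]

theorem succ_pow_succ_le (s k : ℕ) : (s + 1) ^ (k + 1) ≤ s ^ (k + 1) + (k + 1) * (s + 1) ^ k := by
  induction k with
  | zero => simp
  | succ k ih =>
    have h1 : s ^ (k + 1) ≤ (s + 1) ^ (k + 1) := Nat.pow_le_pow_left (Nat.le_succ s) _
    calc (s + 1) ^ (k + 1 + 1) = (s + 1) ^ (k + 1) * (s + 1) := pow_succ _ _
      _ ≤ (s ^ (k + 1) + (k + 1) * (s + 1) ^ k) * (s + 1) := Nat.mul_le_mul_right _ ih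
      _ = s ^ (k + 1 + 1) + s ^ (k + 1) + (k + 1) * (s + 1) ^ (k + 1) := by ring
      _ ≤ s ^ (k + 1 + 1) + (s + 1) ^ (k + 1) + (k + 1) * (s + 1) ^ (k + 1) := by gcongr
      _ = s ^ (k + 1 + 1) + (k + 1 + 1) * (s + 1) ^ (k + 1) := by ring

theorem one_le_codim {X : Ideal S} (h : FinCodim K X) (hX : X ≠ ⊤) : 1 ≤ codim K X := by
  have : Nontrivial (S ⧸ X) := Ideal.Quotient.nontrivial_iff.2 hX
  exact Module.finrank_pos

/-- Artin–Rees in `S / p` for the submodule generated by `a`, which is a nonzerodivisor there. -/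
theorem exists_colon_sup_pow_le [IsNoetherianRing S] (Q : Ideal S) {p : Ideal S} (hp : p.IsPrime)
    {a : S} (ha : a ∉ p) :
    ∃ c, 0 < c ∧ ∀ t, c ≤ t → (p ⊔ Q ^ t).colon {a} ≤ p ⊔ Q ^ (t - c) := by
  obtain ⟨c, hc⟩ := Q.exists_pow_inf_eq_pow_smul
    (Submodule.span S {(Ideal.Quotient.mk p a : S ⧸ p)})
  have key : ∀ t, c ≤ t → (p ⊔ Q ^ t).colon {a} ≤ p ⊔ Q ^ (t - c) := by
    intro t ht y hy
    rw [Submodule.mem_colon_singleton, smul_eq_mul] at hy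
    obtain ⟨u, hu, v, hv, huv⟩ := Submodule.mem_sup.1 hy
    have h1 : (Ideal.Quotient.mk p (y * a) : S ⧸ p) ∈
        Q ^ t • (⊤ : Submodule S (S ⧸ p)) ⊓ Submodule.span S {(Ideal.Quotient.mk p a : S ⧸ p)} := by
      refine ⟨?_, Submodule.mem_span_singleton.2 ⟨y, rfl⟩⟩
      rw [← huv, map_add, Ideal.Quotient.eq_zero_iff_mem.2 hu, zero_add]
      have : (Ideal.Quotient.mk p v : S ⧸ p) = v • (1 : S ⧸ p) := by
        rw [Algebra.smul_def, mul_one]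
        rfl
      rw [this]
      exact Submodule.smul_mem_smul hv Submodule.mem_top
    rw [hc t ht] at h1
    obtain ⟨q, hq, hqe⟩ := Submodule.mem_smul_span_singleton.1
      (Submodule.smul_mono le_rfl inf_le_right h1)
    have h2 : (q - y) * a ∈ p := by
      rw [← Ideal.Quotient.eq_zero_iff_mem, sub_mul, map_sub, sub_eq_zero, map_mul, ← hqe]
      rfl
    have h3 := (hp.mem_or_mem h2).resolve_right ha
    rw [show y = -(q - y) + q by ring]
    exact Submodule.add_mem_sup (neg_mem h3) hq
  exact ⟨c + 1, Nat.succ_pos c, fun t ht => (key t (by omega)).trans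
    (sup_le_sup_left (Ideal.pow_le_pow_right (by omega)) _)⟩

/-- If there is a chain of primes of length `k` below `Q`, then the Hilbert–Samuel function of `Q`
grows at least like a polynomial of degree `k`. -/
theorem exists_pow_le_codim_of_chain [IsNoetherianRing S] {Q : Ideal S} (hQ : Q ≠ ⊤)
    (hfin : ∀ t, FinCodim K (Q ^ t)) (k : ℕ) : ∀ (p : Fin (k + 1) → Ideal S), StrictMono p →
    (∀ j, (p j).IsPrime) → p (Fin.last k) ≤ Q →
    ∃ c m, 0 < c ∧ 0 < m ∧ ∀ s, 1 ≤ s → s ^ k ≤ m * codim K (p 0 ⊔ Q ^ (c * s)) := by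
  have hfin' : ∀ (p : Ideal S) t, FinCodim K (p ⊔ Q ^ t) := fun p t => (hfin t).mono le_sup_right
  induction k with
  | zero =>
    intro p _ _ hpQ
    refine ⟨1, 1, one_pos, one_pos, fun s hs => ?_⟩
    rw [pow_zero, one_mul]
    refine one_le_codim (hfin' _ _) fun h => hQ (eq_top_iff.2 ?_)
    rw [← h]
    exact sup_le hpQ (Ideal.pow_le_self (by omega))
  | succ k ih =>
    intro p hmono hprime hpQ
    obtain ⟨c₁, m, hc₁, hm, h⟩ := ih (fun j => p j.succ)
      (fun i j hij => hmono (Fin.succ_lt_succ_iff.2 hij)) (fun j => hprime _) hpQ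
    have h01 : p 0 < p (Fin.succ 0) := hmono (Fin.succ_pos 0)
    obtain ⟨a, ha1, ha0⟩ := SetLike.exists_of_lt h01
    obtain ⟨c, hc, hcol⟩ := exists_colon_sup_pow_le Q (hprime 0) ha0
    -- The multiplication sequence of an element of `p 1` outside `p 0`: the increment of the
    -- function of `p 0` over `c` steps is at least the function of the shorter chain.
    have hdiff : ∀ t, c ≤ t → codim K (p 0 ⊔ Q ^ (t - c)) + codim K (p (Fin.succ 0) ⊔ Q ^ t) ≤
        codim K (p 0 ⊔ Q ^ t) := by
      intro t ht
      rw [← codim_colon_add a (hfin' (p 0) t)]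
      refine add_le_add (codim_mono ((hfin' (p 0) t).mono ?_) (hcol t ht))
        (codim_mono ((hfin' (p 0) t).mono le_sup_left) ?_)
      · intro y hy
        rw [Submodule.mem_colon_singleton]
        exact Ideal.mul_mem_right _ _ hy
      · refine sup_le (sup_le_sup_right h01.le _) ?_
        rw [Ideal.span_singleton_le_iff_mem]
        exact Ideal.mem_sup_left ha1
    have hanti : ∀ (p : Ideal S) {t t' : ℕ}, t ≤ t' →
        codim K (p ⊔ Q ^ t) ≤ codim K (p ⊔ Q ^ t') := fun p t t' htt' =>
      codim_mono (hfin' p t') (sup_le_sup_left (Ideal.pow_le_pow_right htt') _)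
    refine ⟨c * c₁, m * (k + 1), Nat.mul_pos hc hc₁, by positivity, ?_⟩
    -- Increments of size about `s ^ k` sum to about `s ^ (k + 1)`. One step in `s` advances the
    -- exponent by `c * c₁ ≥ c`, enough to use `hdiff`.
    have : ∀ s, s ^ (k + 1) ≤ m * (k + 1) * codim K (p 0 ⊔ Q ^ (c * c₁ * s)) := by
      intro s
      induction s with
      | zero => simp
      | succ s ihs =>
        have h1 := h (s + 1) (by omega)
        have h2 : codim K (p (Fin.succ 0) ⊔ Q ^ (c₁ * (s + 1))) ≤
            codim K (p (Fin.succ 0) ⊔ Q ^ (c * c₁ * (s + 1))) :=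
          hanti _ (by nlinarith [Nat.mul_le_mul_right (c₁ * (s + 1)) hc])
        have h3 := hdiff (c * c₁ * (s + 1)) (by nlinarith [Nat.mul_pos hc hc₁])
        have h4 : codim K (p 0 ⊔ Q ^ (c * c₁ * s)) ≤
            codim K (p 0 ⊔ Q ^ (c * c₁ * (s + 1) - c)) :=
          hanti _ (by
            have : c * c₁ * (s + 1) = c * c₁ * s + c * c₁ := by ring
            have : c ≤ c * c₁ := Nat.le_mul_of_pos_right c hc₁
            omega)
        calc (s + 1) ^ (k + 1) ≤ s ^ (k + 1) + (k + 1) * (s + 1) ^ k := succ_pow_succ_le s k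
          _ ≤ m * (k + 1) * codim K (p 0 ⊔ Q ^ (c * c₁ * s)) +
              (k + 1) * (m * codim K (p (Fin.succ 0) ⊔ Q ^ (c₁ * (s + 1)))) :=
            add_le_add ihs (Nat.mul_le_mul_left _ h1)
          _ = m * (k + 1) * (codim K (p 0 ⊔ Q ^ (c * c₁ * s)) +
              codim K (p (Fin.succ 0) ⊔ Q ^ (c₁ * (s + 1)))) := by ring
          _ ≤ m * (k + 1) * codim K (p 0 ⊔ Q ^ (c * c₁ * (s + 1))) :=
            Nat.mul_le_mul_left _ (by omega)
    exact fun s _ => this s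

end Growth

section Chain

universe u

variable {K : Type*} [Field K]

/-- The ideals of a flag of affine subspaces through the point `x`. -/
noncomputable def flagIdeal {d : ℕ} (x : Fin d → K) (j : ℕ) : Ideal (MvPolynomial (Fin d) K) :=
  RingHom.ker (MvPolynomial.aeval (R := K) fun i : Fin d =>
    if (i : ℕ) < j then (MvPolynomial.C (x i) : MvPolynomial (Fin d) K) else MvPolynomial.X i)

theorem flagIdeal_isPrime {d : ℕ} (x : Fin d → K) (j : ℕ) : (flagIdeal x j).IsPrime :=
  RingHom.ker_isPrime _

theorem flagIdeal_lt {d : ℕ} (x : Fin d → K) {j : ℕ} (hj : j < d) :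
    flagIdeal x j < flagIdeal x (j + 1) := by
  refine lt_of_le_of_ne ?_ fun h => ?_
  · intro f hf
    have key : (MvPolynomial.aeval (R := K) fun i : Fin d => if (i : ℕ) < j + 1 then
          (MvPolynomial.C (x i) : MvPolynomial (Fin d) K) else MvPolynomial.X i) =
        (MvPolynomial.aeval (R := K) fun i : Fin d => if (i : ℕ) < j + 1 then
          (MvPolynomial.C (x i) : MvPolynomial (Fin d) K) else MvPolynomial.X i).comp
        (MvPolynomial.aeval (R := K) fun i : Fin d => if (i : ℕ) < j then
          (MvPolynomial.C (x i) : MvPolynomial (Fin d) K) else MvPolynomial.X i) := by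
      refine MvPolynomial.algHom_ext fun i => ?_
      simp only [AlgHom.comp_apply, MvPolynomial.aeval_X]
      by_cases hi : (i : ℕ) < j
      · rw [if_pos hi, if_pos (by omega), MvPolynomial.aeval_C, MvPolynomial.algebraMap_eq]
      · rw [if_neg hi, MvPolynomial.aeval_X]
    rw [flagIdeal, RingHom.mem_ker] at hf ⊢
    rw [key, AlgHom.comp_apply, hf, map_zero]
  · have h1 : (MvPolynomial.X ⟨j, hj⟩ - MvPolynomial.C (x ⟨j, hj⟩) : MvPolynomial (Fin d) K) ∈
        flagIdeal x (j + 1) := by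
      rw [flagIdeal, RingHom.mem_ker, map_sub, MvPolynomial.aeval_X, MvPolynomial.aeval_C,
        if_pos (Nat.lt_succ_self j), MvPolynomial.algebraMap_eq, sub_self]
    rw [← h, flagIdeal, RingHom.mem_ker, map_sub, MvPolynomial.aeval_X, MvPolynomial.aeval_C,
        if_neg (lt_irrefl j), MvPolynomial.algebraMap_eq, sub_eq_zero] at h1
    have := congrArg (MvPolynomial.coeff (Finsupp.single (⟨j, hj⟩ : Fin d) 1)) h1
    rw [MvPolynomial.coeff_X, if_pos rfl, MvPolynomial.coeff_C, if_neg] at this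
    · exact one_ne_zero this
    · intro h0
      exact one_ne_zero (Finsupp.single_eq_zero.1 h0.symm)

theorem flagIdeal_le_of_isMaximal [IsAlgClosed K] {d : ℕ} {I : Ideal (MvPolynomial (Fin d) K)}
    (hI : I.IsMaximal) : ∃ x, flagIdeal x d = I := by
  obtain ⟨x, rfl⟩ := MvPolynomial.isMaximal_iff_eq_vanishingIdeal_singleton.1 hI
  refine ⟨x, ?_⟩
  have key : (MvPolynomial.aeval (R := K) fun i : Fin d => if (i : ℕ) < d then
          (MvPolynomial.C (x i) : MvPolynomial (Fin d) K) else MvPolynomial.X i) =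
      (Algebra.ofId K (MvPolynomial (Fin d) K)).comp
        (MvPolynomial.aeval (R := K) x) := by
    refine MvPolynomial.algHom_ext fun i => ?_
    simp [Algebra.ofId_apply, MvPolynomial.algebraMap_eq]
  ext p
  rw [flagIdeal, key, RingHom.mem_ker, AlgHom.comp_apply,
    MvPolynomial.mem_vanishingIdeal_singleton_iff]
  change MvPolynomial.C _ = 0 ↔ _
  rw [map_eq_zero_iff _ (MvPolynomial.C_injective _ _)]

/-- The Hilbert–Samuel function of a maximal ideal of an affine domain grows at least like a
polynomial whose degree is the transcendence degree. -/
theorem exists_pow_le_codim_pow {K S : Type u} [Field K] [IsAlgClosed K] [CommRing S]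
    [IsDomain S] [Algebra K S] [Algebra.FiniteType K S] {d : ℕ} (hd : Algebra.trdeg K S = d)
    {Q : Ideal S} (hQ : Q.IsMaximal) (hfin : ∀ t, FinCodim K (Q ^ t)) :
    ∃ c m, 0 < c ∧ 0 < m ∧ ∀ s, 1 ≤ s → s ^ d ≤ m * codim K (Q ^ (c * s)) := by
  -- Noether normalization: a polynomial ring in as many variables as the transcendence degree, over
  -- which `S` is finite.
  obtain ⟨e, g, hg, hgfin⟩ := exists_finite_inj_algHom_of_fg K S
  algebraize [g.toRingHom]
  have : IsScalarTower K (MvPolynomial (Fin e) K) S :=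
    IsScalarTower.of_algebraMap_eq fun x => (g.commutes x).symm
  have : Module.Finite (MvPolynomial (Fin e) K) S := hgfin
  have : FaithfulSMul (MvPolynomial (Fin e) K) S := (faithfulSMul_iff_algebraMap_injective _ _).2 hg
  have : Algebra.IsIntegral (MvPolynomial (Fin e) K) S := inferInstance
  have hed : e = d := by
    have h1 := trdeg_add_eq K (MvPolynomial (Fin e) K) (A := S)
    rw [trdeg_eq_zero (R := MvPolynomial (Fin e) K), add_zero,
      MvPolynomial.trdeg_of_isDomain, hd] at h1
    simpa using h1
  subst hed
  have hmax : (Q.under (MvPolynomial (Fin e) K)).IsMaximal := Ideal.isMaximal_comap_of_isIntegral_of_isMaximal Q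
  obtain ⟨x, hx⟩ := flagIdeal_le_of_isMaximal hmax
  let l : LTSeries (PrimeSpectrum (MvPolynomial (Fin e) K)) :=
    LTSeries.mk e (fun j => ⟨flagIdeal x j, flagIdeal_isPrime x j⟩)
      (Fin.strictMono_iff_lt_succ.2 fun i => flagIdeal_lt x i.2)
  have hlast : l.last.asIdeal = Q.under (MvPolynomial (Fin e) K) := by
    rw [← hx]
    rfl
  have hlo : Q.LiesOver l.last.asIdeal := ⟨hlast⟩
  have hQp := hQ.isPrime
  have : IsNoetherianRing S := Algebra.FiniteType.isNoetherianRing K S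
  -- Going down lifts the flag of linear primes ending at the point below `Q` to a chain of the same
  -- length ending at `Q`.
  obtain ⟨L, hLlen, hLlast, -⟩ := Ideal.exists_ltSeries_of_hasGoingDown l Q
  have hmono : StrictMono fun j => (L j).asIdeal := fun i j hij => L.strictMono hij
  have hle : (L (Fin.last _)).asIdeal ≤ Q := by
    have : L (Fin.last _) = L.last := rfl
    rw [this, hLlast]
  obtain ⟨c, m, hc, hm, h⟩ := exists_pow_le_codim_of_chain (K := K) hQ.ne_top hfin L.length
    (fun j => (L j).asIdeal) hmono (fun j => (L j).isPrime) hle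
  refine ⟨c, m, hc, hm, fun s hs => ?_⟩
  have hlen : L.length = e := hLlen
  refine (congrArg (s ^ ·) hlen.symm).le.trans ?_
  exact (h s hs).trans (Nat.mul_le_mul_left _ (codim_mono (hfin _) le_sup_right))

end Chain

/-! ### The chart `R[A/x]` and colength differences -/

section Blowup

variable {R : Type*} [CommRing R] [IsDomain R] (A : Ideal R) (x : R)

/-- The affine chart `R[A/x]` of the blowup of `A + (x)`. -/
noncomputable def blowupAlgebra : Subalgebra R (FractionRing R) :=
  Algebra.adjoin R {y | ∃ a ∈ A, y = algebraMap R (FractionRing R) a / algebraMap R (FractionRing R) x}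

/-- The ideal of `R[A/x]` generated by `A/x`. -/
noncomputable def blowupIdeal : Ideal (blowupAlgebra A x) :=
  Ideal.span {s | ∃ a ∈ A, (s : FractionRing R) =
    algebraMap R (FractionRing R) a / algebraMap R (FractionRing R) x}

variable {A x}

local notation "φ" => algebraMap R (FractionRing R)

theorem exists_mul_pow_eq_of_mem_blowupAlgebra (hx : x ≠ 0) {s : FractionRing R}
    (hs : s ∈ blowupAlgebra A x) : ∃ k, ∃ w ∈ (A ⊔ Ideal.span {x}) ^ k, s * φ x ^ k = φ w := by
  have hx' : φ x ≠ 0 := by simpa using hx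
  have hxJ : ∀ k, x ^ k ∈ (A ⊔ Ideal.span {x}) ^ k := fun k =>
    Ideal.pow_mem_pow (Ideal.mem_sup_right (Ideal.mem_span_singleton_self x)) k
  induction hs using Algebra.adjoin_induction with
  | mem y hy =>
    obtain ⟨a, ha, rfl⟩ := hy
    refine ⟨1, a, ?_, ?_⟩
    · rw [pow_one]
      exact Ideal.mem_sup_left ha
    · field_simp
  | algebraMap r => exact ⟨0, r, by simp, by simp⟩
  | add y z _ _ hy hz =>
    obtain ⟨k, w, hw, e⟩ := hy
    obtain ⟨l, v, hv, e'⟩ := hz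
    refine ⟨k + l, w * x ^ l + x ^ k * v, add_mem ?_ ?_, ?_⟩
    · rw [pow_add]
      exact Ideal.mul_mem_mul hw (hxJ l)
    · rw [pow_add]
      exact Ideal.mul_mem_mul (hxJ k) hv
    · rw [map_add, map_mul, map_mul, ← e, ← e', map_pow, map_pow]
      ring
  | mul y z _ _ hy hz =>
    obtain ⟨k, w, hw, e⟩ := hy
    obtain ⟨l, v, hv, e'⟩ := hz
    refine ⟨k + l, w * v, ?_, ?_⟩
    · rw [pow_add]
      exact Ideal.mul_mem_mul hw hv
    · rw [map_mul, ← e, ← e']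
      ring

/-- Clears denominators. For `s = 1` it shows that if `A/x` generates the unit ideal, then `x`
satisfies an integral equation `x ^ (k + 1) ∈ A (A + (x)) ^ k`. -/
theorem exists_mul_pow_eq_of_mem_blowupIdeal (hx : x ≠ 0) {s : blowupAlgebra A x}
    (hs : s ∈ blowupIdeal A x) :
    ∃ k, ∃ w ∈ A * (A ⊔ Ideal.span {x}) ^ k, (s : FractionRing R) * φ x ^ (k + 1) = φ w := by
  have hx' : φ x ≠ 0 := by simpa using hx
  have hxJ : ∀ k, x ^ k ∈ (A ⊔ Ideal.span {x}) ^ k := fun k =>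
    Ideal.pow_mem_pow (Ideal.mem_sup_right (Ideal.mem_span_singleton_self x)) k
  induction hs using Submodule.span_induction with
  | mem y hy =>
    obtain ⟨a, ha, e⟩ := hy
    refine ⟨0, a, by simpa using ha, ?_⟩
    rw [e, zero_add, pow_one, div_mul_cancel₀ _ hx']
  | zero => exact ⟨0, 0, by simp, by simp⟩
  | add y z _ _ hy hz =>
    obtain ⟨k, w, hw, e⟩ := hy
    obtain ⟨l, v, hv, e'⟩ := hz
    refine ⟨k + l + 1, w * x ^ (l + 1) + v * x ^ (k + 1), add_mem ?_ ?_, ?_⟩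
    · rw [show k + l + 1 = k + (l + 1) by ring, pow_add, ← mul_assoc]
      exact Ideal.mul_mem_mul hw (hxJ _)
    · rw [show k + l + 1 = l + (k + 1) by ring, pow_add, ← mul_assoc]
      exact Ideal.mul_mem_mul hv (hxJ _)
    · rw [map_add, map_mul, map_mul, ← e, ← e', map_pow, map_pow, AddMemClass.coe_add]
      ring
  | smul r y _ hy =>
    obtain ⟨l, v, hv, e'⟩ := hy
    obtain ⟨k, w, hw, e⟩ := exists_mul_pow_eq_of_mem_blowupAlgebra hx r.2
    refine ⟨k + l, v * w, ?_, ?_⟩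
    · rw [add_comm, pow_add, ← mul_assoc]
      exact Ideal.mul_mem_mul hv hw
    · rw [map_mul, ← e, ← e', smul_eq_mul, MulMemClass.coe_mul]
      ring

theorem exists_mem_blowupIdeal_pow (hx : x ≠ 0) (k : ℕ) : ∀ a ∈ A ^ k,
    ∃ s ∈ blowupIdeal A x ^ k, (s : FractionRing R) * φ x ^ k = φ a := by
  have hx' : φ x ≠ 0 := by simpa using hx
  induction k with
  | zero =>
    intro a _
    exact ⟨algebraMap R _ a, by simp, by simp⟩
  | succ k ih =>
    intro a ha
    rw [pow_succ] at ha
    induction ha using Submodule.mul_induction_on' with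
    | mem_mul_mem u hu v hv =>
      obtain ⟨s, hs, e⟩ := ih u hu
      have hv' : φ v / φ x ∈ blowupAlgebra A x := Algebra.subset_adjoin ⟨v, hv, rfl⟩
      refine ⟨s * ⟨_, hv'⟩, ?_, ?_⟩
      · rw [pow_succ]
        exact Ideal.mul_mem_mul hs (Ideal.subset_span ⟨v, hv, rfl⟩)
      · rw [map_mul, ← e, MulMemClass.coe_mul, pow_succ]
        field_simp
    | add u _ v _ hu hv =>
      obtain ⟨s, hs, e⟩ := hu
      obtain ⟨s', hs', e'⟩ := hv
      refine ⟨s + s', add_mem hs hs', ?_⟩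
      rw [map_add, ← e, ← e', AddMemClass.coe_add]
      ring

theorem div_pow_mem_blowupAlgebra (hx : x ≠ 0) (k : ℕ) : ∀ w ∈ (A ⊔ Ideal.span {x}) ^ k,
    φ w / φ x ^ k ∈ blowupAlgebra A x := by
  have hx' : φ x ≠ 0 := by simpa using hx
  induction k with
  | zero =>
    intro w _
    rw [pow_zero, div_one]
    exact (blowupAlgebra A x).algebraMap_mem w
  | succ k ih =>
    intro a ha
    rw [pow_succ] at ha
    induction ha using Submodule.mul_induction_on' with
    | mem_mul_mem u hu v hv =>
      obtain ⟨a, ha, b, hb, rfl⟩ := Submodule.mem_sup.1 hv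
      obtain ⟨r, rfl⟩ := Ideal.mem_span_singleton'.1 hb
      have h1 : φ a / φ x ∈ blowupAlgebra A x := Algebra.subset_adjoin ⟨a, ha, rfl⟩
      have e : φ (u * (a + r * x)) / φ x ^ (k + 1) = φ u / φ x ^ k * (φ a / φ x + φ r) := by
        rw [map_mul, map_add, map_mul]
        field_simp
        ring
      rw [e]
      exact mul_mem (ih u hu) (add_mem h1 ((blowupAlgebra A x).algebraMap_mem r))
    | add u _ v _ hu hv =>
      rw [map_add, add_div]
      exact add_mem hu hv

theorem sup_span_pow_succ_le {R : Type*} [CommRing R] {A : Ideal R} {x : R} (k : ℕ) : (A ⊔ Ideal.span {x}) ^ (k + 1) ≤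
    A ^ (k + 1) ⊔ Ideal.span {x} * (A ⊔ Ideal.span {x}) ^ k := by
  induction k with
  | zero => simp
  | succ k ih =>
    rw [pow_succ, Ideal.mul_sup]
    refine sup_le ?_ ?_
    · refine (Ideal.mul_mono_left ih).trans ?_
      rw [Ideal.sup_mul, ← pow_succ, mul_assoc, pow_succ (A ⊔ Ideal.span {x}) k]
      exact sup_le_sup_left (Ideal.mul_mono_right (Ideal.mul_mono_right le_sup_left)) _
    · rw [mul_comm]
      exact le_sup_right

/-- Every class modulo the `t`-th power of the ideal generated by `A/x` has a representative `w / x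
^ t` with `w ∈ (A + (x)) ^ t`: larger denominators can be lowered. -/
theorem exists_sub_mul_pow_eq (hx : x ≠ 0) (t : ℕ) (s : blowupAlgebra A x) :
    ∃ r ∈ blowupIdeal A x ^ t, ∃ w ∈ (A ⊔ Ideal.span {x}) ^ t,
      ((s - r : blowupAlgebra A x) : FractionRing R) * φ x ^ t = φ w := by
  have hx' : φ x ≠ 0 := by simpa using hx
  have key : ∀ (j : ℕ) (s : blowupAlgebra A x), ∀ w ∈ (A ⊔ Ideal.span {x}) ^ (t + j),
      (s : FractionRing R) * φ x ^ (t + j) = φ w →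
      ∃ r ∈ blowupIdeal A x ^ t, ∃ w ∈ (A ⊔ Ideal.span {x}) ^ t,
        ((s - r : blowupAlgebra A x) : FractionRing R) * φ x ^ t = φ w := by
    intro j
    induction j with
    | zero =>
      intro s w hw e
      exact ⟨0, zero_mem _, w, hw, by simpa using e⟩
    | succ j ih =>
      intro s w hw e
      -- By `J ^ (k + 1) ≤ A ^ (k + 1) + x J ^ k` for `J = A + (x)`, the first part over `x ^ (k +
      -- 1)` lies in a high power of the ideal, and the second cancels one `x`.
      obtain ⟨a, ha, b, hb, rfl⟩ := Submodule.mem_sup.1 (sup_span_pow_succ_le (t + j) hw)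
      obtain ⟨w', hw', rfl⟩ := Ideal.mem_span_singleton_mul.1 hb
      obtain ⟨r₁, hr₁, e₁⟩ := exists_mem_blowupIdeal_pow hx (t + j + 1) a ha
      obtain ⟨r₂, hr₂, v, hv, e₂⟩ := ih (s - r₁) w' hw' (by
        refine mul_right_cancel₀ hx' ?_
        rw [mul_assoc, ← pow_succ, AddSubgroupClass.coe_sub, sub_mul, e₁]
        rw [← add_assoc] at e
        rw [e, map_add, map_mul]
        ring)
      refine ⟨r₁ + r₂, add_mem (Ideal.pow_le_pow_right (by omega) hr₁) hr₂, v, hv, ?_⟩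
      rw [← sub_sub]
      exact e₂
  obtain ⟨k, w, hw, e⟩ := exists_mul_pow_eq_of_mem_blowupAlgebra hx s.2
  refine key k s (x ^ t * w) ?_ ?_
  · rw [pow_add]
    exact Ideal.mul_mem_mul
      (Ideal.pow_mem_pow (Ideal.mem_sup_right (Ideal.mem_span_singleton_self x)) t) hw
  · rw [map_mul, ← e, pow_add, map_pow]
    ring

theorem blowupAlgebra_fg (A : Ideal R) (hA : A.FG) (x : R) : (blowupAlgebra A x).FG := by
  classical
  obtain ⟨g, hg⟩ := hA
  refine ⟨g.image fun a => φ a / φ x, le_antisymm ?_ ?_⟩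
  · refine Algebra.adjoin_mono ?_
    rintro _ hy
    obtain ⟨a, ha, rfl⟩ := Finset.mem_image.1 (Finset.mem_coe.1 hy)
    exact ⟨a, hg ▸ Ideal.subset_span ha, rfl⟩
  · refine Algebra.adjoin_le ?_
    rintro _ ⟨a, ha, rfl⟩
    rw [← hg] at ha
    rw [SetLike.mem_coe]
    induction ha using Submodule.span_induction with
    | mem y hy =>
      exact Algebra.subset_adjoin (Finset.mem_coe.2 (Finset.mem_image_of_mem _ hy))
    | zero => simp
    | add u v _ _ hu hv => rw [map_add, add_div]; exact add_mem hu hv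
    | smul r u _ hu =>
      rw [smul_eq_mul, map_mul, mul_div_assoc]
      exact mul_mem (Subalgebra.algebraMap_mem _ r) hu

end Blowup

section Rees

universe u

variable {K R : Type u} [Field K] [CommRing R] [IsDomain R] [Algebra K R]
  {A : Ideal R} {x : R}

/-- With `J = A + (x)`, the map `w ↦ w / x ^ t` sends `J ^ t` onto the quotient by the `t`-th power
of the ideal of the chart and kills `A ^ t`. The dimension of that quotient is therefore at most
that of `J ^ t / A ^ t`. -/
theorem finCodim_blowupIdeal_pow (hx : x ≠ 0) (t : ℕ) (hfin : FinCodim K (A ^ t)) :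
    FinCodim K (blowupIdeal A x ^ t) ∧
      codim K (blowupIdeal A x ^ t) + codim K ((A ⊔ Ideal.span {x}) ^ t) ≤ codim K (A ^ t) := by
  have hx' : algebraMap R (FractionRing R) x ≠ 0 := by simpa using hx
  have hAJ : A ^ t ≤ (A ⊔ Ideal.span {x}) ^ t := Ideal.pow_right_mono le_sup_left t
  let U : Submodule K R := ((A ⊔ Ideal.span {x}) ^ t).restrictScalars K
  let W := LinearMap.ker (Ideal.Quotient.factorₐ K hAJ).toLinearMap
  have hkW : ∀ y : R, Ideal.Quotient.mk (A ^ t) y ∈ W ↔ y ∈ (A ⊔ Ideal.span {x}) ^ t := fun y => by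
    rw [LinearMap.mem_ker]
    exact Ideal.Quotient.eq_zero_iff_mem
  let f : U →ₗ[K] W := ((Ideal.Quotient.mkₐ K (A ^ t)).toLinearMap.restrict
    (p := U) (q := W) fun y hy => (hkW y).2 hy)
  have hf : Function.Surjective f := by
    rintro ⟨v, hv⟩
    obtain ⟨y, rfl⟩ := Ideal.Quotient.mk_surjective v
    exact ⟨⟨y, (hkW y).1 hv⟩, rfl⟩
  let g₀ : U →ₗ[K] blowupAlgebra A x :=
    { toFun := fun w => ⟨algebraMap R (FractionRing R) w / algebraMap R (FractionRing R) x ^ t,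
        div_pow_mem_blowupAlgebra hx t w w.2⟩
      map_add' := fun v w => Subtype.ext (by simp [add_div])
      map_smul' := fun c w => Subtype.ext (by
        simp [Algebra.smul_def, mul_div_assoc, IsScalarTower.algebraMap_apply K R (FractionRing R)]) }
  let g : U →ₗ[K] (blowupAlgebra A x ⧸ blowupIdeal A x ^ t) :=
    (Ideal.Quotient.mkₐ K (blowupIdeal A x ^ t)).toLinearMap ∘ₗ g₀
  have hg : Function.Surjective g := by
    intro v
    obtain ⟨s, rfl⟩ := Ideal.Quotient.mk_surjective v
    obtain ⟨r, hr, w, hw, e⟩ := exists_sub_mul_pow_eq hx t s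
    refine ⟨⟨w, hw⟩, ?_⟩
    have : g₀ ⟨w, hw⟩ = s - r := Subtype.ext (by
      change algebraMap R (FractionRing R) w / algebraMap R (FractionRing R) x ^ t = _
      rw [← e, mul_div_cancel_right₀ _ (pow_ne_zero t hx')])
    change Ideal.Quotient.mk _ (g₀ ⟨w, hw⟩) = _
    rw [this]
    exact Ideal.Quotient.eq.2 (by simpa using neg_mem hr)
  have hker : ∀ w, f w = 0 → g w = 0 := by
    intro w hw
    have hwA : (w : R) ∈ A ^ t := Ideal.Quotient.eq_zero_iff_mem.1 (congrArg Subtype.val hw)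
    obtain ⟨s, hs, e⟩ := exists_mem_blowupIdeal_pow hx t w hwA
    have : g₀ w = s := Subtype.ext (by
      change algebraMap R (FractionRing R) w / algebraMap R (FractionRing R) x ^ t = _
      rw [← e, mul_div_cancel_right₀ _ (pow_ne_zero t hx')])
    change Ideal.Quotient.mk _ (g₀ w) = _
    rw [this, Ideal.Quotient.eq_zero_iff_mem.2 hs]
  -- `f` is the projection of `J ^ t` onto `J ^ t / A ^ t`. As `g` kills its kernel, composing `g`
  -- with a linear section of `f` is still surjective.
  obtain ⟨σ, hσ⟩ := f.exists_rightInverse_of_surjective (LinearMap.range_eq_top.2 hf)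
  have hgσ : Function.Surjective (g ∘ₗ σ) := by
    intro v
    obtain ⟨w, rfl⟩ := hg v
    refine ⟨f w, ?_⟩
    have := hker (σ (f w) - w) (by
      rw [map_sub, sub_eq_zero]
      exact LinearMap.congr_fun hσ (f w))
    rw [map_sub, sub_eq_zero] at this
    exact this
  refine ⟨Module.Finite.of_surjective _ hgσ, ?_⟩
  rw [codim_eq_add_finrank_ker hfin hAJ, add_comm]
  exact add_le_add_right (LinearMap.finrank_le_finrank_of_surjective hgσ) _

/-- If `x` is not integral over `A`, then the powers of `A` and of `A + (x)` have colengths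
differing by at least a polynomial of degree the dimension. -/
theorem exists_pow_add_le_codim_of_not_integral [IsAlgClosed K] [Algebra.FiniteType K R] {d : ℕ}
    (hd : Algebra.trdeg K R = d) (hx : x ≠ 0) (hfin : ∀ t, FinCodim K (A ^ t))
    (h : ∀ k, x ^ (k + 1) ∉ A * (A ⊔ Ideal.span {x}) ^ k) :
    ∃ c m, 0 < c ∧ 0 < m ∧ ∀ s, 1 ≤ s →
      s ^ d + m * codim K ((A ⊔ Ideal.span {x}) ^ (c * s)) ≤ m * codim K (A ^ (c * s)) := by
  have : IsNoetherianRing R := Algebra.FiniteType.isNoetherianRing K R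
  have hne : blowupIdeal A x ≠ ⊤ := by
    intro htop
    obtain ⟨k, w, hw, e⟩ := exists_mul_pow_eq_of_mem_blowupIdeal hx
      (s := 1) (htop ▸ Submodule.mem_top)
    rw [OneMemClass.coe_one, one_mul, ← map_pow] at e
    exact h k (IsFractionRing.injective R (FractionRing R) e ▸ hw)
  obtain ⟨Q, hQ, hle⟩ := Ideal.exists_le_maximal _ hne
  have : Algebra.FiniteType R (blowupAlgebra A x) :=
    Subalgebra.fg_iff_finiteType _ |>.1 (blowupAlgebra_fg A (IsNoetherian.noetherian A) x)
  have : Algebra.FiniteType K (blowupAlgebra A x) :=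
    Algebra.FiniteType.trans (S := R) inferInstance inferInstance
  have hinj : Function.Injective (algebraMap R (blowupAlgebra A x)) := fun a b hab =>
    IsFractionRing.injective R (FractionRing R) (congrArg Subtype.val hab)
  have : FaithfulSMul R (blowupAlgebra A x) := (faithfulSMul_iff_algebraMap_injective _ _).2 hinj
  have : FaithfulSMul K R :=
    (faithfulSMul_iff_algebraMap_injective _ _).2 (algebraMap K R).injective
  have : Algebra.IsAlgebraic R (FractionRing R) := (IsFractionRing.comap_isAlgebraic_iff (K := FractionRing R)).2 inferInstance
  have : Algebra.IsAlgebraic R (blowupAlgebra A x) :=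
    Algebra.IsAlgebraic.of_injective (blowupAlgebra A x).val Subtype.val_injective
  -- The chart lies between `R` and its fraction field, so its transcendence degree is that of `R`.
  have hd' : Algebra.trdeg K (blowupAlgebra A x) = d := by
    rw [← trdeg_add_eq K R, trdeg_eq_zero (R := R), add_zero, hd]
  have hfinQ : ∀ t, FinCodim K (Q ^ t) := fun t =>
    (finCodim_blowupIdeal_pow hx t (hfin t)).1.mono (Ideal.pow_right_mono hle t)
  obtain ⟨c, m, hc, hm, hgrow⟩ := exists_pow_le_codim_pow hd' hQ hfinQ
  refine ⟨c, m, hc, hm, fun s hs => ?_⟩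
  obtain ⟨h1, h2⟩ := finCodim_blowupIdeal_pow hx (c * s) (hfin (c * s))
  have h3 := codim_mono h1 (Ideal.pow_right_mono hle (c * s))
  calc _ ≤ m * codim K (blowupIdeal A x ^ (c * s)) +
        m * codim K ((A ⊔ Ideal.span {x}) ^ (c * s)) :=
      add_le_add_left ((hgrow s hs).trans (Nat.mul_le_mul_left m h3)) _
    _ ≤ _ := by
      rw [← mul_add]
      exact Nat.mul_le_mul_left m h2

end Rees

/-! ### Multiplicities and reductions -/

theorem eq_zero_of_sum_choose_eq_zero {D N : ℕ} {g : ℕ → ℚ}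
    (h : ∀ a, N ≤ a → ∑ u ∈ Finset.range D, g u * (a.choose u : ℚ) = 0) : ∀ u < D, g u = 0 := by
  have h1 := coeff_eq_zero_of_growth (f := fun _ => 0) (N := N) (m := 0) (K := 0) D
    (fun a ha => (h a ha).symm) (by simp)
  intro u hu
  rcases Nat.eq_zero_or_pos u with rfl | hp
  · have h2 := h N le_rfl
    rw [Finset.sum_eq_single 0] at h2
    · simpa using h2
    · intro v hv hv0
      rw [h1 v (Finset.mem_range.1 hv) (Nat.pos_of_ne_zero hv0), zero_mul]
    · intro h0
      exact absurd (Finset.mem_range.2 hu) h0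
  · exact h1 u hu hp

theorem tendsto_shift_div_pow_iff {f : ℕ → ℝ} (N d : ℕ) {l : ℝ} :
    Tendsto (fun a : ℕ => f (a + N) / (a : ℝ) ^ d) atTop (𝓝 l) ↔
      Tendsto (fun a : ℕ => f a / (a : ℝ) ^ d) atTop (𝓝 l) := by
  have h1 : Tendsto (fun a : ℕ => ((((a + N : ℕ) : ℝ) / a) ^ d)) atTop (𝓝 1) := by
    have : Tendsto (fun a : ℕ => 1 + (N : ℝ) / a) atTop (𝓝 (1 + 0)) :=
      tendsto_const_nhds.add (tendsto_const_div_atTop_nhds_zero_nat _)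
    rw [add_zero] at this
    have h := this.pow d
    rw [one_pow] at h
    refine h.congr' ?_
    filter_upwards [eventually_gt_atTop 0] with a ha
    have : (a : ℝ) ≠ 0 := by positivity
    push_cast
    field_simp
  have h2 := h1.inv₀ one_ne_zero
  rw [inv_one] at h2
  rw [← tendsto_add_atTop_iff_nat (f := fun a : ℕ => f a / (a : ℝ) ^ d) N]
  constructor
  · intro h
    have := h.mul h2
    rw [mul_one] at this
    refine this.congr' ?_
    filter_upwards [eventually_gt_atTop 0] with a ha
    have : (a : ℝ) ≠ 0 := by positivity
    have : ((a + N : ℕ) : ℝ) ≠ 0 := by positivity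
    rw [div_pow]
    field_simp
  · intro h
    have := h.mul h1
    rw [mul_one] at this
    refine this.congr' ?_
    filter_upwards [eventually_gt_atTop 0] with a ha
    have : (a : ℝ) ≠ 0 := by positivity
    have : ((a + N : ℕ) : ℝ) ≠ 0 := by positivity
    rw [div_pow]
    field_simp

section Multiplicity

variable {K : Type*} [Field K] {n : ℕ}

theorem IsHilbertSamuel.unique {Y : Ideal (MvPolynomial (Fin n) K)} {c d : ℕ → ℕ → ℚ}
    (hc : IsHilbertSamuel Y c) (hd : IsHilbertSamuel Y d) : c = d := by
  obtain ⟨hc0, N, hN⟩ := hc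
  obtain ⟨hd0, N', hN'⟩ := hd
  have key : ∀ b, max N N' ≤ b → ∀ u < n + 1,
      ∑ v ∈ Finset.range (n + 1), (c u v - d u v) * (b.choose v : ℚ) = 0 := by
    intro b hb
    refine eq_zero_of_sum_choose_eq_zero (N := max N N') fun a ha => ?_
    have h1 := hN a b (le_of_max_le_left ha) (le_of_max_le_left hb)
    rw [hN' a b (le_of_max_le_right ha) (le_of_max_le_right hb), eq_comm, ← sub_eq_zero,
      ← Finset.sum_sub_distrib] at h1
    rw [← h1]
    refine Finset.sum_congr rfl fun u _ => ?_
    rw [Finset.sum_mul, ← Finset.sum_sub_distrib]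
    exact Finset.sum_congr rfl fun v _ => by ring
  funext u v
  by_cases huv : n < u + v
  · rw [hc0 u v huv, hd0 u v huv]
  · exact sub_eq_zero.1 (eq_zero_of_sum_choose_eq_zero (fun b hb => key b hb u (by omega)) v
      (by omega))

open Classical in
/-- The coefficient of `C(a, u) C(b, v)` in the polynomial giving the codimension of
`Y ^ a * 𝔪 ^ b`. -/
noncomputable def hsCoeff (Y : Ideal (MvPolynomial (Fin n) K)) (u v : ℕ) : ℚ :=
  if h : ∃ c, IsHilbertSamuel Y c then h.choose u v else 0

theorem IsHilbertSamuel.hsCoeff_eq {Y : Ideal (MvPolynomial (Fin n) K)} {c : ℕ → ℕ → ℚ}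
    (hc : IsHilbertSamuel Y c) : hsCoeff Y = c := by
  have h : ∃ c, IsHilbertSamuel Y c := ⟨c, hc⟩
  funext u v
  rw [hsCoeff, dif_pos h, h.choose_spec.unique hc]

theorem IsVarsPrimary.isHilbertSamuel [Infinite K] {Y : Ideal (MvPolynomial (Fin n) K)}
    (hY : IsVarsPrimary Y) : IsHilbertSamuel Y (hsCoeff Y) := by
  obtain ⟨c, hc⟩ := exists_isHilbertSamuel n hY
  rwa [hc.hsCoeff_eq]

theorem exists_section_hsCoeff_eq [Infinite K] (i m : ℕ)
    (s : Finset (Ideal (MvPolynomial (Fin (i + m)) K))) (hs : ∀ Y ∈ s, IsVarsPrimary Y) :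
    ∃ π : MvPolynomial (Fin (i + m)) K →ₐ[K] MvPolynomial (Fin i) K,
      (varsIdeal K (i + m)).map π = varsIdeal K i ∧
      ∀ Y ∈ s, hsCoeff Y i m = hsCoeff (Y.map π) i 0 := by
  obtain ⟨π, -, hπ, h⟩ := exists_linear_section i m s hs
  refine ⟨π, hπ, fun Y hY => ?_⟩
  obtain ⟨c, hc, e⟩ := h Y hY _ ((hs Y hY).map hπ).isHilbertSamuel
  rw [hc.hsCoeff_eq, e]

/-- The bivariate polynomial is valid only for large `b`, but passing from `b = 0` to `b = N` does
not change the leading term in `a`. This makes `hsCoeff Z n 0` the multiplicity of `Z`. -/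
theorem tendsto_codim_pow_div [Infinite K] {Z : Ideal (MvPolynomial (Fin n) K)}
    (hZ : IsVarsPrimary Z) (hZM : Z ≤ varsIdeal K n) :
    Tendsto (fun a : ℕ => (codim K (Z ^ a) : ℝ) / (a : ℝ) ^ n) atTop
      (𝓝 ((hsCoeff Z n 0 : ℝ) / n.factorial)) := by
  obtain ⟨hc0, N, hN⟩ := hZ.isHilbertSamuel
  have h1 : Tendsto (fun a : ℕ => (codim K (Z ^ a * varsIdeal K n ^ N) : ℝ) / (a : ℝ) ^ n) atTop
      (𝓝 ((hsCoeff Z n 0 : ℝ) / n.factorial)) := by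
    have := tendsto_sum_choose_div_pow n
      (fun u => ∑ v ∈ Finset.range (n + 1), hsCoeff Z u v * (N.choose v : ℚ))
    have e : ∑ v ∈ Finset.range (n + 1), hsCoeff Z n v * (N.choose v : ℚ) = hsCoeff Z n 0 := by
      rw [Finset.sum_eq_single 0]
      · simp
      · intro v _ hv
        rw [hc0 n v (by omega), zero_mul]
      · simp
    simp only [e] at this
    refine this.congr' ?_
    filter_upwards [eventually_ge_atTop N] with a ha
    congr 1
    have := hN a N ha le_rfl
    rw [← Rat.cast_natCast, this]
    congr 1
    refine Finset.sum_congr rfl fun u _ => ?_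
    rw [Finset.sum_mul]
    exact Finset.sum_congr rfl fun v _ => by ring
  rw [← tendsto_shift_div_pow_iff N]
  -- Sandwich from `Z ^ (a + N) * 𝔪 ^ N ≤ Z ^ (a + N) ≤ Z ^ a * 𝔪 ^ N`, where the last inclusion
  -- uses `Z ≤ 𝔪`.
  refine tendsto_of_tendsto_of_tendsto_of_le_of_le h1
    ((tendsto_shift_div_pow_iff (f := fun a => (codim K (Z ^ a * varsIdeal K n ^ N) : ℝ)) N n).2 h1)
    (fun a => ?_) (fun a => ?_)
  · refine div_le_div_of_nonneg_right ?_ (by positivity)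
    refine Nat.cast_le.2 (codim_mono (hZ.pow _).finCodim ?_)
    rw [pow_add]
    exact Ideal.mul_mono_right (Ideal.pow_right_mono hZM N)
  · refine div_le_div_of_nonneg_right ?_ (by positivity)
    exact Nat.cast_le.2 (codim_mono ((hZ.pow _).mul (.vars_pow _)).finCodim Ideal.mul_le_left)

theorem hsCoeff_eq_of_tendsto [Infinite K] {Z : Ideal (MvPolynomial (Fin n) K)}
    (hZ : IsVarsPrimary Z) (hZM : Z ≤ varsIdeal K n) {q : ℚ}
    (h : Tendsto (fun a : ℕ => (codim K (Z ^ a) : ℝ) / (a : ℝ) ^ n) atTop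
      (𝓝 ((q : ℝ) / n.factorial))) : hsCoeff Z n 0 = q := by
  have := tendsto_nhds_unique (tendsto_codim_pow_div hZ hZM) h
  have hf : (n.factorial : ℝ) ≠ 0 := by positivity
  field_simp at this
  exact_mod_cast this

theorem hsCoeff_top_anti [Infinite K] {Z Z' : Ideal (MvPolynomial (Fin n) K)}
    (hZ : IsVarsPrimary Z) (h : Z ≤ Z') (hM : Z' ≤ varsIdeal K n) :
    hsCoeff Z' n 0 ≤ hsCoeff Z n 0 := by
  have := le_of_tendsto_of_tendsto' (tendsto_codim_pow_div (hZ.mono h) hM)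
    (tendsto_codim_pow_div hZ (h.trans hM)) (fun a => by
      refine div_le_div_of_nonneg_right ?_ (by positivity)
      exact_mod_cast codim_mono (hZ.pow _).finCodim (Ideal.pow_right_mono h a))
  rw [div_le_div_iff_of_pos_right (by positivity)] at this
  exact_mod_cast this

theorem hsCoeff_top_pow [Infinite K] {Z : Ideal (MvPolynomial (Fin n) K)}
    (hZ : IsVarsPrimary Z) (hM : Z ≤ varsIdeal K n) {k : ℕ} (hk : 1 ≤ k) :
    hsCoeff (Z ^ k) n 0 = (k : ℚ) ^ n * hsCoeff Z n 0 := by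
  refine hsCoeff_eq_of_tendsto (hZ.pow k) ((Ideal.pow_le_self (by omega)).trans hM) ?_
  have h1 := ((tendsto_codim_pow_div hZ hM).comp
    (tendsto_id.const_mul_atTop' (show 0 < k by omega))).const_mul ((k : ℝ) ^ n)
  push_cast
  rw [mul_div_assoc]
  refine h1.congr' ?_
  filter_upwards [eventually_gt_atTop 0] with a ha
  have : (a : ℝ) ≠ 0 := by positivity
  have : (k : ℝ) ≠ 0 := by positivity
  simp only [Function.comp, id]
  rw [pow_mul]
  push_cast
  rw [mul_pow]
  field_simp

theorem hsCoeff_top_vars [Infinite K] : hsCoeff (varsIdeal K n) n 0 = 1 := by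
  refine hsCoeff_eq_of_tendsto ⟨1, by simp⟩ le_rfl ?_
  rw [← tendsto_shift_div_pow_iff 1]
  have h := tendsto_choose_div_pow (le_refl n)
  rw [if_pos rfl, ← tendsto_shift_div_pow_iff n] at h
  simp only [(finCodim_and_codim_vars_pow_succ n _).2]
  simpa using h

/-- `A' N ⊆ A N` for some ideal `N` containing a power of `𝔪`: up to passing to `A + A'`, this says
that `A` is a reduction of `A'`. -/
def IsReductionOf (A A' : Ideal (MvPolynomial (Fin n) K)) : Prop :=
  ∃ N, IsVarsPrimary N ∧ A' * N ≤ A * N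

namespace IsReductionOf

variable {A A' C C' D : Ideal (MvPolynomial (Fin n) K)}

theorem refl (A : Ideal (MvPolynomial (Fin n) K)) : IsReductionOf A A := ⟨⊤, ⟨0, le_top⟩, le_rfl⟩

theorem mul (h : IsReductionOf A A') (h' : IsReductionOf C C') :
    IsReductionOf (A * C) (A' * C') := by
  obtain ⟨N, hN, e⟩ := h
  obtain ⟨N', hN', e'⟩ := h'
  refine ⟨N * N', hN.mul hN', ?_⟩
  rw [mul_mul_mul_comm, mul_mul_mul_comm A]
  exact Ideal.mul_mono e e'

theorem pow (h : IsReductionOf A A') (k : ℕ) : IsReductionOf (A ^ k) (A' ^ k) := by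
  induction k with
  | zero => simpa using refl _
  | succ k ih =>
    rw [pow_succ, pow_succ]
    exact ih.mul h

theorem sup (h : IsReductionOf A A') (D : Ideal (MvPolynomial (Fin n) K)) :
    IsReductionOf (A ⊔ D) (A' ⊔ D) := by
  obtain ⟨N, hN, e⟩ := h
  refine ⟨N, hN, ?_⟩
  rw [Ideal.sup_mul, Ideal.sup_mul]
  exact sup_le_sup_right e _

theorem cancel (hD : IsVarsPrimary D) (h : IsReductionOf (D * A) (D * A')) :
    IsReductionOf A A' := by
  obtain ⟨N, hN, e⟩ := h
  refine ⟨D * N, hD.mul hN, ?_⟩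
  rwa [← mul_assoc, ← mul_assoc, mul_comm A', mul_comm A]

theorem map {m : ℕ} (h : IsReductionOf A A')
    {π : MvPolynomial (Fin n) K →ₐ[K] MvPolynomial (Fin m) K}
    (hπ : (varsIdeal K n).map π = varsIdeal K m) : IsReductionOf (A.map π) (A'.map π) := by
  obtain ⟨N, hN, e⟩ := h
  refine ⟨N.map π, hN.map hπ, ?_⟩
  rw [← Ideal.map_mul, ← Ideal.map_mul]
  exact Ideal.map_mono e

theorem of_forall (h : ∀ x ∈ A', ∃ N, IsVarsPrimary N ∧ Ideal.span {x} * N ≤ A * N) :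
    IsReductionOf A A' := by
  classical
  obtain ⟨t, ht⟩ := IsNoetherian.noetherian A'
  have key : ∀ t : Finset (MvPolynomial (Fin n) K), (∀ x ∈ t, x ∈ A') →
      ∃ N, IsVarsPrimary N ∧ Ideal.span (t : Set (MvPolynomial (Fin n) K)) * N ≤ A * N := by
    intro t
    induction t using Finset.induction_on with
    | empty => exact fun _ => ⟨⊤, ⟨0, le_top⟩, by simp⟩
    | insert x t _ ih =>
      intro ht
      obtain ⟨N, hN, e⟩ := ih fun y hy => ht y (Finset.mem_insert_of_mem hy)
      obtain ⟨N', hN', e'⟩ := h x (ht x (Finset.mem_insert_self _ _))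
      refine ⟨N * N', hN.mul hN', ?_⟩
      rw [Finset.coe_insert, Ideal.span_insert, Ideal.sup_mul]
      refine sup_le ?_ ?_
      · rw [mul_comm N N', ← mul_assoc, ← mul_assoc]
        exact Ideal.mul_mono_left e'
      · rw [← mul_assoc, ← mul_assoc]
        exact Ideal.mul_mono_left e
  obtain ⟨N, hN, e⟩ := key t fun x hx => ht ▸ Ideal.subset_span hx
  refine ⟨N, hN, ?_⟩
  rw [← ht]
  exact e

theorem pow_mul_le {N : Ideal (MvPolynomial (Fin n) K)} (e : A' * N ≤ A * N) (t : ℕ) :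
    A' ^ t * N ≤ A ^ t * N := by
  induction t with
  | zero => simp
  | succ t ih =>
    calc A' ^ (t + 1) * N = A' ^ t * (A' * N) := by rw [pow_succ, mul_assoc]
      _ ≤ A' ^ t * (A * N) := Ideal.mul_mono_right e
      _ = A * (A' ^ t * N) := by ring
      _ ≤ A * (A ^ t * N) := Ideal.mul_mono_right ih
      _ = _ := by rw [pow_succ]; ring

/-- If `𝔪 ^ q ≤ N`, then `A' ^ (a + q) ≤ A' ^ a N ≤ A ^ a N ≤ A ^ a`, and a shift by `q` does not
affect leading terms. -/
theorem hsCoeff_top_eq [Infinite K] (h : IsReductionOf A A') (hA : IsVarsPrimary A) (hle : A ≤ A')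
    (hM : A' ≤ varsIdeal K n) : hsCoeff A n 0 = hsCoeff A' n 0 := by
  refine le_antisymm ?_ (hsCoeff_top_anti hA hle hM)
  obtain ⟨N, ⟨q, hq⟩, e⟩ := h
  have h2 := (tendsto_shift_div_pow_iff (f := fun a => (codim K (A' ^ a) : ℝ)) q n).2
    (tendsto_codim_pow_div (hA.mono hle) hM)
  have := le_of_tendsto_of_tendsto' (tendsto_codim_pow_div hA (hle.trans hM)) h2 (fun a => by
      refine div_le_div_of_nonneg_right ?_ (by positivity)
      refine Nat.cast_le.2 (codim_mono ((hA.mono hle).pow _).finCodim ?_)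
      rw [pow_add]
      exact (Ideal.mul_mono_right ((Ideal.pow_right_mono hM q).trans hq)).trans
        ((pow_mul_le e a).trans Ideal.mul_le_left))
  rw [div_le_div_iff_of_pos_right (by positivity)] at this
  exact_mod_cast this

end IsReductionOf

theorem span_singleton_mul_sup_pow_le {R : Type*} [CommRing R] (A : Ideal R) (x : R) (k : ℕ) :
    Ideal.span {x} * (A ⊔ Ideal.span {x}) ^ k ≤
      A * (A ⊔ Ideal.span {x}) ^ k ⊔ Ideal.span {x ^ (k + 1)} := by
  induction k with
  | zero => simp
  | succ k ih =>
    rw [pow_succ, ← mul_assoc]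
    refine (Ideal.mul_mono_left ih).trans ?_
    rw [Ideal.sup_mul, mul_assoc A, Ideal.mul_sup (Ideal.span {x ^ (k + 1)}),
      Ideal.span_singleton_mul_span_singleton, ← pow_succ x (k + 1)]
    refine sup_le le_sup_left (sup_le ?_ le_sup_right)
    rw [mul_comm]
    refine le_sup_of_le_left (Ideal.mul_mono_right ?_)
    rw [← pow_succ, ← Ideal.span_singleton_pow]
    exact Ideal.pow_right_mono le_sup_right _

/-- The equation for `x` gives `x J ^ k ≤ A J ^ k` with `J = A + (x)`, so `J ^ k` serves as the
primary factor. -/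
theorem IsReductionOf.of_forall_pow_mem {A A' : Ideal (MvPolynomial (Fin n) K)}
    (hA : IsVarsPrimary A)
    (h : ∀ x ∈ A', ∃ k, x ^ (k + 1) ∈ A * (A ⊔ Ideal.span {x}) ^ k) : IsReductionOf A A' := by
  refine .of_forall fun x hx => ?_
  obtain ⟨k, hk⟩ := h x hx
  refine ⟨(A ⊔ Ideal.span {x}) ^ k, (hA.mono le_sup_left).pow k,
    (span_singleton_mul_sup_pow_le A x k).trans (sup_le le_rfl ?_)⟩
  rwa [Ideal.span_singleton_le_iff_mem]

end Multiplicity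

/-! ### Rees' theorem and its transfer to mixed multiplicities -/

section ReesCriterion

universe u

variable {K : Type u} [Field K] [IsAlgClosed K] {n : ℕ}

/-- Rees' theorem: an ideal of the same multiplicity as an ideal containing it is a reduction of
it. -/
theorem IsReductionOf.of_hsCoeff_top_eq {A A' : Ideal (MvPolynomial (Fin n) K)}
    (hA : IsVarsPrimary A) (hle : A ≤ A') (hM : A' ≤ varsIdeal K n)
    (h : hsCoeff A n 0 = hsCoeff A' n 0) : IsReductionOf A A' := by
  have : Infinite K := IsAlgClosed.instInfinite
  refine .of_forall_pow_mem hA fun x hx => ?_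
  by_contra! hk
  have hx0 : x ≠ 0 := by
    rintro rfl
    exact hk 0 (by simp)
  obtain ⟨c, m, hc, hm, hgrow⟩ := exists_pow_add_le_codim_of_not_integral (K := K)
    (d := n) (by rw [MvPolynomial.trdeg_of_isDomain]; simp) hx0 (fun t => (hA.pow t).finCodim) hk
  have hB : A ⊔ Ideal.span {x} ≤ A' := sup_le hle (by rwa [Ideal.span_singleton_le_iff_mem])
  have h1 := (tendsto_codim_pow_div hA (hle.trans hM)).sub
    (tendsto_codim_pow_div (hA.mono hle) hM)
  rw [h, sub_self] at h1
  have h2 := h1.comp (tendsto_id.const_mul_atTop' hc)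
  -- If some `x ∈ A'` were not integral over `A`, the colengths of `A ^ (c s)` and `A' ^ (c s)`
  -- would differ by at least `s ^ n / m`, while equal multiplicities make the difference `o(s ^
  -- n)`.
  have h3 : (1 : ℝ) / (m * c ^ n) ≤ 0 := by
    refine ge_of_tendsto h2 ?_
    filter_upwards [eventually_ge_atTop 1] with s hs
    simp only [Function.comp, id]
    have h4 : s ^ n + m * codim K (A' ^ (c * s)) ≤ m * codim K (A ^ (c * s)) :=
      (add_le_add_right (Nat.mul_le_mul_left m (codim_mono ((hA.mono le_sup_left).pow _).finCodim
        (Ideal.pow_right_mono hB _))) _).trans (hgrow s hs)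
    have h5 : (s : ℝ) ^ n + m * codim K (A' ^ (c * s)) ≤ m * codim K (A ^ (c * s)) := by
      exact_mod_cast h4
    have hs' : (0 : ℝ) < s := by exact_mod_cast hs
    have hc' : (0 : ℝ) < c := by exact_mod_cast hc
    have hm' : (0 : ℝ) < m := by exact_mod_cast hm
    rw [← sub_div, div_le_div_iff₀ (by positivity) (by positivity)]
    push_cast
    rw [mul_pow]
    nlinarith [pow_pos hc' n]
  have hc' : (0 : ℝ) < c := by exact_mod_cast hc
  have hm' : (0 : ℝ) < m := by exact_mod_cast hm
  exact absurd h3 (not_le.2 (by positivity))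

end ReesCriterion

theorem exists_nat_hsCoeff_top_eq {K : Type*} [Field K] [Infinite K] {n : ℕ}
    {Z : Ideal (MvPolynomial (Fin n) K)} (hZ : IsVarsPrimary Z) (hZM : Z ≤ varsIdeal K n) :
    ∃ k : ℕ, hsCoeff Z n 0 = k := by
  obtain ⟨hc0, N, hN⟩ := hZ.isHilbertSamuel
  obtain ⟨z, hz⟩ := exists_int_top_coeff n (N := N)
    (f := fun a => (codim K (Z ^ a * varsIdeal K n ^ N) : ℤ))
    (g := fun u => ∑ v ∈ Finset.range (n + 1), hsCoeff Z u v * (N.choose v : ℚ)) (fun a ha => by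
      rw [Int.cast_natCast, hN a N ha le_rfl]
      refine Finset.sum_congr rfl fun u _ => ?_
      rw [Finset.sum_mul]
      exact Finset.sum_congr rfl fun v _ => by ring)
  have e : ∑ v ∈ Finset.range (n + 1), hsCoeff Z n v * (N.choose v : ℚ) = hsCoeff Z n 0 := by
    rw [Finset.sum_eq_single 0]
    · simp
    · intro v _ hv
      rw [hc0 n v (by omega), zero_mul]
    · simp
  rw [e] at hz
  have h0 := ge_of_tendsto' (b := (0 : ℝ)) (tendsto_codim_pow_div hZ hZM)
    (fun a => by positivity)
  have h1 : (0 : ℝ) ≤ hsCoeff Z n 0 := by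
    have hf : (0 : ℝ) < n.factorial := by positivity
    by_contra! hneg
    exact absurd h0 (not_le.2 (div_neg_of_neg_of_pos hneg hf))
  have h2 : 0 ≤ z := by
    rw [hz] at h1
    exact_mod_cast h1
  lift z to ℕ using h2
  exact ⟨z, by exact_mod_cast hz⟩

section SectionMultiplicity

variable {K : Type*} [Field K] [Infinite K] {i m : ℕ}
  {A A' : Ideal (MvPolynomial (Fin (i + m)) K)}

/-- One generic section serves both ideals at once, which reduces the claim to ordinary
multiplicities; the following lemmas use the same device. -/
theorem hsCoeff_anti (hA : IsVarsPrimary A) (h : A ≤ A') (hM : A' ≤ varsIdeal K (i + m)) :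
    hsCoeff A' i m ≤ hsCoeff A i m := by
  classical
  obtain ⟨π, hπ, hs⟩ := exists_section_hsCoeff_eq i m {A, A'}
    (by simpa using ⟨hA, hA.mono h⟩)
  rw [hs A (by simp), hs A' (by simp)]
  exact hsCoeff_top_anti (hA.map hπ) (Ideal.map_mono h) (hπ ▸ Ideal.map_mono hM)

theorem hsCoeff_pow (hA : IsVarsPrimary A) (hM : A ≤ varsIdeal K (i + m)) {k : ℕ} (hk : 1 ≤ k) :
    hsCoeff (A ^ k) i m = (k : ℚ) ^ i * hsCoeff A i m := by
  classical
  obtain ⟨π, hπ, hs⟩ := exists_section_hsCoeff_eq i m {A, A ^ k}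
    (by simpa using ⟨hA, hA.pow k⟩)
  rw [hs A (by simp), hs (A ^ k) (by simp), Ideal.map_pow]
  exact hsCoeff_top_pow (hA.map hπ) (hπ ▸ Ideal.map_mono hM) hk

theorem hsCoeff_vars : hsCoeff (varsIdeal K (i + m)) i m = 1 := by
  obtain ⟨π, hπ, hs⟩ := exists_section_hsCoeff_eq i m {varsIdeal K (i + m)}
    (fun Y hY => by rw [Finset.mem_singleton.1 hY]; exact ⟨1, by simp⟩)
  rw [hs _ (by simp), hπ, hsCoeff_top_vars]

theorem hsCoeff_vars_pow {k : ℕ} (hk : 1 ≤ k) :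
    hsCoeff (varsIdeal K (i + m) ^ k) i m = (k : ℚ) ^ i := by
  rw [hsCoeff_pow ⟨1, by simp⟩ le_rfl hk, hsCoeff_vars, mul_one]

theorem exists_nat_hsCoeff_eq (hA : IsVarsPrimary A) (hM : A ≤ varsIdeal K (i + m)) :
    ∃ k : ℕ, hsCoeff A i m = k := by
  obtain ⟨π, hπ, hs⟩ := exists_section_hsCoeff_eq i m {A} (by simpa using hA)
  rw [hs _ (by simp)]
  exact exists_nat_hsCoeff_top_eq (hA.map hπ) (hπ ▸ Ideal.map_mono hM)

theorem IsReductionOf.hsCoeff_eq (h : IsReductionOf A A') (hA : IsVarsPrimary A) (hle : A ≤ A')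
    (hM : A' ≤ varsIdeal K (i + m)) : hsCoeff A i m = hsCoeff A' i m := by
  classical
  obtain ⟨π, hπ, hs⟩ := exists_section_hsCoeff_eq i m {A, A'}
    (by simpa using ⟨hA, hA.mono hle⟩)
  rw [hs A (by simp), hs A' (by simp)]
  exact (h.map hπ).hsCoeff_top_eq (hA.map hπ) (Ideal.map_mono hle) (hπ ▸ Ideal.map_mono hM)

end SectionMultiplicity

section SectionReesCriterion

universe u

variable {K : Type u} [Field K] [IsAlgClosed K] {i m : ℕ}
  {A A' C C' D : Ideal (MvPolynomial (Fin (i + m)) K)}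

/-- On a common generic section Rees' theorem turns both equalities into reduction relations, which
multiply; reductions in turn preserve the multiplicity. -/
theorem hsCoeff_mul_eq (hA : IsVarsPrimary A) (hle : A ≤ A') (hM : A' ≤ varsIdeal K (i + m))
    (hC : IsVarsPrimary C) (hle' : C ≤ C') (hM' : C' ≤ varsIdeal K (i + m))
    (h : hsCoeff A i m = hsCoeff A' i m) (h' : hsCoeff C i m = hsCoeff C' i m) :
    hsCoeff (A * C) i m = hsCoeff (A' * C') i m := by
  classical
  have : Infinite K := IsAlgClosed.instInfinite
  obtain ⟨π, hπ, hs⟩ := exists_section_hsCoeff_eq i m {A, A', C, C', A * C, A' * C'}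
    (by simpa using ⟨hA, hA.mono hle, hC, hC.mono hle', hA.mul hC,
      (hA.mono hle).mul (hC.mono hle')⟩)
  rw [hs A (by simp), hs A' (by simp)] at h
  rw [hs C (by simp), hs C' (by simp)] at h'
  rw [hs (A * C) (by simp), hs (A' * C') (by simp), Ideal.map_mul, Ideal.map_mul]
  have hX : ∀ {X}, X ≤ varsIdeal K (i + m) → X.map π ≤ varsIdeal K i := fun hX =>
    hπ ▸ Ideal.map_mono hX
  exact ((IsReductionOf.of_hsCoeff_top_eq (hA.map hπ) (Ideal.map_mono hle) (hX hM) h).mul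
    (.of_hsCoeff_top_eq (hC.map hπ) (Ideal.map_mono hle') (hX hM') h')).hsCoeff_top_eq
      ((hA.map hπ).mul (hC.map hπ)) (Ideal.mul_mono (Ideal.map_mono hle) (Ideal.map_mono hle'))
      (Ideal.mul_le_left.trans (hX hM))

/-- On a generic section `D * A` is a reduction of `D * A'`, and the factor `D` can be absorbed into
the auxiliary primary ideal. -/
theorem hsCoeff_eq_of_mul_eq (hD : IsVarsPrimary D) (hA : IsVarsPrimary A) (hle : A ≤ A')
    (hM : A' ≤ varsIdeal K (i + m)) (h : hsCoeff (D * A) i m = hsCoeff (D * A') i m) :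
    hsCoeff A i m = hsCoeff A' i m := by
  classical
  have : Infinite K := IsAlgClosed.instInfinite
  obtain ⟨π, hπ, hs⟩ := exists_section_hsCoeff_eq i m {A, A', D * A, D * A'}
    (by simpa using ⟨hA, hA.mono hle, hD.mul hA, hD.mul (hA.mono hle)⟩)
  rw [hs (D * A) (by simp), hs (D * A') (by simp), Ideal.map_mul, Ideal.map_mul] at h
  rw [hs A (by simp), hs A' (by simp)]
  have hX : A'.map π ≤ varsIdeal K i := hπ ▸ Ideal.map_mono hM
  exact (IsReductionOf.of_hsCoeff_top_eq ((hD.map hπ).mul (hA.map hπ))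
    (Ideal.mul_mono_right (Ideal.map_mono hle)) (Ideal.mul_le_right.trans hX) h
    |>.cancel (hD.map hπ)).hsCoeff_top_eq (hA.map hπ) (Ideal.map_mono hle) hX

end SectionReesCriterion

/-! ### Łojasiewicz exponents in the polynomial ring -/

section Lojasiewicz

universe u

variable {K : Type u} [Field K] {i m : ℕ}

/-- Adding `𝔪 ^ r` to `Z ^ s` does not change the `i`-th mixed multiplicity. -/
def IsTruncationOrder (i m : ℕ) (Z : Ideal (MvPolynomial (Fin (i + m)) K)) (s r : ℕ) : Prop :=
  1 ≤ r ∧ hsCoeff (Z ^ s ⊔ varsIdeal K (i + m) ^ r) i m = hsCoeff (Z ^ s) i m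

/-- The mixed Łojasiewicz exponent of an ideal of the polynomial ring. -/
noncomputable def polyLojasiewicz (i m : ℕ) (Z : Ideal (MvPolynomial (Fin (i + m)) K)) : ℝ :=
  sInf {q : ℝ | ∃ s r : ℕ, 1 ≤ s ∧ IsTruncationOrder i m Z s r ∧ q = (r : ℝ) / s}

variable {A B C I J Z : Ideal (MvPolynomial (Fin (i + m)) K)} {s r r' k : ℕ}

theorem polyLojasiewicz_le (hs : 1 ≤ s) (h : IsTruncationOrder i m Z s r) :
    polyLojasiewicz i m Z ≤ (r : ℝ) / s :=
  csInf_le ⟨0, by rintro _ ⟨s, r, -, -, rfl⟩; positivity⟩ ⟨s, r, hs, h, rfl⟩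

theorem exists_isTruncationOrder (hZ : IsVarsPrimary Z) (s : ℕ) :
    ∃ r, IsTruncationOrder i m Z s r := by
  obtain ⟨q, hq⟩ := hZ.pow s
  refine ⟨q + 1, by omega, ?_⟩
  rw [sup_eq_left.2 ((Ideal.pow_le_pow_right (Nat.le_succ q)).trans hq)]

theorem le_polyLojasiewicz (hZ : IsVarsPrimary Z) {q : ℝ}
    (h : ∀ s r, 1 ≤ s → IsTruncationOrder i m Z s r → q ≤ (r : ℝ) / s) :
    q ≤ polyLojasiewicz i m Z := by
  obtain ⟨r, hr⟩ := exists_isTruncationOrder hZ 1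
  refine le_csInf ⟨_, 1, r, le_rfl, hr, rfl⟩ ?_
  rintro _ ⟨s, r, hs, h', rfl⟩
  exact h s r hs h'

theorem pow_le_vars (hM : Z ≤ varsIdeal K (i + m)) (hs : 1 ≤ s) : Z ^ s ≤ varsIdeal K (i + m) :=
  (Ideal.pow_le_self (by omega)).trans hM

theorem pow_sup_le_vars (hM : Z ≤ varsIdeal K (i + m)) (hs : 1 ≤ s) (hr : 1 ≤ r) :
    Z ^ s ⊔ varsIdeal K (i + m) ^ r ≤ varsIdeal K (i + m) :=
  sup_le (pow_le_vars hM hs) (pow_le_vars le_rfl hr)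

theorem isTruncationOrder_pow_iff :
    IsTruncationOrder i m (Z ^ k) s r ↔ IsTruncationOrder i m Z (k * s) r := by
  rw [IsTruncationOrder, IsTruncationOrder, pow_mul]

namespace IsTruncationOrder

/-- `Z ^ (k s) + 𝔪 ^ (k r)` lies between `Z ^ (k s)` and `(Z ^ s + 𝔪 ^ r) ^ k`, whose coefficients
agree because both scale by `k ^ i`. -/
theorem pow [Infinite K] (hZ : IsVarsPrimary Z) (hM : Z ≤ varsIdeal K (i + m)) (hs : 1 ≤ s)
    (h : IsTruncationOrder i m Z s r) (hk : 1 ≤ k) : IsTruncationOrder i m Z (k * s) (k * r) := by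
  obtain ⟨hr, h⟩ := h
  have hkr : 1 ≤ k * r := Nat.mul_pos hk hr
  have hks : 1 ≤ k * s := Nat.mul_pos hk hs
  refine ⟨hkr, le_antisymm ?_ ?_⟩
  · exact hsCoeff_anti (hZ.pow _) le_sup_left (pow_sup_le_vars hM hks hkr)
  · have h1 : Z ^ (k * s) ⊔ varsIdeal K (i + m) ^ (k * r) ≤ (Z ^ s ⊔ varsIdeal K (i + m) ^ r) ^ k := by
      rw [mul_comm k s, mul_comm k r, pow_mul, pow_mul]
      exact sup_le (Ideal.pow_right_mono le_sup_left k) (Ideal.pow_right_mono le_sup_right k)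
    refine le_trans (le_of_eq ?_) (hsCoeff_anti ((hZ.pow _).mono le_sup_left) h1
      (pow_le_vars (pow_sup_le_vars hM hs hr) hk))
    rw [hsCoeff_pow ((hZ.pow s).mono le_sup_left) (pow_sup_le_vars hM hs hr) hk, h, mul_comm k s,
      pow_mul, hsCoeff_pow (hZ.pow s) (pow_le_vars hM hs) hk]

/-- For `r < s` the truncation is `𝔪 ^ r`, of coefficient `r ^ i`, whereas `Z ^ s ≤ 𝔪 ^ s` has
coefficient at least `s ^ i`. -/
theorem le [Infinite K] (hi : 1 ≤ i) (hZ : IsVarsPrimary Z) (hM : Z ≤ varsIdeal K (i + m))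
    (hs : 1 ≤ s) (h : IsTruncationOrder i m Z s r) : s ≤ r := by
  obtain ⟨hr, h⟩ := h
  by_contra! hlt
  have h1 : Z ^ s ≤ varsIdeal K (i + m) ^ s := Ideal.pow_right_mono hM s
  rw [sup_eq_right.2 (h1.trans (Ideal.pow_le_pow_right hlt.le)), hsCoeff_vars_pow hr] at h
  have h2 := hsCoeff_anti (hZ.pow s) h1 (pow_le_vars le_rfl hs)
  rw [← h, hsCoeff_vars_pow hs] at h2
  have h3 : s ^ i ≤ r ^ i := by exact_mod_cast h2
  exact absurd h3 (not_le.2 (Nat.pow_lt_pow_left hlt (by omega)))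

/-- `(I J) ^ s + 𝔪 ^ (r + r')` lies between `(I J) ^ s` and `(I ^ s + 𝔪 ^ r) (J ^ s + 𝔪 ^ r')`,
whose coefficients agree by `hsCoeff_mul_eq`. -/
theorem mul [IsAlgClosed K] (hI : IsVarsPrimary I) (hIM : I ≤ varsIdeal K (i + m))
    (hJ : IsVarsPrimary J) (hJM : J ≤ varsIdeal K (i + m)) (hs : 1 ≤ s)
    (h : IsTruncationOrder i m I s r) (h' : IsTruncationOrder i m J s r') :
    IsTruncationOrder i m (I * J) s (r + r') := by
  have : Infinite K := IsAlgClosed.instInfinite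
  obtain ⟨hr, h⟩ := h
  obtain ⟨hr', h'⟩ := h'
  have hrr : 1 ≤ r + r' := by omega
  have hIJM : I * J ≤ varsIdeal K (i + m) := Ideal.mul_le_left.trans hIM
  refine ⟨hrr, le_antisymm ?_ ?_⟩
  · exact hsCoeff_anti ((hI.mul hJ).pow s) le_sup_left (pow_sup_le_vars hIJM hs hrr)
  · have h1 : (I * J) ^ s ⊔ varsIdeal K (i + m) ^ (r + r') ≤
        (I ^ s ⊔ varsIdeal K (i + m) ^ r) * (J ^ s ⊔ varsIdeal K (i + m) ^ r') := by
      rw [mul_pow, pow_add]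
      exact sup_le (Ideal.mul_mono le_sup_left le_sup_left)
        (Ideal.mul_mono le_sup_right le_sup_right)
    refine le_trans (le_of_eq ?_) (hsCoeff_anti (((hI.mul hJ).pow s).mono le_sup_left) h1
      (Ideal.mul_le_left.trans (pow_sup_le_vars hIM hs hr)))
    rw [mul_pow]
    exact hsCoeff_mul_eq (hI.pow s) le_sup_left (pow_sup_le_vars hIM hs hr) (hJ.pow s) le_sup_left
      (pow_sup_le_vars hJM hs hr') h.symm h'.symm

/-- For `r ≥ 1` the truncation factors as `𝔪 ^ s (Z ^ s + 𝔪 ^ r)`, so `𝔪 ^ s` can be cancelled. -/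
theorem of_vars_mul [IsAlgClosed K] (hi : 1 ≤ i) (hZ : IsVarsPrimary Z)
    (hM : Z ≤ varsIdeal K (i + m)) (hs : 1 ≤ s)
    (h : IsTruncationOrder i m (varsIdeal K (i + m) * Z) s (s + r)) :
    IsTruncationOrder i m Z s r := by
  have : Infinite K := IsAlgClosed.instInfinite
  have hV : IsVarsPrimary (varsIdeal K (i + m)) := ⟨1, by simp⟩
  obtain ⟨-, h⟩ := h
  rw [mul_pow] at h
  rcases Nat.eq_zero_or_pos r with rfl | hr
  -- For `r = 0` the truncation is `𝔪 ^ s`, of coefficient `s ^ i`, while `𝔪 ^ s Z ^ s ≤ 𝔪 ^ (2 s)`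
  -- has at least `(2 s) ^ i`.
  · exfalso
    rw [add_zero, sup_eq_right.2 Ideal.mul_le_left, hsCoeff_vars_pow hs] at h
    have h1 : varsIdeal K (i + m) ^ s * Z ^ s ≤ varsIdeal K (i + m) ^ (s + s) := by
      rw [pow_add]
      exact Ideal.mul_mono_right (Ideal.pow_right_mono hM s)
    have h2 := hsCoeff_anti ((hV.pow s).mul (hZ.pow s)) h1 (pow_le_vars le_rfl (by omega))
    rw [← h, hsCoeff_vars_pow (by omega)] at h2
    have h3 : (s + s) ^ i ≤ s ^ i := by exact_mod_cast h2
    exact absurd h3 (not_le.2 (Nat.pow_lt_pow_left (by omega) (by omega)))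
  · rw [pow_add, ← Ideal.mul_sup] at h
    exact ⟨hr, (hsCoeff_eq_of_mul_eq (hV.pow s) (hZ.pow s) le_sup_left
      (pow_sup_le_vars hM hs hr) h.symm).symm⟩

end IsTruncationOrder

theorem polyLojasiewicz_pow [Infinite K] (hZ : IsVarsPrimary Z) (hM : Z ≤ varsIdeal K (i + m))
    (hk : 1 ≤ k) : polyLojasiewicz i m (Z ^ k) = k * polyLojasiewicz i m Z := by
  have hk' : (0 : ℝ) < k := by exact_mod_cast hk
  refine le_antisymm ?_ ?_
  · rw [← div_le_iff₀' hk']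
    refine le_polyLojasiewicz hZ fun s r hs h => ?_
    rw [div_le_iff₀' hk']
    refine (polyLojasiewicz_le hs
      (isTruncationOrder_pow_iff.2 (h.pow hZ hM hs hk))).trans (le_of_eq ?_)
    push_cast
    ring
  · refine le_polyLojasiewicz (hZ.pow k) fun s r hs h => ?_
    rw [← le_div_iff₀' hk']
    refine (polyLojasiewicz_le (Nat.mul_pos hk hs)
      (isTruncationOrder_pow_iff.1 h)).trans (le_of_eq ?_)
    push_cast
    rw [div_div, mul_comm]

theorem polyLojasiewicz_mul_le [IsAlgClosed K] (hI : IsVarsPrimary I)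
    (hIM : I ≤ varsIdeal K (i + m)) (hJ : IsVarsPrimary J) (hJM : J ≤ varsIdeal K (i + m)) :
    polyLojasiewicz i m (I * J) ≤ polyLojasiewicz i m I + polyLojasiewicz i m J := by
  have : Infinite K := IsAlgClosed.instInfinite
  rw [← sub_le_iff_le_add]
  refine le_polyLojasiewicz hI fun s r hs h => ?_
  rw [sub_le_comm]
  refine le_polyLojasiewicz hJ fun s' r' hs' h' => ?_
  rw [sub_le_iff_le_add']
  -- Bring the two fractions to the common denominator `s' s` before multiplying.
  have h1 := h.pow hI hIM hs hs'
  have h2 := h'.pow hJ hJM hs' hs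
  rw [mul_comm s s'] at h2
  refine (polyLojasiewicz_le (Nat.mul_pos hs' hs)
    (h1.mul hI hIM hJ hJM (Nat.mul_pos hs' hs) h2)).trans (le_of_eq ?_)
  have e1 : (s : ℝ) ≠ 0 := by positivity
  have e2 : (s' : ℝ) ≠ 0 := by positivity
  push_cast
  field_simp

theorem polyLojasiewicz_vars [Infinite K] (hi : 1 ≤ i) :
    polyLojasiewicz i m (varsIdeal K (i + m)) = 1 := by
  have hV : IsVarsPrimary (varsIdeal K (i + m)) := ⟨1, by simp⟩
  refine le_antisymm ?_ (le_polyLojasiewicz hV fun s r hs h => ?_)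
  · refine (polyLojasiewicz_le (s := 1) (r := 1) le_rfl ⟨le_rfl, ?_⟩).trans (by simp)
    rw [sup_idem]
  · have hs' : (0 : ℝ) < s := by exact_mod_cast hs
    rw [le_div_iff₀ hs', one_mul]
    exact_mod_cast h.le hi hV le_rfl hs

/-- The upper bound is subadditivity with exponent 1 for `𝔪`. For the lower bound, any admissible
order is `s + r`, and cancelling `𝔪 ^ s` shows that `r` is admissible for `Z`. -/
theorem polyLojasiewicz_vars_mul [IsAlgClosed K] (hi : 1 ≤ i) (hZ : IsVarsPrimary Z)
    (hM : Z ≤ varsIdeal K (i + m)) :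
    polyLojasiewicz i m (varsIdeal K (i + m) * Z) = polyLojasiewicz i m Z + 1 := by
  have : Infinite K := IsAlgClosed.instInfinite
  have hV : IsVarsPrimary (varsIdeal K (i + m)) := ⟨1, by simp⟩
  refine le_antisymm ?_ (le_polyLojasiewicz (hV.mul hZ) fun s r hs h => ?_)
  · refine (polyLojasiewicz_mul_le hV le_rfl hZ hM).trans (le_of_eq ?_)
    rw [polyLojasiewicz_vars hi, add_comm]
  · obtain ⟨r, rfl⟩ := Nat.exists_eq_add_of_le
      (h.le hi (hV.mul hZ) Ideal.mul_le_left hs)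
    have h1 := polyLojasiewicz_le hs (h.of_vars_mul hi hZ hM hs)
    have hs' : (s : ℝ) ≠ 0 := by positivity
    push_cast
    rw [add_div, div_self hs']
    linarith

theorem IsReductionOf.polyLojasiewicz_eq [Infinite K] (h : IsReductionOf A C)
    (hA : IsVarsPrimary A) (hle : A ≤ C) (hM : C ≤ varsIdeal K (i + m)) :
    polyLojasiewicz i m A = polyLojasiewicz i m C := by
  rw [polyLojasiewicz, polyLojasiewicz]
  congr 1
  ext q
  refine exists_congr fun s => exists_congr fun r => and_congr_right fun hs =>
    and_congr_left fun _ => and_congr_right fun hr => ?_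
  rw [(h.pow s).hsCoeff_eq (hA.pow s) (Ideal.pow_right_mono hle s) (pow_le_vars hM hs),
    ((h.pow s).sup _).hsCoeff_eq ((hA.pow s).mono le_sup_left)
      (sup_le_sup_right (Ideal.pow_right_mono hle s) _) (pow_sup_le_vars hM hs hr)]

/-- With `C = I ^ a + J ^ b`, the exponent of `C` is `a` times that of `I` and `b` times that of
`J`. As `(I J) ^ (a b)` is a reduction of `C ^ (a + b)`, `a b` times the exponent of `I J` is `a +
b` times that of `C`. -/
theorem polyLojasiewicz_mul_eq [Infinite K] (hI : IsVarsPrimary I)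
    (hIM : I ≤ varsIdeal K (i + m)) (hJ : IsVarsPrimary J) (hJM : J ≤ varsIdeal K (i + m))
    {a b : ℕ} (ha : 1 ≤ a) (hb : 1 ≤ b) (h : IsReductionOf (I ^ a) (I ^ a ⊔ J ^ b))
    (h' : IsReductionOf (J ^ b) (I ^ a ⊔ J ^ b)) :
    polyLojasiewicz i m (I * J) = polyLojasiewicz i m I + polyLojasiewicz i m J := by
  set C := I ^ a ⊔ J ^ b with hC
  have hCM : C ≤ varsIdeal K (i + m) := sup_le (pow_le_vars hIM ha) (pow_le_vars hJM hb)
  have hCP : IsVarsPrimary C := (hI.pow a).mono le_sup_left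
  have e1 := h.polyLojasiewicz_eq (hI.pow a) le_sup_left hCM
  have e2 := h'.polyLojasiewicz_eq (hJ.pow b) le_sup_right hCM
  have hred := (h.pow b).mul (h'.pow a)
  have hle : (I ^ a) ^ b * (J ^ b) ^ a ≤ C ^ b * C ^ a :=
    Ideal.mul_mono (Ideal.pow_right_mono le_sup_left b) (Ideal.pow_right_mono le_sup_right a)
  have e : (I ^ a) ^ b * (J ^ b) ^ a = (I * J) ^ (a * b) := by
    rw [mul_pow, ← pow_mul, ← pow_mul, mul_comm b a]
  rw [e, ← pow_add] at hred hle
  have e3 := hred.polyLojasiewicz_eq ((hI.mul hJ).pow _) hle (pow_le_vars hCM (by omega))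
  rw [polyLojasiewicz_pow (hI.mul hJ) (Ideal.mul_le_left.trans hIM) (Nat.mul_pos ha hb),
    polyLojasiewicz_pow hCP hCM (by omega)] at e3
  rw [polyLojasiewicz_pow hI hIM ha] at e1
  rw [polyLojasiewicz_pow hJ hJM hb] at e2
  have ha' : (a : ℝ) ≠ 0 := by positivity
  have hb' : (b : ℝ) ≠ 0 := by positivity
  push_cast at e3
  have : (a * b : ℝ) * polyLojasiewicz i m (I * J) =
      (a * b : ℝ) * (polyLojasiewicz i m I + polyLojasiewicz i m J) := by
    rw [e3]
    linear_combination (-b : ℝ) * e1 - (a : ℝ) * e2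
  exact mul_left_cancel₀ (mul_ne_zero ha' hb') this

end Lojasiewicz

/-! ### Comparing germs with polynomials -/

section Germs

variable (n : ℕ)

/-- The germs of constant functions. -/
noncomputable def germConst : ℂ →+* holomorphicGerms n where
  toFun c := ⟨((fun _ => c : (Fin n → ℂ) → ℂ) : Germ (𝓝 (0 : Fin n → ℂ)) ℂ), _,
    analyticAt_const, rfl⟩
  map_one' := rfl
  map_mul' _ _ := rfl
  map_zero' := rfl
  map_add' _ _ := rfl

noncomputable instance : Algebra ℂ (holomorphicGerms n) := (germConst n).toAlgebra

/-- The germs of the coordinate functions. -/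
noncomputable def germCoord (j : Fin n) : holomorphicGerms n :=
  ⟨((fun x => x j : (Fin n → ℂ) → ℂ) : Germ (𝓝 (0 : Fin n → ℂ)) ℂ), _,
    (ContinuousLinearMap.proj (R := ℂ) (φ := fun _ : Fin n => ℂ) j).analyticAt 0, rfl⟩

/-- The germ at the origin of a polynomial function. -/
noncomputable def polyGerm : MvPolynomial (Fin n) ℂ →ₐ[ℂ] holomorphicGerms n :=
  MvPolynomial.aeval (germCoord n)

variable {n}

theorem coe_polyGerm (p : MvPolynomial (Fin n) ℂ) :
    (polyGerm n p : Germ (𝓝 (0 : Fin n → ℂ)) ℂ) =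
      ((fun x => MvPolynomial.eval x p : (Fin n → ℂ) → ℂ) : Germ (𝓝 (0 : Fin n → ℂ)) ℂ) := by
  induction p using MvPolynomial.induction_on with
  | C a =>
    rw [MvPolynomial.algHom_C]
    simp only [MvPolynomial.eval_C]
    rfl
  | add p q hp hq =>
    rw [map_add, AddMemClass.coe_add, hp, hq]
    simp only [map_add]
    rfl
  | mul_X p j hp =>
    rw [map_mul, MulMemClass.coe_mul, hp]
    simp only [map_mul, MvPolynomial.eval_X, polyGerm, MvPolynomial.aeval_X]
    rfl

theorem germEval_germConst (c : ℂ) : germEval n (algebraMap ℂ _ c) = c := rfl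

theorem germEval_germCoord (j : Fin n) : germEval n (germCoord n j) = 0 := rfl

/-- Shifting the power series splits off one linear argument from each homogeneous term of positive
degree. -/
theorem exists_analytic_sub_eq {f : (Fin n → ℂ) → ℂ} (hf : AnalyticAt ℂ f 0) :
    ∃ G : (Fin n → ℂ) → (Fin n → ℂ) →L[ℂ] ℂ, AnalyticAt ℂ G 0 ∧
      ∀ᶠ x in 𝓝 0, f x = f 0 + G x x := by
  obtain ⟨p, r, hp⟩ := hf
  have hr : 0 < p.shift.radius := by
    rw [FormalMultilinearSeries.radius_shift]
    exact hp.r_pos.trans_le hp.r_le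
  have hG := p.shift.hasFPowerSeriesOnBall hr
  refine ⟨p.shift.sum, hG.analyticAt, ?_⟩
  filter_upwards [Metric.eball_mem_nhds 0 hp.r_pos] with x hx
  have h1 := hp.hasSum hx
  have hx' : x ∈ Metric.eball (0 : Fin n → ℂ) p.shift.radius := by
    rw [FormalMultilinearSeries.radius_shift]
    exact Metric.eball_subset_eball hp.r_le hx
  have h2 := (hG.hasSum hx').mapL (ContinuousLinearMap.apply ℂ ℂ x)
  rw [zero_add] at h1 h2
  rw [← hasSum_nat_add_iff' 1, Finset.sum_range_one, hp.coeff_zero] at h1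
  have h3 : ∀ k, (ContinuousLinearMap.apply ℂ ℂ x) (p.shift k fun _ => x) = p (k + 1) fun _ => x := by
    intro k
    change (p (k + 1)).curryRight (fun _ => x) x = _
    rw [ContinuousMultilinearMap.curryRight_apply]
    congr 1
    ext j
    refine Fin.lastCases ?_ (fun j => ?_) j <;> simp
  simp only [h3] at h2
  have := h1.unique h2
  rw [ContinuousLinearMap.apply_apply] at this
  rw [← this]
  ring

/-- Hadamard's lemma. -/
theorem exists_eq_const_add_sum (g : holomorphicGerms n) :
    ∃ h : Fin n → holomorphicGerms n,
      g = algebraMap ℂ _ (germEval n g) + ∑ j, germCoord n j * h j := by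
  obtain ⟨_, f, hf, rfl⟩ := g
  obtain ⟨G, hG, e⟩ := exists_analytic_sub_eq hf
  have hGw : ∀ j, AnalyticAt ℂ (fun x => G x (fun k => if j = k then 1 else 0)) 0 := fun j =>
    AnalyticAt.comp (g := ContinuousLinearMap.apply ℂ ℂ (fun k : Fin n => if j = k then (1 : ℂ) else 0))
      (ContinuousLinearMap.analyticAt _ _) hG
  refine ⟨fun j => ⟨((fun x => G x (fun k => if j = k then 1 else 0) : (Fin n → ℂ) → ℂ) :
    Germ (𝓝 (0 : Fin n → ℂ)) ℂ), _, hGw j, rfl⟩, Subtype.ext ?_⟩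
  have h1 : ((∑ j, germCoord n j * (⟨((fun x => G x (fun k => if j = k then 1 else 0) :
      (Fin n → ℂ) → ℂ) : Germ (𝓝 (0 : Fin n → ℂ)) ℂ), _, hGw j, rfl⟩ :
      holomorphicGerms n) : holomorphicGerms n) : Germ (𝓝 (0 : Fin n → ℂ)) ℂ) =
      ((∑ j, fun x => x j * G x (fun k => if j = k then 1 else 0) : (Fin n → ℂ) → ℂ) :
        Germ (𝓝 (0 : Fin n → ℂ)) ℂ) := by
    rw [AddSubmonoidClass.coe_finsetSum]
    exact (map_sum (Germ.coeRingHom (𝓝 (0 : Fin n → ℂ)) (R := ℂ))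
      (fun j x => x j * G x (fun k => if j = k then 1 else 0)) Finset.univ).symm
  rw [AddMemClass.coe_add, h1]
  refine Germ.coe_eq.2 ?_
  filter_upwards [e] with x hx
  change f x = f 0 + (∑ j, fun x : Fin n → ℂ => x j * G x (fun k => if j = k then 1 else 0)) x
  rw [hx, Finset.sum_apply]
  congr 1
  exact (G x : (Fin n → ℂ) →ₗ[ℂ] ℂ).pi_apply_eq_sum_univ x

local notation "𝔪" => IsLocalRing.maximalIdeal (holomorphicGerms n)

theorem map_polyGerm_vars : (varsIdeal ℂ n).map (polyGerm n) = 𝔪 := by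
  refine le_antisymm ?_ fun g hg => ?_
  · rw [Ideal.map_span, Ideal.span_le]
    rintro _ ⟨_, ⟨j, rfl⟩, rfl⟩
    rw [SetLike.mem_coe, mem_maximalIdeal_holomorphicGerms, polyGerm, MvPolynomial.aeval_X,
      germEval_germCoord]
  · rw [mem_maximalIdeal_holomorphicGerms] at hg
    obtain ⟨h, e⟩ := exists_eq_const_add_sum g
    rw [e, hg, map_zero, zero_add]
    refine sum_mem fun j _ => Ideal.mul_mem_right _ _ ?_
    have : germCoord n j = polyGerm n (MvPolynomial.X j) := by
      rw [polyGerm, MvPolynomial.aeval_X]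
    rw [this]
    exact Ideal.mem_map_of_mem _ (Ideal.subset_span ⟨j, rfl⟩)

theorem map_polyGerm_vars_pow (N : ℕ) : (varsIdeal ℂ n ^ N).map (polyGerm n) = 𝔪 ^ N := by
  rw [Ideal.map_pow, map_polyGerm_vars]

theorem germCoord_mem (j : Fin n) : germCoord n j ∈ 𝔪 := by
  rw [mem_maximalIdeal_holomorphicGerms, germEval_germCoord]

/-- Taylor approximation to order `N`, by iterating Hadamard's lemma. -/
theorem exists_sub_polyGerm_mem (N : ℕ) : ∀ g : holomorphicGerms n,
    ∃ p, g - polyGerm n p ∈ 𝔪 ^ N := by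
  induction N with
  | zero => exact fun g => ⟨0, by simp⟩
  | succ N ih =>
    intro g
    obtain ⟨h, e⟩ := exists_eq_const_add_sum g
    choose p hp using fun j => ih (h j)
    refine ⟨MvPolynomial.C (germEval n g) + ∑ j, MvPolynomial.X j * p j, ?_⟩
    have e' : g - polyGerm n (MvPolynomial.C (germEval n g) + ∑ j, MvPolynomial.X j * p j) =
        ∑ j, germCoord n j * (h j - polyGerm n (p j)) := by
      rw [map_add, map_sum, MvPolynomial.algHom_C]
      nth_rewrite 1 [e]
      rw [add_sub_add_left_eq_sub, ← Finset.sum_sub_distrib]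
      refine Finset.sum_congr rfl fun j _ => ?_
      rw [map_mul, mul_sub]
      congr 2
      rw [polyGerm, MvPolynomial.aeval_X]
    rw [e', pow_succ']
    exact sum_mem fun j _ => Ideal.mul_mem_mul (germCoord_mem j) (hp j)

theorem isBigO_of_mem_pow (N : ℕ) : ∀ {g : holomorphicGerms n}, g ∈ 𝔪 ^ N →
    ∀ {f : (Fin n → ℂ) → ℂ}, (f : Germ (𝓝 (0 : Fin n → ℂ)) ℂ) = g →
      f =O[𝓝 0] fun x => ‖x‖ ^ N := by
  induction N with
  | zero =>
    rintro ⟨_, f₀, hf₀, rfl⟩ - f hf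
    refine (hf₀.continuousAt.isBigO_one ℝ).congr' (Germ.coe_eq.1 hf).symm ?_
    simp
  | succ N ih =>
    intro g hg
    rw [pow_succ] at hg
    induction hg using Submodule.mul_induction_on' with
    | mem_mul_mem u hu v hv =>
      intro f hf
      have hv' := (mem_maximalIdeal_holomorphicGerms v).1 hv
      obtain ⟨_, f₁, hf₁, rfl⟩ := u
      obtain ⟨_, f₂, hf₂, rfl⟩ := v
      have h2 : f₂ =O[𝓝 0] fun x => ‖x‖ := by
        have := hf₂.differentiableAt.hasFDerivAt.isBigO_sub
        change f₂ 0 = 0 at hv'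
        simp only [hv', sub_zero] at this
        exact this.norm_right
      have := (ih hu rfl).mul h2
      simp only [← pow_succ] at this
      exact this.congr' (Germ.coe_eq.1 hf).symm EventuallyEq.rfl
    | add u _ v _ hu hv =>
      intro f hf
      obtain ⟨_, f₁, hf₁, rfl⟩ := u
      obtain ⟨_, f₂, hf₂, rfl⟩ := v
      exact ((hu rfl).add (hv rfl)).congr' (Germ.coe_eq.1 hf).symm EventuallyEq.rfl

theorem eval_smul_of_isHomogeneous {p : MvPolynomial (Fin n) ℂ} {N : ℕ} (hp : p.IsHomogeneous N)
    (t : ℂ) (v : Fin n → ℂ) :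
    MvPolynomial.eval (t • v) p = t ^ N * MvPolynomial.eval v p := by
  rw [MvPolynomial.eval_eq', MvPolynomial.eval_eq', Finset.mul_sum]
  refine Finset.sum_congr rfl fun d hd => ?_
  have hdeg : ∑ j, d j = N := by
    have := hp (MvPolynomial.mem_support_iff.1 hd)
    rw [← this, Finsupp.weight_apply, Finsupp.sum_fintype _ _ (by simp)]
    simp
  simp only [Pi.smul_apply, smul_eq_mul, mul_pow, Finset.prod_mul_distrib,
    Finset.prod_pow_eq_pow_sum, hdeg]
  ring

/-- Along `t v` the polynomial scales by `t ^ N`, while the bound is of order `|t| ^ (N + 1)`; let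
`t` tend to 0. -/
theorem eq_zero_of_isHomogeneous_of_isBigO {p : MvPolynomial (Fin n) ℂ} {N : ℕ}
    (hp : p.IsHomogeneous N)
    (h : (fun x => MvPolynomial.eval x p) =O[𝓝 0] fun x => ‖x‖ ^ (N + 1)) : p = 0 := by
  refine MvPolynomial.funext fun v => ?_
  rw [map_zero]
  have ht : Tendsto (fun t : ℂ => t • v) (𝓝[≠] 0) (𝓝 0) := by
    have : Tendsto (fun t : ℂ => t • v) (𝓝 0) (𝓝 ((0 : ℂ) • v)) :=
      tendsto_id.smul_const v
    rw [zero_smul] at this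
    exact this.mono_left nhdsWithin_le_nhds
  obtain ⟨c, hc⟩ := (h.comp_tendsto ht).bound
  have h1 : Tendsto (fun t : ℂ => c * (‖t‖ * ‖v‖ ^ (N + 1))) (𝓝[≠] 0) (𝓝 0) := by
    have : Tendsto (fun t : ℂ => c * (‖t‖ * ‖v‖ ^ (N + 1))) (𝓝 0)
        (𝓝 (c * (‖(0 : ℂ)‖ * ‖v‖ ^ (N + 1)))) := by
      refine Continuous.tendsto ?_ 0
      fun_prop
    rw [norm_zero, zero_mul, mul_zero] at this
    exact this.mono_left nhdsWithin_le_nhds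
  have h2 : ‖MvPolynomial.eval v p‖ ≤ 0 := by
    refine ge_of_tendsto h1 ?_
    filter_upwards [hc, self_mem_nhdsWithin] with t hct ht0
    have ht0' : 0 < ‖t‖ := norm_pos_iff.2 ht0
    simp only [Function.comp] at hct
    rw [eval_smul_of_isHomogeneous hp, norm_smul, norm_mul, norm_pow, norm_pow, norm_mul, norm_norm,
      norm_norm, mul_pow] at hct
    have : 0 < ‖t‖ ^ N := by positivity
    refine le_of_mul_le_mul_left ?_ this
    calc _ ≤ _ := hct
      _ = _ := by ring
  exact norm_le_zero_iff.1 h2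

/-- A polynomial whose germ vanishes to order `N + 1` lies in `𝔪 ^ N` by induction, and its degree
`N` part must vanish by growth at the origin. -/
theorem comap_polyGerm_pow (N : ℕ) : (𝔪 ^ N).comap (polyGerm n) = varsIdeal ℂ n ^ N := by
  refine le_antisymm ?_ (by
    rw [← Ideal.map_le_iff_le_comap, map_polyGerm_vars_pow])
  induction N with
  | zero => simp
  | succ N ih =>
    intro p hp
    rw [Ideal.mem_comap] at hp
    have h1 : p ∈ varsIdeal ℂ n ^ N := ih (Ideal.pow_le_pow_right (Nat.le_succ N) hp)
    have h2 : p - MvPolynomial.homogeneousComponent N p ∈ varsIdeal ℂ n ^ (N + 1) := by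
      rw [MvPolynomial.mem_pow_idealOfVars_iff'] at h1 ⊢
      intro d hd
      rw [MvPolynomial.coeff_sub, MvPolynomial.coeff_homogeneousComponent]
      split_ifs with hdN
      · rw [sub_self]
      · rw [h1 d (by omega), sub_zero]
    have h3 : polyGerm n (MvPolynomial.homogeneousComponent N p) ∈ 𝔪 ^ (N + 1) := by
      have h4 := Ideal.mem_map_of_mem (polyGerm n) h2
      rw [map_polyGerm_vars_pow, map_sub] at h4
      have := sub_mem hp h4
      rwa [sub_sub_cancel] at this
    have h5 := eq_zero_of_isHomogeneous_of_isBigO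
      (MvPolynomial.homogeneousComponent_isHomogeneous N p)
      (isBigO_of_mem_pow (N + 1) h3 (coe_polyGerm _).symm)
    rwa [h5, sub_zero] at h2

theorem exists_polyGerm_add_of_mem_map {Z : Ideal (MvPolynomial (Fin n) ℂ)} (q : ℕ)
    {g : holomorphicGerms n} (hg : g ∈ Z.map (polyGerm n)) :
    ∃ z ∈ Z, g - polyGerm n z ∈ 𝔪 ^ q := by
  induction hg using Submodule.span_induction with
  | mem y hy =>
    obtain ⟨z, hz, rfl⟩ := hy
    exact ⟨z, hz, by simp⟩
  | zero => exact ⟨0, zero_mem _, by simp⟩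
  | add y y' _ _ hy hy' =>
    obtain ⟨z, hz, h⟩ := hy
    obtain ⟨z', hz', h'⟩ := hy'
    refine ⟨z + z', add_mem hz hz', ?_⟩
    rw [map_add, add_sub_add_comm]
    exact add_mem h h'
  | smul r y _ hy =>
    obtain ⟨z, hz, h⟩ := hy
    obtain ⟨p, hp⟩ := exists_sub_polyGerm_mem q r
    refine ⟨p * z, Ideal.mul_mem_left _ _ hz, ?_⟩
    have : r • y - polyGerm n (p * z) =
        r * (y - polyGerm n z) + polyGerm n z * (r - polyGerm n p) := by
      rw [map_mul, smul_eq_mul]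
      ring
    rw [this]
    exact add_mem (Ideal.mul_mem_left _ _ h) (Ideal.mul_mem_left _ _ hp)

/-- Coefficients in an expression over germs can be replaced by Taylor polynomials; the error is a
polynomial of high order, which already lies in `Z`. -/
theorem comap_map_polyGerm {Z : Ideal (MvPolynomial (Fin n) ℂ)} (hZ : IsVarsPrimary Z) :
    (Z.map (polyGerm n)).comap (polyGerm n) = Z := by
  refine le_antisymm (fun p hp => ?_) Ideal.le_comap_map
  obtain ⟨q, hq⟩ := hZ
  obtain ⟨z, hz, h⟩ := exists_polyGerm_add_of_mem_map q (Ideal.mem_comap.1 hp)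
  rw [← map_sub, ← Ideal.mem_comap, comap_polyGerm_pow] at h
  have := add_mem (hq h) hz
  rwa [sub_add_cancel] at this

theorem isVarsPrimary_comap {X : Ideal (holomorphicGerms n)} {q : ℕ} (hq : 𝔪 ^ q ≤ X) :
    IsVarsPrimary (X.comap (polyGerm n)) :=
  ⟨q, by rw [← Ideal.map_le_iff_le_comap, map_polyGerm_vars_pow]; exact hq⟩

theorem map_comap_polyGerm {X : Ideal (holomorphicGerms n)} {q : ℕ} (hq : 𝔪 ^ q ≤ X) :
    (X.comap (polyGerm n)).map (polyGerm n) = X := by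
  refine le_antisymm Ideal.map_comap_le fun g hg => ?_
  obtain ⟨p, hp⟩ := exists_sub_polyGerm_mem q g
  have h1 : polyGerm n p ∈ X := by
    have := sub_mem hg (hq hp)
    rwa [sub_sub_cancel] at this
  have h2 : 𝔪 ^ q ≤ (X.comap (polyGerm n)).map (polyGerm n) := by
    rw [← map_polyGerm_vars_pow]
    refine Ideal.map_mono ?_
    rw [← Ideal.map_le_iff_le_comap, map_polyGerm_vars_pow]
    exact hq
  have := add_mem (h2 hp) (Ideal.mem_map_of_mem (polyGerm n) (Ideal.mem_comap.2 h1))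
  rwa [sub_add_cancel] at this

/-- The quotient is Artinian, so its Jacobson radical, which contains the image of `𝔪`, is
nilpotent. -/
theorem exists_pow_le_of_hasFiniteColength {I : Ideal (holomorphicGerms n)}
    (h : HasFiniteColength I) : ∃ q, 𝔪 ^ q ≤ I := by
  have h1 := (isFiniteLength_iff_isNoetherian_isArtinian.1 h).2
  have h2 : IsArtinianRing (holomorphicGerms n ⧸ I) := isArtinian_of_tower (holomorphicGerms n) h1
  obtain ⟨q, hq⟩ := IsArtinianRing.isNilpotent_jacobson_bot (R := holomorphicGerms n ⧸ I)
  refine ⟨q, ?_⟩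
  have hle : Ideal.map (Ideal.Quotient.mk I) 𝔪 ≤ Ideal.jacobson ⊥ := by
    intro x hx
    obtain ⟨a, ha, rfl⟩ := (Ideal.mem_map_iff_of_surjective _ Ideal.Quotient.mk_surjective).1 hx
    refine Ideal.mem_jacobson_bot.2 fun y => ?_
    obtain ⟨b, rfl⟩ := Ideal.Quotient.mk_surjective y
    rw [← map_mul, ← map_one (Ideal.Quotient.mk I), ← map_add]
    refine IsUnit.map _ ?_
    by_contra hu
    have h3 : a * b + 1 ∈ 𝔪 := hu
    have h4 := sub_mem h3 (Ideal.mul_mem_right b _ ha)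
    rw [add_sub_cancel_left] at h4
    exact (Ideal.ne_top_iff_one _).1 (IsLocalRing.maximalIdeal.isMaximal _).ne_top h4
  have h5 := Ideal.pow_right_mono hle q
  rw [hq, ← Ideal.map_pow] at h5
  rw [← Ideal.mk_ker (I := I), RingHom.ker_eq_comap_bot, ← Ideal.map_le_iff_le_comap]
  exact h5

instance : IsLocalHom (algebraMap ℂ (holomorphicGerms n)) := ⟨fun c hc => by
  have := hc.map (germEval n)
  rwa [germEval_germConst] at this⟩

/-- The residue field of the germs is `ℂ`, so length is dimension over `ℂ`; Taylor approximation
identifies the two quotients. -/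
theorem length_quotient_map_polyGerm {Z : Ideal (MvPolynomial (Fin n) ℂ)} (hZ : IsVarsPrimary Z) :
    Module.length (holomorphicGerms n) (holomorphicGerms n ⧸ Z.map (polyGerm n)) =
      (codim ℂ Z : ℕ∞) := by
  have hsurj : Function.Surjective (algebraMap (IsLocalRing.ResidueField ℂ)
      (IsLocalRing.ResidueField (holomorphicGerms n))) := by
    intro y
    obtain ⟨g, rfl⟩ := IsLocalRing.residue_surjective y
    refine ⟨IsLocalRing.residue ℂ (germEval n g), ?_⟩
    change IsLocalRing.residue _ (algebraMap ℂ _ (germEval n g)) = _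
    refine Ideal.Quotient.eq.2 ?_
    rw [mem_maximalIdeal_holomorphicGerms, map_sub, germEval_germConst, sub_self]
  have h1 := IsLocalRing.length_restrictScalars ℂ (holomorphicGerms n)
    (holomorphicGerms n ⧸ Z.map (polyGerm n))
  rw [Module.length_eq_of_surjective (M := IsLocalRing.ResidueField (holomorphicGerms n)) hsurj,
    Module.length_eq_one (IsLocalRing.ResidueField (holomorphicGerms n)), mul_one] at h1
  rw [← h1]
  let e : (MvPolynomial (Fin n) ℂ ⧸ Z) →ₐ[ℂ] (holomorphicGerms n ⧸ Z.map (polyGerm n)) :=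
    Ideal.quotientMapₐ _ (polyGerm n) Ideal.le_comap_map
  have he : Function.Bijective e := by
    constructor
    · exact Ideal.quotientMap_injective' (H := Ideal.le_comap_map) (comap_map_polyGerm hZ).le
    · intro y
      obtain ⟨g, rfl⟩ := Ideal.Quotient.mk_surjective y
      obtain ⟨q, hq⟩ := hZ
      obtain ⟨p, hp⟩ := exists_sub_polyGerm_mem q g
      refine ⟨Ideal.Quotient.mk Z p, ?_⟩
      change Ideal.Quotient.mk _ (polyGerm n p) = _
      refine (Ideal.Quotient.eq.2 ?_).symm
      rw [← map_polyGerm_vars_pow] at hp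
      exact Ideal.map_mono hq hp
  have := hZ.finCodim
  rw [← (LinearEquiv.ofBijective e.toLinearMap he).length_eq, Module.length_eq_finrank]
  rfl

end Germs

/-! ### The multilinear coefficient of a polynomial in two linear forms -/

section MultilinearCoefficient

variable {σ : Type*} [Fintype σ] (p : σ → Prop) [DecidablePred p] (q : ℚ)

/-- The sum of the variables with index satisfying `p`. -/
noncomputable def sumOfVars : MvPolynomial σ ℚ := ∑ j with p j, MvPolynomial.X j

/-- `q` times the sum of the variables with index not satisfying `p`. -/
noncomputable def sumOfOtherVars : MvPolynomial σ ℚ :=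
  ∑ j with ¬ p j, MvPolynomial.C q * MvPolynomial.X j

theorem totalDegree_aeval_le {τ : Type*} (F : Polynomial ℚ) {A : MvPolynomial τ ℚ} (hA : A.totalDegree ≤ 1) :
    (Polynomial.aeval A F).totalDegree ≤ F.natDegree := by
  rw [Polynomial.aeval_eq_sum_range]
  refine MvPolynomial.totalDegree_finsetSum_le fun k hk => ?_
  refine (MvPolynomial.totalDegree_smul_le _ _).trans ((MvPolynomial.totalDegree_pow _ _).trans ?_)
  rw [Finset.mem_range] at hk
  nlinarith

theorem totalDegree_sumOfVars_le : (sumOfVars p).totalDegree ≤ 1 :=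
  MvPolynomial.totalDegree_finsetSum_le fun j _ => (MvPolynomial.totalDegree_X j).le

theorem totalDegree_sumOfOtherVars_le : (sumOfOtherVars p q).totalDegree ≤ 1 :=
  MvPolynomial.totalDegree_finsetSum_le fun j _ => (MvPolynomial.totalDegree_mul _ _).trans (by
    rw [MvPolynomial.totalDegree_C, MvPolynomial.totalDegree_X])

variable [DecidableEq σ]

theorem pderiv_sumOfVars (j : σ) :
    MvPolynomial.pderiv j (sumOfVars p) = if p j then 1 else 0 := by
  rw [sumOfVars, map_sum]
  simp only [MvPolynomial.pderiv_X, Pi.single_apply, eq_comm (b := j)]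
  rw [Finset.sum_ite_eq]
  simp

theorem pderiv_sumOfOtherVars (j : σ) :
    MvPolynomial.pderiv j (sumOfOtherVars p q) = if p j then 0 else MvPolynomial.C q := by
  rw [sumOfOtherVars, map_sum]
  simp only [MvPolynomial.pderiv_C_mul, MvPolynomial.pderiv_X, Pi.single_apply, mul_ite, mul_one,
    mul_zero, eq_comm (b := j)]
  rw [Finset.sum_ite_eq]
  simp [ite_not]

/-- The variables of `S` are removed one at a time by differentiation; each lowers the power of the
one form containing it. Both powers must be used up exactly, leaving the factorials and `q ^ l`. -/
theorem coeff_sumOfVars_pow_mul_pow (S : Finset σ) : ∀ k l : ℕ,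
    (sumOfVars p ^ k * sumOfOtherVars p q ^ l).coeff (∑ j ∈ S, Finsupp.single j 1) =
      if k = (S.filter p).card ∧ l = (S.filter fun j => ¬ p j).card then
        (k.factorial * l.factorial * q ^ l : ℚ) else 0 := by
  induction S using Finset.induction_on with
  | empty =>
    intro k l
    have hA : MvPolynomial.constantCoeff (sumOfVars p) = 0 := by simp [sumOfVars]
    have hB : MvPolynomial.constantCoeff (sumOfOtherVars p q) = 0 := by simp [sumOfOtherVars]
    rw [Finset.sum_empty]
    change MvPolynomial.constantCoeff _ = _
    rw [map_mul, map_pow, map_pow, hA, hB]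
    rcases Nat.eq_zero_or_pos k with rfl | hk
    · rcases Nat.eq_zero_or_pos l with rfl | hl
      · simp
      · simp [hl.ne']
    · simp [hk.ne']
  | insert j S hj ih =>
    intro k l
    have hj0 : (∑ j ∈ S, Finsupp.single j 1 : σ →₀ ℕ) j = 0 := by
      rw [Finsupp.finsetSum_apply]
      refine Finset.sum_eq_zero fun x hx => ?_
      rw [Finsupp.single_apply, if_neg]
      rintro rfl
      exact hj hx
    have h1 := MvPolynomial.coeff_pderiv (i := j) (sumOfVars p ^ k * sumOfOtherVars p q ^ l)
      (∑ j ∈ S, Finsupp.single j 1)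
    rw [hj0, Nat.cast_zero, zero_add, mul_one, add_comm] at h1
    rw [Finset.sum_insert hj, ← h1, MvPolynomial.pderiv_mul, MvPolynomial.pderiv_pow,
      MvPolynomial.pderiv_pow, pderiv_sumOfVars, pderiv_sumOfOtherVars, Finset.filter_insert,
      Finset.filter_insert]
    by_cases hp : p j
    · simp only [hp, if_true, mul_one, mul_zero, add_zero, not_true, if_false]
      rw [Finset.card_insert_of_notMem (fun h => hj (Finset.mem_filter.1 h).1)]
      cases k with
      | zero => simp
      | succ k =>
        have e : ((k + 1 : ℕ) : MvPolynomial σ ℚ) * sumOfVars p ^ (k + 1 - 1) *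
            sumOfOtherVars p q ^ l =
            MvPolynomial.C (k + 1 : ℚ) * (sumOfVars p ^ k * sumOfOtherVars p q ^ l) := by
          rw [Nat.add_sub_cancel, mul_assoc]
          simp
        rw [e, MvPolynomial.coeff_C_mul, ih]
        simp only [add_left_inj, mul_ite, mul_zero, Nat.factorial_succ]
        split_ifs
        · push_cast
          ring
        · rfl
    · simp only [hp, if_false, mul_zero, zero_mul, zero_add, not_false_eq_true, if_true]
      rw [Finset.card_insert_of_notMem (fun h => hj (Finset.mem_filter.1 h).1)]
      cases l with
      | zero => simp
      | succ l =>
        have e : sumOfVars p ^ k * (((l + 1 : ℕ) : MvPolynomial σ ℚ) *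
            sumOfOtherVars p q ^ (l + 1 - 1) * MvPolynomial.C q) =
            MvPolynomial.C ((l + 1 : ℚ) * q) * (sumOfVars p ^ k * sumOfOtherVars p q ^ l) := by
          rw [Nat.add_sub_cancel]
          simp only [map_mul, map_add, map_natCast, map_one]
          push_cast
          ring
        rw [e, MvPolynomial.coeff_C_mul, ih]
        simp only [add_left_inj, mul_ite, mul_zero, Nat.factorial_succ]
        split_ifs
        · push_cast
          ring
        · rfl

theorem coeff_aeval_mul_aeval (F G : Polynomial ℚ) {i m : ℕ}
    (hi : (Finset.univ.filter p).card = i) (hm : (Finset.univ.filter fun j => ¬ p j).card = m) :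
    (Polynomial.aeval (sumOfVars p) F * Polynomial.aeval (sumOfOtherVars p q) G).coeff
      (Finsupp.equivFunOnFinite.symm fun _ => 1) =
      F.coeff i * G.coeff m * (i.factorial * m.factorial * q ^ m) := by
  have e1 : (Finsupp.equivFunOnFinite.symm fun _ => 1 : σ →₀ ℕ) = ∑ j, Finsupp.single j 1 := by
    ext j
    simp [Finsupp.single_apply]
  rw [e1]
  induction F using Polynomial.induction_on' with
  | add F F' hF hF' =>
    rw [map_add, add_mul, MvPolynomial.coeff_add, hF, hF', Polynomial.coeff_add]
    ring
  | monomial k a =>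
    induction G using Polynomial.induction_on' with
    | add G G' hG hG' =>
      rw [map_add, mul_add, MvPolynomial.coeff_add, hG, hG', Polynomial.coeff_add]
      ring
    | monomial l b =>
      rw [Polynomial.aeval_monomial, Polynomial.aeval_monomial, mul_mul_mul_comm, ← map_mul,
        MvPolynomial.algebraMap_eq, MvPolynomial.coeff_C_mul, coeff_sumOfVars_pow_mul_pow, hi, hm,
        Polynomial.coeff_monomial, Polynomial.coeff_monomial]
      by_cases hk : k = i
      · by_cases hl : l = m
        · simp [hk, hl]
        · simp [hl]
      · simp [hk]

/-- The polynomial `∑ c u v C(A, u) C(B, v)` for linear forms `A` and `B` in disjoint sets of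
variables: its degree, values and multilinear coefficient. -/
theorem exists_polynomial_of_choose {i m : ℕ} (hi : (Finset.univ.filter p).card = i)
    (hm : (Finset.univ.filter fun j => ¬ p j).card = m) (c : ℕ → ℕ → ℚ)
    (hc : ∀ u v, i + m < u + v → c u v = 0) (q : ℕ) :
    ∃ P : MvPolynomial σ ℚ, P.totalDegree ≤ i + m ∧
      (∀ t : σ → ℕ, MvPolynomial.eval (fun j => (t j : ℚ)) P =
        ∑ u ∈ Finset.range (i + m + 1), ∑ v ∈ Finset.range (i + m + 1), c u v *
          (((∑ j with p j, t j).choose u : ℚ) * ((q * ∑ j with ¬ p j, t j).choose v : ℚ))) ∧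
      P.coeff (Finsupp.equivFunOnFinite.symm fun _ => 1) = (q : ℚ) ^ m * c i m := by
  -- The falling factorial of degree `u` divided by `u!` interpolates `C(·, u)`.
  refine ⟨∑ u ∈ Finset.range (i + m + 1), ∑ v ∈ Finset.range (i + m + 1),
    MvPolynomial.C (c u v / (u.factorial * v.factorial)) *
      (Polynomial.aeval (sumOfVars p) (descPochhammer ℚ u) *
        Polynomial.aeval (sumOfOtherVars p q) (descPochhammer ℚ v)), ?_, fun t => ?_, ?_⟩
  · refine MvPolynomial.totalDegree_finsetSum_le fun u _ =>
      MvPolynomial.totalDegree_finsetSum_le fun v _ => ?_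
    by_cases huv : i + m < u + v
    · simp [hc u v huv]
    · refine (MvPolynomial.totalDegree_mul _ _).trans ?_
      rw [MvPolynomial.totalDegree_C, zero_add]
      refine (MvPolynomial.totalDegree_mul _ _).trans ?_
      have h1 := totalDegree_aeval_le (descPochhammer ℚ u) (totalDegree_sumOfVars_le p)
      have h2 := totalDegree_aeval_le (descPochhammer ℚ v) (totalDegree_sumOfOtherVars_le p q)
      rw [descPochhammer_natDegree] at h1 h2
      omega
  · have heval : ∀ (A : MvPolynomial σ ℚ) (F : Polynomial ℚ) (x : σ → ℚ),
        MvPolynomial.eval x (Polynomial.aeval A F) = F.eval (MvPolynomial.eval x A) := by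
      intro A F x
      rw [← MvPolynomial.coe_aeval_eq_eval, RingHom.coe_coe, ← Polynomial.aeval_algHom_apply,
        Polynomial.coe_aeval_eq_eval]
    have hA : MvPolynomial.eval (fun j => (t j : ℚ)) (sumOfVars p) =
        ((∑ j with p j, t j : ℕ) : ℚ) := by
      simp [sumOfVars]
    have hB : MvPolynomial.eval (fun j => (t j : ℚ)) (sumOfOtherVars p q) =
        ((q * ∑ j with ¬ p j, t j : ℕ) : ℚ) := by
      simp [sumOfOtherVars, Finset.mul_sum]
    simp only [map_sum, map_mul, MvPolynomial.eval_C, heval, hA, hB]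
    refine Finset.sum_congr rfl fun u _ => Finset.sum_congr rfl fun v _ => ?_
    rw [Nat.cast_choose_eq_descPochhammer_div, Nat.cast_choose_eq_descPochhammer_div]
    have h1 : (u.factorial : ℚ) ≠ 0 := by positivity
    have h2 : (v.factorial : ℚ) ≠ 0 := by positivity
    field_simp
  · simp only [MvPolynomial.coeff_sum, MvPolynomial.coeff_C_mul, coeff_aeval_mul_aeval p q _ _ hi hm]
    have hlt : ∀ u w, u < w → (descPochhammer ℚ u).coeff w = 0 := fun u w h =>
      Polynomial.coeff_eq_zero_of_natDegree_lt (by rwa [descPochhammer_natDegree])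
    have heq : ∀ u, (descPochhammer ℚ u).coeff u = 1 := fun u => by
      have := (monic_descPochhammer ℚ u).coeff_natDegree
      rwa [descPochhammer_natDegree] at this
    -- Apart from `(i, m)`, a pair with `u + v ≤ i + m` has `u < i` or `v < m`, so one falling
    -- factorial has too small a degree to contribute.
    rw [Finset.sum_eq_single i, Finset.sum_eq_single m]
    · rw [heq, heq]
      have h1 : (i.factorial : ℚ) ≠ 0 := by positivity
      have h2 : (m.factorial : ℚ) ≠ 0 := by positivity
      field_simp
    · intro v _ hv
      rcases lt_or_gt_of_ne hv with h | h
      · simp [hlt v m h]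
      · simp [hc i v (by omega)]
    · intro h
      exact absurd (Finset.mem_range.2 (by omega)) h
    · intro u _ hu
      refine Finset.sum_eq_zero fun v _ => ?_
      rcases lt_or_gt_of_ne hu with h | h
      · simp [hlt u i h]
      · rcases lt_or_ge v m with h' | h'
        · simp [hlt v m h']
        · simp [hc u v (by omega)]
    · intro h
      exact absurd (Finset.mem_range.2 (by omega)) h

end MultilinearCoefficient

/-! ### Mixed multiplicities and exponents of germs -/

theorem IsMixedMultiplicity.mixedMultiplicity_eq {R : Type*} [CommRing R] {n : ℕ}
    {I : Fin n → Ideal R} {e : ℕ} (h : IsMixedMultiplicity I e) : mixedMultiplicity I = e := by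
  have h' : ∃ e, IsMixedMultiplicity I e := ⟨e, h⟩
  rw [mixedMultiplicity, dif_pos h']
  obtain ⟨P, -, ⟨N, hN⟩, hP⟩ := h
  obtain ⟨P', -, ⟨N', hN'⟩, hP'⟩ := h'.choose_spec
  have : P = P' := by
    refine MvPolynomial.funext_set (fun _ => (fun k : ℕ => (k : ℚ)) '' Set.Ici (max N N'))
      (fun _ => (Set.Ici_infinite _).image Nat.cast_injective.injOn) fun x hx => ?_
    choose t ht hxt using fun j => hx j (Set.mem_univ j)
    obtain rfl : (fun j => (t j : ℚ)) = x := funext hxt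
    obtain ⟨l, hl, e⟩ := hN t fun j => (le_max_left _ _).trans (ht j)
    obtain ⟨l', hl', e'⟩ := hN' t fun j => (le_max_right _ _).trans (ht j)
    rw [hl] at hl'
    rw [e, e', ENat.natCast_inj.1 hl']
  rw [this, hP'] at hP
  exact_mod_cast hP

/-- The codimension of `Y ^ a * 𝔪 ^ b` for large `a` and either large `b` or, if only the powers of
`Y` matter, `b = 0`. -/
theorem exists_codim_eq_sum_choose {K : Type*} [Field K] [Infinite K] {i m : ℕ}
    {Y : Ideal (MvPolynomial (Fin (i + m)) K)} (hY : IsVarsPrimary Y)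
    (hM : Y ≤ varsIdeal K (i + m)) :
    ∃ c : ℕ → ℕ → ℚ, (∀ u v, i + m < u + v → c u v = 0) ∧ c i m = hsCoeff Y i m ∧
      ∃ N, ∀ a b, N ≤ a → (1 ≤ m → N ≤ b) → (m = 0 → b = 0) →
        (codim K (Y ^ a * varsIdeal K (i + m) ^ b) : ℚ) = ∑ u ∈ Finset.range (i + m + 1),
          ∑ v ∈ Finset.range (i + m + 1), c u v * ((a.choose u : ℚ) * (b.choose v : ℚ)) := by
  -- For `m = 0` the family has no copies of `𝔪`, so `b` is 0, outside the range of the bivariate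
  -- polynomial. The polynomial in `a` alone is used, with the same leading coefficient.
  rcases Nat.eq_zero_or_pos m with rfl | hm
  · obtain ⟨g, N, hg0, hg⟩ := exists_codim_pow_mul_eq hY 0
    have hgi : hsCoeff Y i 0 = g i := by
      refine hsCoeff_eq_of_tendsto (n := i) hY hM ?_
      refine (tendsto_sum_choose_div_pow i g).congr' ?_
      filter_upwards [eventually_ge_atTop N] with a ha
      have := hg a ha
      rw [pow_zero, mul_one] at this
      rw [← Rat.cast_natCast]
      congr 2
      exact this.symm
    refine ⟨fun u v => if v = 0 then g u else 0, fun u v huv => ?_, by simp [hgi], N,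
      fun a b ha _ hb => ?_⟩
    · beta_reduce
      split_ifs with hv
      · exact hg0 u (by omega)
      · rfl
    · rw [hb rfl, hg a ha]
      refine Finset.sum_congr rfl fun u _ => ?_
      rw [Finset.sum_eq_single 0]
      · simp
      · intro v _ hv
        simp [hv]
      · simp
  · obtain ⟨hc0, N, hN⟩ := hY.isHilbertSamuel
    exact ⟨hsCoeff Y, hc0, rfl, N, fun a b ha hb _ => hN a b ha (hb hm)⟩

section MixedMultiplicityGerms

variable {i m : ℕ}

local notation "𝔪" => IsLocalRing.maximalIdeal (holomorphicGerms (i + m))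

theorem card_filter_val_lt_add : (Finset.univ.filter fun j : Fin (i + m) => (j : ℕ) < i).card = i := by
  rw [Fin.card_filter_val_lt]
  omega

theorem card_filter_not_val_lt_add :
    (Finset.univ.filter fun j : Fin (i + m) => ¬ (j : ℕ) < i).card = m := by
  have := Finset.card_filter_add_card_filter_not (s := Finset.univ)
    (fun j : Fin (i + m) => (j : ℕ) < i)
  rw [card_filter_val_lt_add, Finset.card_univ, Fintype.card_fin] at this
  omega

/-- The product of powers is `X ^ a * 𝔪 ^ (q b)`, with `a` and `b` sums of disjoint groups of the `t
j`. Substituting `q b` in the second variable produces the factor `q ^ m`. -/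
theorem isMixedMultiplicity_map (hi : 1 ≤ i) {X : Ideal (MvPolynomial (Fin (i + m)) ℂ)}
    (hX : IsVarsPrimary X) (hM : X ≤ varsIdeal ℂ (i + m)) {q e : ℕ} (hq : 1 ≤ q)
    (he : (q : ℚ) ^ m * hsCoeff X i m = e) :
    IsMixedMultiplicity
      (fun j : Fin (i + m) => if (j : ℕ) < i then X.map (polyGerm (i + m)) else 𝔪 ^ q) e := by
  obtain ⟨c, hc0, hcim, N, hN⟩ := exists_codim_eq_sum_choose hX hM
  obtain ⟨P, hPdeg, hPeval, hPcoeff⟩ := exists_polynomial_of_choose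
    (fun j : Fin (i + m) => (j : ℕ) < i) card_filter_val_lt_add card_filter_not_val_lt_add c hc0 q
  refine ⟨P, hPdeg, ⟨N, fun t ht => ?_⟩, by rw [hPcoeff, hcim, he]⟩
  set a := ∑ j with ((j : Fin (i + m)) : ℕ) < i, t j with ha
  set b := ∑ j with ¬ ((j : Fin (i + m)) : ℕ) < i, t j with hb
  have hprod : ∏ j : Fin (i + m), (if (j : ℕ) < i then X.map (polyGerm (i + m)) else 𝔪 ^ q) ^ t j =
      (X ^ a * varsIdeal ℂ (i + m) ^ (q * b)).map (polyGerm (i + m)) := by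
    simp only [ite_pow]
    rw [Finset.prod_ite, Finset.prod_pow_eq_pow_sum, Finset.prod_pow_eq_pow_sum, Ideal.map_mul,
      Ideal.map_pow, Ideal.map_pow, map_polyGerm_vars, pow_mul]
  refine ⟨codim ℂ (X ^ a * varsIdeal ℂ (i + m) ^ (q * b)), ?_, ?_⟩
  · rw [hprod, length_quotient_map_polyGerm ((hX.pow a).mul ((IsVarsPrimary.vars_pow _)))]
  · rw [hPeval, hN a (q * b) ?_ ?_ ?_]
    · have h0 : (⟨0, by omega⟩ : Fin (i + m)) ∈
          Finset.univ.filter fun j : Fin (i + m) => (j : ℕ) < i := by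
        simp only [Finset.mem_filter, Finset.mem_univ, true_and]
        omega
      exact (ht _).trans (Finset.single_le_sum (f := t) (fun _ _ => Nat.zero_le _) h0)
    · intro hm
      have h0 : (⟨i, by omega⟩ : Fin (i + m)) ∈
          Finset.univ.filter fun j : Fin (i + m) => ¬ (j : ℕ) < i := by
        simp
      exact ((ht _).trans (Finset.single_le_sum (f := t) (fun _ _ => Nat.zero_le _) h0)).trans
        (Nat.le_mul_of_pos_left _ hq)
    · rintro rfl
      rw [hb, Finset.filter_eq_empty_iff.2 fun j _ => not_not.2 j.2]
      simp

variable {Z : Ideal (MvPolynomial (Fin (i + m)) ℂ)}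

/-- Truncation also acts on the slots holding `𝔪 ^ s`, which become `𝔪 ^ min s r`; this accounts for
the extra factor. -/
theorem truncatedMixedMultiplicity_eq (hi : 1 ≤ i) (hZ : IsVarsPrimary Z)
    (hM : Z ≤ varsIdeal ℂ (i + m)) {s r : ℕ} (hs : 1 ≤ s) (hr : 1 ≤ r) :
    (truncatedMixedMultiplicity (fun j : Fin (i + m) =>
      (if (j : ℕ) < i then Z.map (polyGerm (i + m)) else 𝔪) ^ s) r : ℚ) =
      (min s r : ℕ) ^ m * hsCoeff (Z ^ s ⊔ varsIdeal ℂ (i + m) ^ r) i m := by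
  have hP : IsVarsPrimary (Z ^ s ⊔ varsIdeal ℂ (i + m) ^ r) := (hZ.pow s).mono le_sup_left
  have hle := pow_sup_le_vars hM hs hr
  obtain ⟨k, hk⟩ := exists_nat_hsCoeff_eq hP hle
  have hfam : (fun j : Fin (i + m) =>
      (if (j : ℕ) < i then Z.map (polyGerm (i + m)) else 𝔪) ^ s + 𝔪 ^ r) =
      fun j : Fin (i + m) => if (j : ℕ) < i then (Z ^ s ⊔ varsIdeal ℂ (i + m) ^ r).map (polyGerm (i + m))
        else 𝔪 ^ min s r := by
    funext j
    split_ifs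
    · rw [Ideal.map_sup, Ideal.map_pow, map_polyGerm_vars_pow]
      rfl
    · rw [Ideal.add_eq_sup]
      rcases le_total s r with h | h
      · rw [min_eq_left h, sup_eq_left.2 (Ideal.pow_le_pow_right h)]
      · rw [min_eq_right h, sup_eq_right.2 (Ideal.pow_le_pow_right h)]
  rw [truncatedMixedMultiplicity, hfam, (isMixedMultiplicity_map hi hP hle
    (e := (min s r) ^ m * k) (le_min hs hr) (by rw [hk]; push_cast; rfl)).mixedMultiplicity_eq, hk]
  push_cast
  rfl

/-- The maximum is `s ^ m` times the coefficient of `Z ^ s`. Each factor of the truncated value is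
bounded by the corresponding one, and equality of the coefficients already forces `s ≤ r`. -/
theorem mixedOrder_eq (hi : 1 ≤ i) (hZ : IsVarsPrimary Z) (hM : Z ≤ varsIdeal ℂ (i + m)) {s : ℕ}
    (hs : 1 ≤ s) :
    mixedOrder (fun j : Fin (i + m) =>
      (if (j : ℕ) < i then Z.map (polyGerm (i + m)) else 𝔪) ^ s) =
      sInf {r | IsTruncationOrder i m Z s r} := by
  obtain ⟨k, hk⟩ := exists_nat_hsCoeff_eq (hZ.pow s) (pow_le_vars hM hs)
  have hle : ∀ {r}, 1 ≤ r → hsCoeff (Z ^ s ⊔ varsIdeal ℂ (i + m) ^ r) i m ≤ k := fun hr =>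
    hk ▸ hsCoeff_anti (hZ.pow s) le_sup_left (pow_sup_le_vars hM hs hr)
  have hmin : ∀ r, ((min s r : ℕ) : ℚ) ^ m ≤ (s : ℚ) ^ m := fun r => by
    gcongr
    exact_mod_cast min_le_left s r
  have hiff : ∀ {r}, 1 ≤ r → ((truncatedMixedMultiplicity (fun j : Fin (i + m) =>
      (if (j : ℕ) < i then Z.map (polyGerm (i + m)) else 𝔪) ^ s) r = s ^ m * k) ↔
        IsTruncationOrder i m Z s r) := by
    intro r hr
    have hT := truncatedMixedMultiplicity_eq hi hZ hM hs hr
    have hpos : (0 : ℚ) < ((min s r : ℕ) : ℚ) ^ m := by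
      have : 0 < min s r := lt_min hs hr
      positivity
    constructor
    · intro h
      refine ⟨hr, ?_⟩
      rw [h] at hT
      push_cast at hT
      rw [hk]
      refine le_antisymm (hle hr) (le_of_mul_le_mul_left ?_ hpos)
      push_cast
      rw [← hT]
      have := mul_le_mul_of_nonneg_right (hmin r) (Nat.cast_nonneg (α := ℚ) k)
      push_cast at this
      exact this
    · intro h
      rw [h.2, hk, min_eq_left (h.le hi hZ hM hs)] at hT
      exact_mod_cast hT
  have hrees : reesMixedMultiplicity (fun j : Fin (i + m) =>
      (if (j : ℕ) < i then Z.map (polyGerm (i + m)) else 𝔪) ^ s) = ((s ^ m * k : ℕ) : ℕ∞) := by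
    refine le_antisymm (iSup₂_le fun r hr => ?_) ?_
    · refine Nat.cast_le.2 ?_
      have hT := truncatedMixedMultiplicity_eq hi hZ hM hs hr
      have : (truncatedMixedMultiplicity (fun j : Fin (i + m) =>
          (if (j : ℕ) < i then Z.map (polyGerm (i + m)) else 𝔪) ^ s) r : ℚ) ≤ (s ^ m * k : ℕ) := by
        rw [hT]
        push_cast
        have h1 := mul_le_mul_of_nonneg_left (hle hr)
          (by positivity : (0 : ℚ) ≤ ((min s r : ℕ) : ℚ) ^ m)
        have h2 := mul_le_mul_of_nonneg_right (hmin r) (Nat.cast_nonneg (α := ℚ) k)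
        push_cast at h1 h2
        exact h1.trans h2
      exact_mod_cast this
    · obtain ⟨r, hr⟩ := exists_isTruncationOrder (i := i) (m := m) hZ s
      refine le_iSup₂_of_le r hr.1 ?_
      rw [(hiff hr.1).2 hr]
  rw [mixedOrder, hrees]
  congr 1
  ext r
  refine ⟨fun h => (hiff h.1).1 (by exact_mod_cast h.2.symm), fun h => ⟨h.1, ?_⟩⟩
  rw [(hiff h.1).2 h]

theorem lojasiewiczSeq_map_eq (hi : 1 ≤ i) (hZ : IsVarsPrimary Z) (hM : Z ≤ varsIdeal ℂ (i + m)) :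
    lojasiewiczSeq (i + m) i (Z.map (polyGerm (i + m))) = polyLojasiewicz i m Z := by
  rw [lojasiewiczSeq, mixedLojasiewicz]
  refine le_antisymm (le_polyLojasiewicz hZ fun s r hs h => ?_)
    (le_csInf (Set.nonempty_of_mem ⟨1, le_rfl, rfl⟩) ?_)
  · refine le_trans (csInf_le ⟨0, ?_⟩ ⟨s, hs, rfl⟩) ?_
    · rintro _ ⟨s, -, rfl⟩
      positivity
    · rw [mixedOrder_eq hi hZ hM hs]
      refine div_le_div_of_nonneg_right ?_ (Nat.cast_nonneg s)
      exact_mod_cast Nat.sInf_le h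
  · rintro _ ⟨s, hs, rfl⟩
    rw [mixedOrder_eq hi hZ hM hs]
    exact polyLojasiewicz_le hs (Nat.sInf_mem (exists_isTruncationOrder hZ s))

/-- An integral equation for `x` puts `x ^ (k + 1)` in the extension of `A (A + (x)) ^ k`; this
ideal is primary, so membership descends to polynomials. -/
theorem isReductionOf_of_subset_integralClosure {n : ℕ} {A B : Ideal (MvPolynomial (Fin n) ℂ)}
    (hA : IsVarsPrimary A)
    (h : ∀ y ∈ B.map (polyGerm n), y ∈ idealIntegralClosure (A.map (polyGerm n))) :
    IsReductionOf A B := by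
  refine .of_forall_pow_mem hA fun x hx => ?_
  obtain ⟨k, hk, a, ha, e⟩ := h _ (Ideal.mem_map_of_mem _ hx)
  obtain ⟨k, rfl⟩ := Nat.exists_eq_add_of_le' hk
  refine ⟨k, ?_⟩
  have hW : IsVarsPrimary (A * (A ⊔ Ideal.span {x}) ^ k) := hA.mul ((hA.mono le_sup_left).pow k)
  rw [← comap_map_polyGerm hW, Ideal.mem_comap, map_pow, eq_neg_of_add_eq_zero_left e]
  refine neg_mem (sum_mem fun j hj => ?_)
  have hj' := Finset.mem_Icc.1 hj
  have h1 : A ^ j * Ideal.span {x} ^ (k + 1 - j) ≤ A * (A ⊔ Ideal.span {x}) ^ k := by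
    obtain ⟨j, rfl⟩ := Nat.exists_eq_add_of_le' hj'.1
    rw [pow_succ', mul_assoc]
    refine Ideal.mul_mono_right ?_
    obtain ⟨l, rfl⟩ := Nat.exists_eq_add_of_le (show j ≤ k by omega)
    rw [show j + l + 1 - (j + 1) = l by omega, pow_add]
    exact Ideal.mul_mono (Ideal.pow_right_mono le_sup_left j) (Ideal.pow_right_mono le_sup_right l)
  refine Ideal.map_mono h1 ?_
  rw [Ideal.map_mul, Ideal.map_pow, ← map_pow]
  refine Ideal.mul_mem_mul (ha j hj) (Ideal.mem_map_of_mem _ ?_)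
  exact Ideal.pow_mem_pow (Ideal.mem_span_singleton_self x) _

theorem subset_idealIntegralClosure {R : Type*} [CommRing R] (I : Ideal R) {y : R} (hy : y ∈ I) :
    y ∈ idealIntegralClosure I := by
  refine ⟨1, le_rfl, fun _ => -y, fun j hj => ?_, by simp⟩
  obtain rfl : j = 1 := by simpa using hj
  rw [pow_one]
  exact neg_mem hy

theorem exists_eq_map_polyGerm {n : ℕ} {I : Ideal (holomorphicGerms n)} (hI : I ≠ ⊤)
    (h : HasFiniteColength I) : ∃ Z, IsVarsPrimary Z ∧ Z ≤ varsIdeal ℂ n ∧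
      Z.map (polyGerm n) = I := by
  obtain ⟨q, hq⟩ := exists_pow_le_of_hasFiniteColength h
  refine ⟨I.comap (polyGerm n), isVarsPrimary_comap hq, ?_, map_comap_polyGerm hq⟩
  have := comap_polyGerm_pow (n := n) 1
  rw [pow_one, pow_one] at this
  rw [← this]
  exact Ideal.comap_mono (IsLocalRing.le_maximalIdeal hI)

end MixedMultiplicityGerms

/-! ### The main theorem -/

theorem theorem3p3 (n : ℕ) (I J : Ideal (holomorphicGerms n))
    (hI : I ≠ ⊤) (hJ : J ≠ ⊤) (hIfin : HasFiniteColength I) (hJfin : HasFiniteColength J)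
    (i : ℕ) (hi1 : 1 ≤ i) (hin : i ≤ n) :
    lojasiewiczSeq n i (I * J) ≤ lojasiewiczSeq n i I + lojasiewiczSeq n i J ∧
    (ProjectivelyEquivalent I J ∨ J = IsLocalRing.maximalIdeal (holomorphicGerms n) →
      lojasiewiczSeq n i (I * J) = lojasiewiczSeq n i I + lojasiewiczSeq n i J) ∧
    lojasiewiczSeq n i (IsLocalRing.maximalIdeal (holomorphicGerms n) * I) =
      lojasiewiczSeq n i I + 1 := by
  obtain ⟨m, rfl⟩ := Nat.exists_eq_add_of_le hin
  obtain ⟨Z, hZ, hZM, rfl⟩ := exists_eq_map_polyGerm hI hIfin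
  obtain ⟨W, hW, hWM, rfl⟩ := exists_eq_map_polyGerm hJ hJfin
  have hV : IsVarsPrimary (varsIdeal ℂ (i + m)) := ⟨1, by simp⟩
  have hVZ : lojasiewiczSeq (i + m) i
      (IsLocalRing.maximalIdeal (holomorphicGerms (i + m)) * Z.map (polyGerm (i + m))) =
      lojasiewiczSeq (i + m) i (Z.map (polyGerm (i + m))) + 1 := by
    rw [← map_polyGerm_vars, ← Ideal.map_mul,
      lojasiewiczSeq_map_eq hi1 (hV.mul hZ) Ideal.mul_le_left, lojasiewiczSeq_map_eq hi1 hZ hZM,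
      polyLojasiewicz_vars_mul hi1 hZ hZM]
  refine ⟨?_, ?_, hVZ⟩
  · rw [← Ideal.map_mul, lojasiewiczSeq_map_eq hi1 (hZ.mul hW) (Ideal.mul_le_left.trans hZM),
      lojasiewiczSeq_map_eq hi1 hZ hZM, lojasiewiczSeq_map_eq hi1 hW hWM]
    exact polyLojasiewicz_mul_le hZ hZM hW hWM
  · rintro (⟨a, b, ha, hb, hab⟩ | h)
    · rw [← Ideal.map_mul, lojasiewiczSeq_map_eq hi1 (hZ.mul hW) (Ideal.mul_le_left.trans hZM),
        lojasiewiczSeq_map_eq hi1 hZ hZM, lojasiewiczSeq_map_eq hi1 hW hWM]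
      rw [← Ideal.map_pow, ← Ideal.map_pow] at hab
      have h1 : IsReductionOf (Z ^ a) (W ^ b) :=
        isReductionOf_of_subset_integralClosure (hZ.pow a) fun y hy =>
          hab ▸ subset_idealIntegralClosure _ hy
      have h2 : IsReductionOf (W ^ b) (Z ^ a) :=
        isReductionOf_of_subset_integralClosure (hW.pow b) fun y hy =>
          hab ▸ subset_idealIntegralClosure _ hy
      -- The two reduction relations need not be inclusions; adding `Z ^ a` or `W ^ b` to both sides
      -- gives reductions of the common ideal `Z ^ a + W ^ b`.
      refine polyLojasiewicz_mul_eq hZ hZM hW hWM ha hb ?_ ?_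
      · have := h1.sup (Z ^ a)
        rwa [sup_idem, sup_comm] at this
      · have := h2.sup (W ^ b)
        rwa [sup_idem] at this
    · rw [h, mul_comm, hVZ, ← map_polyGerm_vars, lojasiewiczSeq_map_eq hi1 hV le_rfl,
        polyLojasiewicz_vars hi1]
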